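/- Let $0<\alpha\le\beta$, let $a:\mathbb R^2\to[\alpha,\beta]$ be Borel measurable and $\mathbb Z^2$-periodic, and let $f(y,M)=a(y)|M|^2$ for $y\in\mathbb R^2$, $M\in\mathbb R^{2\times2}$, where $|M|$ is the Euclidean (Frobenius) norm. **Notation.** Write $Q=(0,1)^2$ and $A_{r,R}=\{x\in\mathbb R^2: r<|x|<R\}$; for $s\in\mathcal S^1$ let $s^\perp=(-s^2,s^1)$. Let $\mathbb A^{\hom}$ be the symmetric $2\times2$ matrix with $$\langle\mathbb A^{\hom}\xi,\xi\rangle=\inf\Big\{\int_Q a(y)|\xi+\nabla\varphi(y)|^2\,dy:\ \varphi\in W^{1,\infty}_{\rm per}(Q)\Big\}\qquad(\xi\in\mathbb R^2).$$ For $s\in\mathcal S^1$ and $M=s^\perp\otimes\xi$ with $\xi\in\mathbb R^2$, let $$Tf_{\hom}(s,M)=\lim_{t\to+\infty}\inf\Big\{\frac1{t^2}\int_{tQ}f(y,M+\nabla\phi(y))\,dy:\ \phi\in W^{1,\infty}_0(tQ;\mathbb R s^\perp)\Big\}.$$ For $z\in\mathbb Z$ and $0<r<R$ let $\mathscr A_{r,R}(z)$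 be the set of all $w\in H^1(A_{r,R};\mathcal S^1)$ such that the trace of $w$ on $\partial B_r$ (a map in $H^{1/2}(\partial B_r;\mathcal S^1)$) has degree $z$, where $\deg(h,\partial B_r)=\frac1{2\pi}\int_{\partial B_r}h\cdot\partial_\tau(h_2,-h_1)\,d\mathcal H^1$ in the sense of the $H^{1/2}$–$H^{-1/2}$ duality. Put $$\psi_{r,R}(z)=\frac1{\log (R/r)}\inf_{w\in\mathscr A_{r,R}(z)}\int_{A_{r,R}}Tf_{\hom}(w,\nabla w)\,dx,\qquad \psi(z)=\lim_{R/r\to+\infty}\psi_{r,R}(z),$$ $$\Psi(z;Tf_{\hom})=\inf\Big\{\sum_{j=1}^J\psi(z_j):\ J\ge1,\ z_j\in\mathbb Z,\ \sum_{j=1}^Jz_j=z\Big\}.$$ **Proposition.** The matrix $\mathbb A^{\hom}$ is well defined and $\det\mathbb A^{\hom}>0$; the limits defining $Tf_{\hom}(s,s^\perp\otimes\xi)$ (for all $s\in\mathcal S^1$, $\xi\in\mathbb R^2$) and $\psi(z)$ (for all $z\in\mathbb Z$) exist; and for every $z\in\mathbb Z$ $$\psi(z)=2\pi\sqrt{\det\mathbb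 A^{\hom}}\;z^2,\qquad \Psi(z;Tf_{\hom})=2\pi\sqrt{\det\mathbb A^{\hom}}\;|z|.$$ -/

import Mathlib

open MeasureTheory Filter Topology Set
open scoped ContDiff ENNReal

noncomputable section

namespace VortexHom

/-- The Euclidean plane `ℝ²`. -/
abbrev Plane : Type := EuclideanSpace ℝ (Fin 2)

/-- The space `ℝ^{2×2}`; for a gradient `∇w`, the entry `(i, j)` is `∂ⱼ wⁱ`. -/
abbrev Mat : Type := Matrix (Fin 2) (Fin 2) ℝ

/-- The coordinate vector `eⱼ`. -/
def e (j : Fin 2) : Plane := EuclideanSpace.single j (1 : ℝ)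

/-- The square `|M|²` of the Euclidean (Frobenius) norm of a matrix. -/
def frobSq (M : Mat) : ℝ := ∑ i, ∑ j, M i j ^ 2

/-- `s^⊥ = (-s², s¹)`. -/
def perp (s : Plane) : Plane := !₂[-(s 1), s 0]

/-- `p ⊗ ξ`, the matrix with entries `pᵢ ξⱼ`. -/
def tensor (p ξ : Plane) : Mat := Matrix.of fun i j => p i * ξ j

/-- The open square `tQ = (0, t)²`. -/
def square (t : ℝ) : Set Plane := {y | ∀ i, 0 < y i ∧ y i < t}

/-- The annulus `A_{r,R} = B_R \ closure B_r`, centred at the origin. -/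
def annulus (r R : ℝ) : Set Plane := {x | r < ‖x‖ ∧ ‖x‖ < R}

/-- `u` is `(0,1)²`-periodic, i.e. invariant under the translations by `ℤ²`. -/
def IsPeriodic (u : Plane → ℝ) : Prop :=
  ∀ (k : Fin 2 → ℤ) (y : Plane), u (y + WithLp.toLp 2 fun i => (k i : ℝ)) = u y

/-! ### Weak derivatives and Sobolev spaces -/

/-- `v` is the weak partial derivative `∂ⱼ u` in the open set `Ω`. -/
def IsWeakPartial (Ω : Set Plane) (j : Fin 2) (u v : Plane → ℝ) : Prop :=
  LocallyIntegrableOn u Ω volume ∧ LocallyIntegrableOn v Ω volume ∧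
    ∀ η : Plane → ℝ, ContDiff ℝ ∞ η → HasCompactSupport η → tsupport η ⊆ Ω →
      ∫ x in Ω, u x * fderiv ℝ η x (e j) = -∫ x in Ω, v x * η x

/-- `u ∈ W^{1,p}(Ω)` with weak gradient `g` (scalar functions). -/
def MemW1p (p : ℝ≥0∞) (Ω : Set Plane) (u : Plane → ℝ) (g : Plane → Plane) : Prop :=
  MemLp u p (volume.restrict Ω) ∧ MemLp g p (volume.restrict Ω) ∧
    ∀ j, IsWeakPartial Ω j u fun x => g x j

/-- `w ∈ W^{1,p}(Ω; ℝ²)` with weak gradient `G`. -/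
def MemW1pVec (p : ℝ≥0∞) (Ω : Set Plane) (w : Plane → Plane) (G : Plane → Mat) : Prop :=
  ∀ i, MemW1p p Ω (fun x => w x i) fun x => WithLp.toLp 2 (G x i)

/-- `φ ∈ W^{1,∞}_per((0,1)²)`, as a periodic function on `ℝ²`, with weak gradient `g`. -/
def MemW1infPer (φ : Plane → ℝ) (g : Plane → Plane) : Prop :=
  IsPeriodic φ ∧ MemW1p ⊤ univ φ g

/-- `φ ∈ W^{1,∞}_0(tQ; T_s S¹)` with weak gradient `Φ`: the function `φ`, extended by `0` outside
the square `tQ`, is in `W^{1,∞}(ℝ²; ℝ²)`, and it takes values in the line `T_s S¹ = ℝ s^⊥`. -/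
def MemW1infZero (t : ℝ) (s : Plane) (φ : Plane → Plane) (Φ : Plane → Mat) : Prop :=
  MemW1pVec ⊤ univ φ Φ ∧ (∀ y, y ∉ square t → φ y = 0) ∧ ∀ y, ∃ c : ℝ, φ y = c • perp s

/-- `w ∈ H¹(E; S¹)` with weak gradient `G`. -/
def MemH1Circle (E : Set Plane) (w : Plane → Plane) (G : Plane → Mat) : Prop :=
  MemW1pVec 2 E w G ∧ ∀ᵐ x ∂(volume.restrict E), ‖w x‖ = 1

/-! ### Homogenized matrix and tangential homogenization -/

/-- `inf {∫_{(0,1)²} a |ξ + ∇φ|² : φ ∈ W^{1,∞}_per((0,1)²)}`. -/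
def cellEnergy (a : Plane → ℝ) (ξ : Plane) : ℝ :=
  sInf {E : ℝ | ∃ φ g, MemW1infPer φ g ∧ E = ∫ y in square 1, a y * ‖ξ + g y‖ ^ 2}

/-- The matrix `𝔸^hom` of the quadratic form `cellEnergy a`, written by polarization. -/
def Ahom (a : Plane → ℝ) : Mat :=
  Matrix.of fun i j => (cellEnergy a (e i + e j) - cellEnergy a (e i - e j)) / 4

/-- `inf {t⁻² ∫_{tQ} f(y, M + ∇φ(y)) dy : φ ∈ W^{1,∞}_0(tQ; T_s S¹)}`. -/
def tangentialCell (f : Plane → Mat → ℝ) (s : Plane) (M : Mat) (t : ℝ) : ℝ :=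
  sInf {E : ℝ | ∃ φ Φ, MemW1infZero t s φ Φ ∧
    E = 1 / t ^ 2 * ∫ y in square t, f y (M + Φ y)}

/-- The tangential homogenization `Tf_hom(s, M)`. -/
def TfHom (f : Plane → Mat → ℝ) (s : Plane) (M : Mat) : ℝ :=
  limUnder atTop (tangentialCell f s M)

/-! ### Traces and degree -/

/-- The circle `ℝ / 2πℤ`, which parametrizes `∂B_r` by the angle, counterclockwise. -/
abbrev Angle : Type := AddCircle (2 * Real.pi)

instance instFactTwoPiPos : Fact (0 < 2 * Real.pi) := ⟨Real.two_pi_pos⟩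

/-- The point `r (cos θ, sin θ)` of `∂B_r`. -/
def circlePoint (r : ℝ) (θ : Angle) : Plane :=
  !₂[r * (AddCircle.toCircle θ : ℂ).re, r * (AddCircle.toCircle θ : ℂ).im]

/-- The identification of `ℝ²` with `ℂ`. -/
def toC (p : Plane) : ℂ := ⟨p 0, p 1⟩

/-- `h` is the trace on `∂B_r` of the `H¹` map `w` with weak gradient `G` in `A_{r,R}`: it is the
`L²(∂B_r)`-limit of the restrictions to `∂B_r` of maps smooth up to the boundary that converge
to `w` in `H¹(A_{r,R}; ℝ²)`. -/
def IsInnerTrace (r R : ℝ) (w : Plane → Plane) (G : Plane → Mat) (h : Angle → ℂ) : Prop :=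
  ∃ v : ℕ → Plane → Plane, (∀ n, ContDiff ℝ ∞ (v n)) ∧
    Tendsto (fun n => eLpNorm (fun x => v n x - w x) 2 (volume.restrict (annulus r R)))
      atTop (𝓝 0) ∧
    (∀ i j, Tendsto (fun n => eLpNorm (fun x => fderiv ℝ (v n) x (e j) i - G x i j) 2
      (volume.restrict (annulus r R))) atTop (𝓝 0)) ∧
    Tendsto (fun n => eLpNorm (fun θ => toC (v n (circlePoint r θ)) - h θ) 2 volume)
      atTop (𝓝 0)

/-- `h ∈ H^{1/2}(∂B_r; S¹)`: the Gagliardo seminorm on the circle is, up to a constant factor,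
the square root of `∑ |k| |ĥ(k)|²`. -/
def MemHHalfCircle (h : Angle → ℂ) : Prop :=
  AEStronglyMeasurable h volume ∧ (∀ᵐ θ, ‖h θ‖ = 1) ∧
    Summable fun k : ℤ => |(k : ℝ)| * ‖fourierCoeff h k‖ ^ 2

/-- The `H^{1/2}`-`H^{-1/2}` duality `∫_{∂B_r} u · ∂_τ v dℋ¹ = ∫_0^{2π} u · ∂_θ v dθ`, expressed
through the Fourier coefficients of `u`, `v`; the coefficients of `∂_θ v` are `i k v̂(k)`. -/
def halfDuality (u v : Angle → ℂ) : ℝ :=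
  2 * Real.pi * ∑' k : ℤ,
    (fourierCoeff u k * (starRingEnd ℂ) (Complex.I * (k : ℂ) * fourierCoeff v k)).re

/-- The degree `(1/2π) ∫_{∂B_r} h · ∂_τ (h₂, -h₁) dℋ¹` of an `S¹`-valued `H^{1/2}` map; in complex
notation `(h₂, -h₁) = -i h`. -/
def circleDegree (h : Angle → ℂ) : ℝ :=
  1 / (2 * Real.pi) * halfDuality h fun θ => -Complex.I * h θ

/-- `w ∈ H¹(A_{r,R}; S¹)`, with weak gradient `G`, has degree `z` on `∂B_r`. -/
def Admissible (r R : ℝ) (z : ℤ) (w : Plane → Plane) (G : Plane → Mat) : Prop :=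
  MemH1Circle (annulus r R) w G ∧
    ∃ h, IsInnerTrace r R w G h ∧ MemHHalfCircle h ∧ circleDegree h = z

/-! ### The cost of a singularity -/

/-- `ψ_{r,R}(z; h)`: the minimal energy `∫_{A_{r,R}} h(w, ∇w)` over the maps of degree `z`,
divided by `log (R/r)`. -/
def psiAnnulus (h : Plane → Mat → ℝ) (z : ℤ) (r R : ℝ) : ℝ :=
  1 / Real.log (R / r) *
    sInf {E : ℝ | ∃ w G, Admissible r R z w G ∧ E = ∫ x in annulus r R, h (w x) (G x)}

/-- The filter `R/r → +∞` on the pairs `(r, R)` with `0 < r < R`. -/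
def fatAnnuli : Filter (ℝ × ℝ) :=
  comap (fun p => p.2 / p.1) atTop ⊓ 𝓟 {p | 0 < p.1 ∧ p.1 < p.2}

/-- `ψ(z; h) = lim_{R/r → +∞} ψ_{r,R}(z; h)`. -/
def psi (h : Plane → Mat → ℝ) (z : ℤ) : ℝ :=
  limUnder fatAnnuli fun p => psiAnnulus h z p.1 p.2

/-- `Ψ(z; h) = inf {∑_{j=1}^J ψ(zⱼ; h) : ∑_{j=1}^J zⱼ = z}`. -/
def Psi (h : Plane → Mat → ℝ) (z : ℤ) : ℝ :=
  sInf {E : ℝ | ∃ (J : ℕ) (ζ : Fin J → ℤ), 0 < J ∧ ∑ j, ζ j = z ∧ E = ∑ j, psi h (ζ j)}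

end VortexHom

end

noncomputable section

namespace VortexHom

/-! The whole problem reduces to one positive definite quadratic form. Competitors of the periodic
cell problem can be added, so the parallelogram law passes from the integrand to the infimum
(`cellEnergy_parallelogram`), and a homogeneous nonnegative function with this law is a quadratic
form. It is coercive, hence has positive determinant `D²`.

In the tangential problem every competitor is a scalar function times the fixed unit vector `s^⊥`,
and `|s^⊥ ⊗ (ξ + ∇c)| = |ξ + ∇c|`. What remains is a scalar problem on large squares with zero
boundary values. Averaging over lattice translates makes such a function periodic without raising
the energy (`exists_periodic_of_zero`), and cutting off a periodic function costs only a boundary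
layer (`exists_zero_of_periodic`). Therefore `Tf_hom(s, s^⊥ ⊗ ξ) = ⟨Aξ, ξ⟩`, whatever `s` is
(`tendsto_tangentialCell`).

An `S¹`-valued `H¹` map satisfies `∇w = w^⊥ ⊗ ξ` almost everywhere, so its energy is `∫ ⟨Aξ, ξ⟩`.
The degree enters through `ξ`: if `H` vanishes on the outer circle and equals `L` on the inner one,
Stokes' theorem and `det ∇w = 0` give `∫ ∇H × ξ = -2π z L` (`SmoothApprox.setIntegral_cross`). This
is proved for smooth approximations and passed to the limit. On the inner circle the limit rests on
a trace inequality in Fourier coefficients, where the degree is `∑ k |ĥ(k)|²`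
(`tendsto_circulation`).

Let `q` be the quadratic form of the adjugate of `A`. The lower bound is convex duality
(`IsEllipticForm.duality_le`) with `H` a regularized, truncated logarithm of `q`, so that its level
lines are the ellipses adapted to `A`. Since `∫ D / q dθ = 2π` over the unit circle, this gives `2π
D z² log(R/r)` up to an additive error independent of `r` and `R`. The upper bound is attained by
the phase `(ζ/|ζ|)^z`, where `ζ` is a linear map carrying the ellipses to circles; its energy is
exactly `2π D z² log(R/r)` (`IsEllipticForm.setIntegral_vortex`). Dividing by `log(R/r)` squeezes
the cost.

Finally `|k| ≤ k²` on integers, with equality for charges `0` and `±1`, so the optimal decomposition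
of `z` consists of `|z|` unit charges. -/

/-! ### Quadratic forms on the plane and the optimal splitting of a charge. -/

theorem plane_eq (x : Plane) : x = x 0 • e 0 + x 1 • e 1 := by
  ext i; fin_cases i <;> simp [e]

/-- A nonnegative, `2`-homogeneous function on the plane which satisfies the parallelogram law is
a quadratic form. -/
theorem eq_quadratic_of_parallelogram (q : Plane → ℝ)
    (hpar : ∀ x y, q (x + y) + q (x - y) = 2 * q x + 2 * q y)
    (hhom : ∀ (t : ℝ) x, q (t • x) = t ^ 2 * q x) (hnn : ∀ x, 0 ≤ q x) (ξ : Plane) :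
    q ξ = q (e 0) * ξ 0 ^ 2 + q (e 1) * ξ 1 ^ 2
      + (q (e 0 + e 1) - q (e 0 - e 1)) / 2 * (ξ 0 * ξ 1) := by
  have h0 : q 0 = 0 := by simpa using hhom 0 0
  have hneg : ∀ x, q (-x) = q x := fun x => by simpa using hhom (-1) x
  -- Jordan–von Neumann argument. With `B x y = q (x + y) - q (x - y)`, two parallelogram laws give
  -- a midpoint identity for `B` in its first slot; together with doubling it becomes additivity.
  have key : ∀ x x' y, q (x + x' + y) - q (x + x' - y) + (q (x - x' + y) - q (x - x' - y))
      = 2 * (q (x + y) - q (x - y)) := by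
    intro x x' y
    have h1 := hpar (x + y) x'
    have h2 := hpar (x - y) x'
    rw [show x + x' + y = x + y + x' by abel, show x - x' + y = x + y - x' by abel,
      show x + x' - y = x - y + x' by abel, show x - x' - y = x - y - x' by abel]
    linarith
  have hdouble : ∀ x y, q ((2 : ℝ) • x + y) - q ((2 : ℝ) • x - y) = 2 * (q (x + y) - q (x - y)) := by
    intro x y
    have := key x x y
    rw [two_smul]
    simp only [sub_self, zero_add, zero_sub, hneg] at this
    linarith
  have hadd : ∀ x x' y, q (x + x' + y) - q (x + x' - y)
      = (q (x + y) - q (x - y)) + (q (x' + y) - q (x' - y)) := by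
    intro x x' y
    have h1 := key ((1 / 2 : ℝ) • (x + x')) ((1 / 2 : ℝ) • (x - x')) y
    have h2 := hdouble ((1 / 2 : ℝ) • (x + x')) y
    rw [← smul_add, ← smul_sub, show x + x' + (x - x') = (2 : ℝ) • x by rw [two_smul]; abel,
      show x + x' - (x - x') = (2 : ℝ) • x' by rw [two_smul]; abel, smul_smul, smul_smul] at h1
    rw [smul_smul] at h2
    norm_num at h1 h2
    linarith
  have hlin : ∀ (t : ℝ) x y, q (t • x + y) - q (t • x - y) = t * (q (x + y) - q (x - y)) := by
    intro t x y
    let F : ℝ →+ ℝ :=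
      { toFun := fun s => q (s • x + y) - q (s • x - y)
        map_zero' := by simp [hneg]
        map_add' := fun s t => by
          change q ((s + t) • x + y) - q ((s + t) • x - y) = _
          rw [add_smul, hadd] }
    -- An additive function bounded near `0` is continuous, hence linear. Nonnegativity of `q` gives
    -- the bound: a difference of nonnegative terms is dominated by their sum, which the
    -- parallelogram law computes.
    have hFb : ∀ s : ℝ, |s| ≤ 1 → |F s| ≤ 2 * q x + 2 * q y := by
      intro s hs
      have h1 := hpar (s • x) y
      have h2 : s ^ 2 ≤ 1 := by rw [sq_le_one_iff_abs_le_one]; exact hs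
      have h3 := hnn (s • x + y)
      have h4 := hnn (s • x - y)
      rw [hhom] at h1
      have h5 := mul_le_mul_of_nonneg_right h2 (hnn x)
      change |q (s • x + y) - q (s • x - y)| ≤ _
      rw [abs_le]; constructor <;> linarith
    have hFc : Continuous F := by
      refine continuous_of_continuousAt_zero F ?_
      rw [Metric.continuousAt_iff]
      intro ε hε
      obtain ⟨n, hn⟩ := exists_nat_gt ((2 * q x + 2 * q y) / ε)
      have hC : 0 ≤ 2 * q x + 2 * q y := by have := hnn x; have := hnn y; positivity
      have hn0 : (0 : ℝ) < n := lt_of_le_of_lt (by positivity) hn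
      refine ⟨1 / n, by positivity, fun {s} hs => ?_⟩
      rw [map_zero, dist_zero_right, Real.norm_eq_abs] at *
      have h1 : |(n : ℝ) * s| ≤ 1 := by
        rw [abs_mul, abs_of_pos hn0]
        have := mul_lt_mul_of_pos_left hs hn0
        rw [mul_one_div_cancel hn0.ne'] at this
        exact this.le
      have h2 := hFb _ h1
      rw [← nsmul_eq_mul, map_nsmul, nsmul_eq_mul, abs_mul, abs_of_pos hn0] at h2
      rw [div_lt_iff₀ hε] at hn
      nlinarith
    have := (F.toRealLinearMap hFc).map_smul t 1
    simp only [AddMonoidHom.coe_toRealLinearMap, smul_eq_mul, mul_one] at this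
    have h1 : F 1 = q (x + y) - q (x - y) := by
      change q ((1 : ℝ) • x + y) - q ((1 : ℝ) • x - y) = _
      rw [one_smul]
    rw [← h1, ← this]; rfl
  have hsymm : ∀ x y, q (x + y) - q (x - y) = q (y + x) - q (y - x) := by
    intro x y
    rw [add_comm, ← hneg (x - y), neg_sub]
  have h1 := hpar (ξ 0 • e 0) (ξ 1 • e 1)
  have h2 := hlin (ξ 0) (e 0) (ξ 1 • e 1)
  have h3 := hlin (ξ 1) (e 1) (e 0)
  rw [hsymm (e 0), h3, hsymm (e 1)] at h2
  rw [hhom, hhom] at h1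
  rw [← plane_eq ξ] at h1 h2
  linear_combination h1 / 2 + h2 / 2

theorem isSymm_Ahom (a : Plane → ℝ)
    (hneg : ∀ x, cellEnergy a (-x) = cellEnergy a x) : (Ahom a).IsSymm := by
  ext i j
  simp only [Ahom, Matrix.transpose_apply, Matrix.of_apply]
  rw [add_comm, ← hneg (e j - e i), neg_sub]

/-- The polarization formula also yields the diagonal: `e j - e j` has energy `0` and `e j + e j`
has four times the energy of `e j`. -/
theorem sum_Ahom_eq (a : Plane → ℝ)
    (hpar : ∀ x y, cellEnergy a (x + y) + cellEnergy a (x - y) =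
      2 * cellEnergy a x + 2 * cellEnergy a y)
    (hhom : ∀ (t : ℝ) x, cellEnergy a (t • x) = t ^ 2 * cellEnergy a x)
    (hnn : ∀ x, 0 ≤ cellEnergy a x) (ξ : Plane) :
    ∑ i, ∑ j, Ahom a i j * ξ i * ξ j = cellEnergy a ξ := by
  have h0 : cellEnergy a 0 = 0 := by simpa using hhom 0 0
  have hneg : ∀ x, cellEnergy a (-x) = cellEnergy a x := fun x => by simpa using hhom (-1) x
  have hd : ∀ j, cellEnergy a (e j + e j) = 4 * cellEnergy a (e j) := fun j => by
    rw [← two_smul ℝ, hhom]; norm_num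
  rw [eq_quadratic_of_parallelogram (cellEnergy a) hpar hhom hnn ξ]
  simp only [Fin.sum_univ_two, Ahom, Matrix.of_apply, hd, sub_self, h0]
  rw [add_comm (e 1) (e 0), ← hneg (e 1 - e 0), neg_sub]
  ring

theorem det_pos_of_coercive (A : Mat) (hs : A.IsSymm) {α : ℝ} (hα : 0 < α)
    (h : ∀ ξ : Plane, α * ‖ξ‖ ^ 2 ≤ ∑ i, ∑ j, A i j * ξ i * ξ j) :
    0 < A 0 0 ∧ 0 < A 1 1 ∧ 0 < A.det := by
  have hs' : A 1 0 = A 0 1 := hs.apply 0 1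
  have hn : ∀ x y : ℝ, α * (x ^ 2 + y ^ 2) ≤ A 0 0 * x ^ 2 + 2 * A 0 1 * x * y + A 1 1 * y ^ 2 := by
    intro x y
    have := h !₂[x, y]
    rw [EuclideanSpace.norm_sq_eq] at this
    simp [Fin.sum_univ_two, hs'] at this
    linarith
  have h1 := hn 1 0
  have h2 := hn 0 1
  -- At this vector the form equals `A 0 0` times the determinant.
  have h3 := hn (A 0 1) (-A 0 0)
  have h00 : 0 < A 0 0 := by linarith
  refine ⟨h00, by linarith, ?_⟩
  rw [Matrix.det_fin_two, hs']
  have h4 : 0 < A 0 0 * (A 0 0 * A 1 1 - A 0 1 * A 0 1) := by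
    have : 0 < α * (A 0 1 ^ 2 + (-A 0 0) ^ 2) := by
      have : 0 < (-A 0 0) ^ 2 := by rw [neg_sq]; positivity
      positivity
    nlinarith
  exact (pos_iff_pos_of_mul_pos h4).mp h00

/-- On integers `|k| ≤ k²`, with equality at `±1`, so unit charges of the sign of `z` are optimal.
-/
theorem Psi_eq_of_psi_eq_sq (h : Plane → Mat → ℝ) {C : ℝ} (hC : 0 ≤ C)
    (hpsi : ∀ z : ℤ, psi h z = C * (z : ℝ) ^ 2) (z : ℤ) : Psi h z = C * |(z : ℝ)| := by
  have hlow : ∀ E ∈ {E : ℝ | ∃ (J : ℕ) (ζ : Fin J → ℤ), 0 < J ∧ ∑ j, ζ j = z ∧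
      E = ∑ j, psi h (ζ j)}, C * |(z : ℝ)| ≤ E := by
    rintro E ⟨J, ζ, -, hz, rfl⟩
    simp only [hpsi]
    rw [← Finset.mul_sum]
    refine mul_le_mul_of_nonneg_left ?_ hC
    rw [← hz]
    push_cast
    refine (Finset.abs_sum_le_sum_abs _ _).trans (Finset.sum_le_sum fun j _ => ?_)
    have h1 : |ζ j| ≤ ζ j ^ 2 := by
      rw [← sq_abs]
      exact Int.le_self_sq _
    exact_mod_cast h1
  have hmem : C * |(z : ℝ)| ∈ {E : ℝ | ∃ (J : ℕ) (ζ : Fin J → ℤ), 0 < J ∧ ∑ j, ζ j = z ∧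
      E = ∑ j, psi h (ζ j)} := by
    rcases eq_or_ne z 0 with rfl | hz
    -- Empty sums are excluded, so total charge `0` is realized by one null charge.
    · exact ⟨1, fun _ => 0, one_pos, by simp, by simp [hpsi]⟩
    · refine ⟨z.natAbs, fun _ => z.sign, Int.natAbs_pos.2 hz, ?_, ?_⟩
      · simpa [mul_comm] using Int.sign_mul_abs z
      · have h1 : ((z.sign : ℤ) : ℝ) ^ 2 = 1 := by
          rcases Int.sign_trichotomy z with h | h | h
          · simp [h]
          · exact absurd (Int.sign_eq_zero_iff_zero.1 h) hz
          · simp [h]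
        simp [hpsi, h1, Nat.cast_natAbs, mul_comm]
  exact le_antisymm (csInf_le ⟨_, hlow⟩ hmem) (le_csInf ⟨_, hmem⟩ hlow)

/-! ### Calculus of weak derivatives. -/

/-- The test function is supported in `Ω`, so both integrals extend to the plane, where integration
by parts has no boundary term. -/
theorem IsWeakPartial.of_contDiff {u : Plane → ℝ} (hu : ContDiff ℝ 1 u) (Ω : Set Plane)
    (j : Fin 2) : IsWeakPartial Ω j u fun x => fderiv ℝ u x (e j) := by
  have hd : Continuous fun x => fderiv ℝ u x (e j) :=
    (hu.continuous_fderiv one_ne_zero).clm_apply continuous_const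
  refine ⟨(hu.continuous.locallyIntegrable).locallyIntegrableOn _,
    hd.locallyIntegrable.locallyIntegrableOn _, fun η hη hc hs => ?_⟩
  have hη' : Continuous fun x => fderiv ℝ η x (e j) :=
    (hη.continuous_fderiv (by simp)).clm_apply continuous_const
  have hη'c : HasCompactSupport fun x => fderiv ℝ η x (e j) := hc.fderiv_apply ℝ (e j)
  have h0 : ∀ x, x ∉ Ω → η x = 0 := fun x hx =>
    image_eq_zero_of_notMem_tsupport fun h => hx (hs h)
  have h0' : ∀ x, x ∉ Ω → fderiv ℝ η x (e j) = 0 := fun x hx => by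
    rw [fderiv_of_notMem_tsupport (𝕜 := ℝ) fun h => hx (hs h)]; rfl
  rw [setIntegral_eq_integral_of_forall_compl_eq_zero fun x hx => by rw [h0' x hx, mul_zero],
    setIntegral_eq_integral_of_forall_compl_eq_zero fun x hx => by rw [h0 x hx, mul_zero]]
  refine integral_mul_fderiv_eq_neg_fderiv_mul_of_integrable ?_ ?_ ?_
    (fun x _ => (hu.differentiable one_ne_zero).differentiableAt)
    (fun x _ => (hη.differentiable (by simp)).differentiableAt)
  · exact (hd.mul hη.continuous).integrable_of_hasCompactSupport hc.mul_left
  · exact (hu.continuous.mul hη').integrable_of_hasCompactSupport hη'c.mul_left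
  · exact (hu.continuous.mul hη.continuous).integrable_of_hasCompactSupport hc.mul_left

/-- A weak partial derivative on the whole plane. -/
theorem isWeakPartial_univ_iff {j : Fin 2} {u v : Plane → ℝ} :
    IsWeakPartial univ j u v ↔ LocallyIntegrable u ∧ LocallyIntegrable v ∧
      ∀ η : Plane → ℝ, ContDiff ℝ ∞ η → HasCompactSupport η →
        ∫ x, u x * fderiv ℝ η x (e j) = -∫ x, v x * η x := by
  simp [IsWeakPartial, locallyIntegrableOn_univ]

theorem continuous_fderiv_apply_e {η : Plane → ℝ} (hη : ContDiff ℝ ∞ η) (j : Fin 2) :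
    Continuous fun x => fderiv ℝ η x (e j) :=
  (hη.continuous_fderiv (by simp)).clm_apply continuous_const

theorem LocallyIntegrable.integrable_mul_right {u η : Plane → ℝ} (hu : LocallyIntegrable u)
    (hη : Continuous η) (hc : HasCompactSupport η) : Integrable fun x => u x * η x := by
  simpa [mul_comm] using hu.integrable_smul_left_of_hasCompactSupport hη hc

theorem IsWeakPartial.congr {j : Fin 2} {u v u' v' : Plane → ℝ} (h : IsWeakPartial univ j u v)
    (hu : u =ᵐ[volume] u') (hv : v =ᵐ[volume] v') : IsWeakPartial univ j u' v' := by
  rw [isWeakPartial_univ_iff] at h ⊢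
  refine ⟨h.1.congr hu, h.2.1.congr hv, fun η hη hc => ?_⟩
  refine Eq.trans (integral_congr_ae ?_) ((h.2.2 η hη hc).trans (congrArg Neg.neg
    (integral_congr_ae ?_)))
  · filter_upwards [hu] with x hx using by rw [hx]
  · filter_upwards [hv] with x hx using by rw [hx]

theorem IsWeakPartial.const_mul {j : Fin 2} {u v : Plane → ℝ} (h : IsWeakPartial univ j u v)
    (c : ℝ) : IsWeakPartial univ j (fun x => c * u x) fun x => c * v x := by
  rw [isWeakPartial_univ_iff] at h ⊢
  refine ⟨h.1.smul c, h.2.1.smul c, fun η hη hc => ?_⟩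
  simp only [mul_assoc, integral_const_mul]
  rw [h.2.2 η hη hc, mul_neg]

theorem IsWeakPartial.add {j : Fin 2} {u v u' v' : Plane → ℝ} (h : IsWeakPartial univ j u v)
    (h' : IsWeakPartial univ j u' v') :
    IsWeakPartial univ j (fun x => u x + u' x) fun x => v x + v' x := by
  rw [isWeakPartial_univ_iff] at h h' ⊢
  refine ⟨h.1.add h'.1, h.2.1.add h'.2.1, fun η hη hc => ?_⟩
  have hd := continuous_fderiv_apply_e hη j
  have hdc : HasCompactSupport fun x => fderiv ℝ η x (e j) := hc.fderiv_apply ℝ (e j)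
  simp only [add_mul]
  rw [integral_add (LocallyIntegrable.integrable_mul_right h.1 hd hdc)
      (LocallyIntegrable.integrable_mul_right h'.1 hd hdc),
    integral_add (LocallyIntegrable.integrable_mul_right h.2.1 hη.continuous hc)
      (LocallyIntegrable.integrable_mul_right h'.2.1 hη.continuous hc),
    h.2.2 η hη hc, h'.2.2 η hη hc, neg_add]

theorem IsWeakPartial.finset_sum {ι : Type*} {j : Fin 2} {u v : ι → Plane → ℝ} (s : Finset ι)
    (h : ∀ i ∈ s, IsWeakPartial univ j (u i) (v i)) :
    IsWeakPartial univ j (fun x => ∑ i ∈ s, u i x) fun x => ∑ i ∈ s, v i x := by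
  classical
  induction s using Finset.induction_on with
  | empty =>
    simp only [Finset.sum_empty]
    simpa using IsWeakPartial.of_contDiff (u := fun _ => 0) contDiff_const univ j
  | insert i s hi ih =>
    simp only [Finset.sum_insert hi]
    exact (h i (by simp)).add (ih fun k hk => h k (by simp [hk]))

theorem IsWeakPartial.translate {j : Fin 2} {u v : Plane → ℝ} (h : IsWeakPartial univ j u v)
    (k : Plane) : IsWeakPartial univ j (fun x => u (x + k)) fun x => v (x + k) := by
  have hmp := measurePreserving_add_right (volume : Measure Plane) k
  have hli : ∀ w : Plane → ℝ, LocallyIntegrable w → LocallyIntegrable fun x => w (x + k) := by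
    intro w hw
    rw [locallyIntegrable_iff] at hw ⊢
    intro K hK
    have h1 := hw _ (hK.image (continuous_add_const k))
    have h2 := hmp.integrableOn_comp_preimage (MeasurableEquiv.addRight k).measurableEmbedding
      (f := w) (s := (fun x => x + k) '' K)
    rw [Set.preimage_image_eq _ (add_left_injective k)] at h2
    exact h2.2 h1
  rw [isWeakPartial_univ_iff] at h ⊢
  refine ⟨hli _ h.1, hli _ h.2.1, fun η hη hc => ?_⟩
  have h1 := h.2.2 (fun x => η (x - k)) (hη.comp (contDiff_id.sub contDiff_const))
    (hc.comp_homeomorph (Homeomorph.subRight k))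
  rw [← integral_add_right_eq_self _ k, ← integral_add_right_eq_self (fun x => v x * _) k] at h1
  simpa [fderiv_comp_sub] using h1

/-- Weak differentiability is a local property. -/
theorem IsWeakPartial.of_forall_ball {j : Fin 2} {u v : Plane → ℝ}
    (h : ∀ r : ℝ, ∃ u' v', IsWeakPartial univ j u' v' ∧ ∀ x, ‖x‖ ≤ r → u x = u' x ∧ v x = v' x) :
    IsWeakPartial univ j u v := by
  have hli : ∀ w : Plane → ℝ, (∀ r : ℝ, ∃ w', LocallyIntegrable w' ∧ ∀ x, ‖x‖ ≤ r → w x = w' x) →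
      LocallyIntegrable w := by
    intro w hw
    rw [locallyIntegrable_iff]
    intro K hK
    obtain ⟨r, hr⟩ := hK.isBounded.exists_norm_le
    obtain ⟨w', hw', heq⟩ := hw r
    exact ((locallyIntegrable_iff.1 hw') K hK).congr_fun (fun x hx => (heq x (hr x hx)).symm)
      hK.measurableSet
  rw [isWeakPartial_univ_iff]
  refine ⟨hli u fun r => ?_, hli v fun r => ?_, fun η hη hc => ?_⟩
  · obtain ⟨u', v', h1, h2⟩ := h r
    exact ⟨u', (isWeakPartial_univ_iff.1 h1).1, fun x hx => (h2 x hx).1⟩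
  · obtain ⟨u', v', h1, h2⟩ := h r
    exact ⟨v', (isWeakPartial_univ_iff.1 h1).2.1, fun x hx => (h2 x hx).2⟩
  · obtain ⟨r, hr⟩ := hc.isCompact.isBounded.exists_norm_le
    obtain ⟨u', v', h1, h2⟩ := h r
    have h3 := (isWeakPartial_univ_iff.1 h1).2.2 η hη hc
    convert h3 using 2
    · funext x
      by_cases hx : x ∈ tsupport η
      · rw [(h2 x (hr x hx)).1]
      · rw [fderiv_of_notMem_tsupport (𝕜 := ℝ) hx]; simp
    · congr 1
      funext x
      by_cases hx : x ∈ tsupport η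
      · rw [(h2 x (hr x hx)).2]
      · rw [image_eq_zero_of_notMem_tsupport hx]; simp

/-- Testing the derivative of `u` with `χ η` and expanding gives the Leibniz rule. -/
theorem IsWeakPartial.smooth_mul {j : Fin 2} {u v χ : Plane → ℝ} (h : IsWeakPartial univ j u v)
    (hχ : ContDiff ℝ ∞ χ) :
    IsWeakPartial univ j (fun x => χ x * u x) fun x => χ x * v x + fderiv ℝ χ x (e j) * u x := by
  have hχ' := continuous_fderiv_apply_e hχ j
  rw [isWeakPartial_univ_iff] at h ⊢
  have hmul : ∀ {w θ : Plane → ℝ}, LocallyIntegrable w → Continuous θ →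
      LocallyIntegrable fun x => θ x * w x := fun {w θ} hw hθ => by
    rw [← locallyIntegrableOn_univ] at hw ⊢
    exact hw.continuousOn_mul hθ.continuousOn isOpen_univ.isLocallyClosed
  refine ⟨hmul h.1 hχ.continuous, (hmul h.2.1 hχ.continuous).add (hmul h.1 hχ'), fun η hη hc => ?_⟩
  have h1 := h.2.2 (fun x => χ x * η x) (hχ.mul hη) hc.mul_left
  have hdx : ∀ x, fderiv ℝ (fun x => χ x * η x) x (e j)
      = χ x * fderiv ℝ η x (e j) + fderiv ℝ χ x (e j) * η x := fun x => by
    rw [fderiv_fun_mul (hχ.differentiable (by simp)).differentiableAt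
      (hη.differentiable (by simp)).differentiableAt]
    simp [mul_comm]
  have hd := continuous_fderiv_apply_e hη j
  have hdc : HasCompactSupport fun x => fderiv ℝ η x (e j) := hc.fderiv_apply ℝ (e j)
  have i1 : Integrable fun x => u x * (χ x * fderiv ℝ η x (e j)) :=
    LocallyIntegrable.integrable_mul_right h.1 (hχ.continuous.mul hd) hdc.mul_left
  have i2 : Integrable fun x => u x * (fderiv ℝ χ x (e j) * η x) :=
    LocallyIntegrable.integrable_mul_right h.1 (hχ'.mul hη.continuous) hc.mul_left
  have i3 : Integrable fun x => v x * (χ x * η x) :=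
    LocallyIntegrable.integrable_mul_right h.2.1 (hχ.continuous.mul hη.continuous) hc.mul_left
  simp only [hdx, mul_add] at h1
  rw [integral_add i1 i2] at h1
  have e1 : (fun x => χ x * u x * fderiv ℝ η x (e j)) =
      fun x => u x * (χ x * fderiv ℝ η x (e j)) := by funext x; ring
  have e2 : (fun x => (χ x * v x + fderiv ℝ χ x (e j) * u x) * η x) =
      fun x => v x * (χ x * η x) + u x * (fderiv ℝ χ x (e j) * η x) := by funext x; ring
  rw [e1, e2, integral_add i3 i2]
  linarith

theorem IsWeakPartial.ae_unique {j : Fin 2} {u v v' : Plane → ℝ} (h : IsWeakPartial univ j u v)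
    (h' : IsWeakPartial univ j u v') : v =ᵐ[volume] v' := by
  rw [isWeakPartial_univ_iff] at h h'
  refine ae_eq_of_integral_contDiff_smul_eq h.2.1 h'.2.1 fun η hη hc => ?_
  have h1 := h.2.2 η hη hc
  rw [h'.2.2 η hη hc] at h1
  simp only [smul_eq_mul, mul_comm (η _)]
  linarith

/-- Test functions supported off `K` see nothing of `u`. `K` must be closed for its complement to
carry enough of them; this is why the closed square appears later. -/
theorem IsWeakPartial.ae_eq_zero {j : Fin 2} {u v : Plane → ℝ} (h : IsWeakPartial univ j u v)
    {K : Set Plane} (hK : IsClosed K) (hu : ∀ x, x ∉ K → u x = 0) :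
    ∀ᵐ x, x ∉ K → v x = 0 := by
  rw [isWeakPartial_univ_iff] at h
  refine hK.isOpen_compl.ae_eq_zero_of_integral_contDiff_smul_eq_zero
    (h.2.1.locallyIntegrableOn _) fun η hη hc hs => ?_
  have h1 := h.2.2 η hη hc
  have h2 : ∀ x, u x * fderiv ℝ η x (e j) = 0 := fun x => by
    by_cases hx : x ∈ K
    · rw [fderiv_of_notMem_tsupport (𝕜 := ℝ) fun h => hs h hx]; simp
    · rw [hu x hx, zero_mul]
  simp only [h2, integral_zero] at h1
  simp only [smul_eq_mul, mul_comm (η _)]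
  linarith

/-! ### Squares -/

/-- The half-open square `[0, t)²`. -/
def halfOpenSquare (t : ℝ) : Set Plane := {y | ∀ i, 0 ≤ y i ∧ y i < t}

theorem measurableSet_square (t : ℝ) : MeasurableSet (square t) := by
  have : square t = ⋂ i, {y : Plane | 0 < y i} ∩ {y | y i < t} := by
    ext y; simp [square]
  rw [this]
  exact MeasurableSet.iInter fun i => (measurableSet_lt (by fun_prop) (by fun_prop)).inter
    (measurableSet_lt (by fun_prop) (by fun_prop))

theorem measurableSet_halfOpenSquare (t : ℝ) : MeasurableSet (halfOpenSquare t) := by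
  have : halfOpenSquare t = ⋂ i, {y : Plane | 0 ≤ y i} ∩ {y | y i < t} := by
    ext y; simp [halfOpenSquare]
  rw [this]
  exact MeasurableSet.iInter fun i => (measurableSet_le (by fun_prop) (by fun_prop)).inter
    (measurableSet_lt (by fun_prop) (by fun_prop))

theorem volume_openBox (l u : ℝ) :
    volume {y : Plane | ∀ i, l < y i ∧ y i < u} = ENNReal.ofReal (u - l) ^ 2 := by
  have h := (PiLp.volume_preserving_ofLp (Fin 2)).measure_preimage
    (s := Set.pi univ fun _ => Ioo l u) (MeasurableSet.univ_pi fun _ => measurableSet_Ioo).nullMeasurableSet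
  rw [volume_pi_pi] at h
  simp only [Real.volume_Ioo, Finset.prod_const, Finset.card_univ, Fintype.card_fin] at h
  rw [← h]
  congr 1
  ext y; simp

theorem volume_square (t : ℝ) : volume (square t) = ENNReal.ofReal t ^ 2 := by
  have h := volume_openBox 0 t
  rwa [sub_zero] at h

/-- Three squares are in play: the open one of the cell problems, the closed one for the support of
weak gradients, and the half-open one, which tiles. They differ by null sets. -/
theorem ae_eq_closedSquare (t : ℝ) :
    square t =ᵐ[volume] {y : Plane | ∀ i, 0 ≤ y i ∧ y i ≤ t} := by
  have h := (Measure.univ_pi_Ioo_ae_eq_Icc (μ := fun _ : Fin 2 => (volume : Measure ℝ))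
    (f := fun _ => 0) (g := fun _ => t))
  have h2 := (PiLp.volume_preserving_ofLp (Fin 2)).quasiMeasurePreserving.preimage_ae_eq h
  have e1 : WithLp.ofLp ⁻¹' (Set.pi univ fun _ : Fin 2 => Ioo 0 t) = square t := by
    ext y; simp [square]
  have e2 : WithLp.ofLp ⁻¹' (Icc (fun _ : Fin 2 => 0) fun _ => t)
      = {y : Plane | ∀ i, 0 ≤ y i ∧ y i ≤ t} := by
    ext y; simp [Pi.le_def, forall_and]
  rwa [e1, e2] at h2

theorem square_subset_halfOpenSquare {t T : ℝ} (h : t ≤ T) : square t ⊆ halfOpenSquare T :=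
  fun _ hy i => ⟨(hy i).1.le, (hy i).2.trans_le h⟩

theorem square_ae_eq_halfOpenSquare (t : ℝ) : square t =ᵐ[volume] halfOpenSquare t := by
  have h := ae_eq_closedSquare t
  filter_upwards [h.mem_iff] with y hy
  have : y ∈ square t ↔ y ∈ halfOpenSquare t :=
    ⟨fun h => square_subset_halfOpenSquare le_rfl h, fun h => hy.2 fun i => ⟨(h i).1, (h i).2.le⟩⟩
  exact propext this

theorem volume_halfOpenSquare (t : ℝ) : volume (halfOpenSquare t) = ENNReal.ofReal t ^ 2 := by
  rw [← measure_congr (square_ae_eq_halfOpenSquare t), volume_square]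

theorem volume_square_lt_top (t : ℝ) : volume (square t) < ⊤ := by
  rw [volume_square]; exact ENNReal.pow_lt_top ENNReal.ofReal_lt_top

theorem volume_halfOpenSquare_lt_top (t : ℝ) : volume (halfOpenSquare t) < ⊤ := by
  rw [volume_halfOpenSquare]; exact ENNReal.pow_lt_top ENNReal.ofReal_lt_top

instance (t : ℝ) : IsFiniteMeasure (volume.restrict (square t)) :=
  ⟨by simpa using volume_square_lt_top t⟩

theorem volume_real_square {t : ℝ} (ht : 0 ≤ t) : volume.real (square t) = t ^ 2 := by
  simp [Measure.real, volume_square, ENNReal.toReal_ofReal ht]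

theorem volume_real_halfOpenSquare {t : ℝ} (ht : 0 ≤ t) :
    volume.real (halfOpenSquare t) = t ^ 2 := by
  simp [Measure.real, volume_halfOpenSquare, ENNReal.toReal_ofReal ht]

/-- The vector of `ℤ²` with given coordinates. -/
def latticeVec (k : Fin 2 → ℤ) : Plane := WithLp.toLp 2 fun i => (k i : ℝ)

@[simp] theorem latticeVec_apply (k : Fin 2 → ℤ) (i : Fin 2) : latticeVec k i = k i := rfl

/-- The points of `ℤ² ∩ [0, T)²`. -/
def natVec {T : ℕ} (k : Fin 2 → Fin T) : Plane := latticeVec fun i => ((k i : ℕ) : ℤ)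

@[simp] theorem natVec_apply {T : ℕ} (k : Fin 2 → Fin T) (i : Fin 2) : natVec k i = (k i : ℕ) := by
  simp [natVec]

/-- The coordinatewise fractional part. -/
def fracPart (y : Plane) : Plane := WithLp.toLp 2 fun i => Int.fract (y i)

@[simp] theorem fracPart_apply (y : Plane) (i : Fin 2) : fracPart y i = Int.fract (y i) := rfl

theorem measurable_fracPart : Measurable fracPart := by
  refine (WithLp.measurable_toLp 2 _).comp (measurable_pi_lambda _ fun i => ?_)
  exact measurable_fract.comp (by fun_prop)

theorem fracPart_add_latticeVec (y : Plane) (k : Fin 2 → ℤ) :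
    fracPart (y + latticeVec k) = fracPart y := by
  ext i; simp

theorem fracPart_of_mem {y : Plane} (hy : y ∈ halfOpenSquare 1) : fracPart y = y := by
  ext i; simpa using Int.fract_eq_self.2 (hy i)

theorem IsPeriodic.add_latticeVec {u : Plane → ℝ} (h : IsPeriodic u) (y : Plane) (k : Fin 2 → ℤ) :
    u (y + latticeVec k) = u y := h k y

/-- Half-open unit cells tile `[0, T)²` exactly; the cell containing a point is read off from the
floors of its coordinates. -/
theorem setIntegral_halfOpenSquare_nat (T : ℕ) {F : Plane → ℝ}
    (hF : IntegrableOn F (halfOpenSquare T)) :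
    ∫ y in halfOpenSquare T, F y
      = ∑ k : Fin 2 → Fin T, ∫ y in halfOpenSquare 1, F (y + natVec k) := by
  have hpre : ∀ k : Fin 2 → Fin T, MeasurableSet ((fun y => y - natVec k) ⁻¹' halfOpenSquare 1) :=
    fun k => measurable_sub_const _ (measurableSet_halfOpenSquare 1)
  have hU : halfOpenSquare T = ⋃ k : Fin 2 → Fin T, (fun y => y - natVec k) ⁻¹' halfOpenSquare 1 := by
    ext y
    simp only [mem_iUnion, mem_preimage, halfOpenSquare, mem_ofPred_eq, PiLp.sub_apply, natVec_apply]
    constructor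
    · intro h
      refine ⟨fun i => ⟨⌊y i⌋₊, (Nat.floor_lt (h i).1).2 (h i).2⟩, fun i => ⟨?_, ?_⟩⟩
      · have := Nat.floor_le (h i).1
        simp only; linarith
      · have := Nat.lt_floor_add_one (y i)
        simp only; linarith
    · rintro ⟨k, hk⟩ i
      have h1 : ((k i : ℕ) : ℝ) + 1 ≤ T := by exact_mod_cast (k i).2
      have h2 : (0 : ℝ) ≤ (k i : ℕ) := Nat.cast_nonneg _
      constructor <;> linarith [(hk i).1, (hk i).2]
  have hd : Pairwise (Function.onFun Disjoint
      fun k : Fin 2 → Fin T => (fun y => y - natVec k) ⁻¹' halfOpenSquare 1) := by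
    intro k k' hkk
    refine Set.disjoint_left.2 fun y hy hy' => hkk ?_
    funext i
    have h1 := hy i
    have h2 := hy' i
    simp only [PiLp.sub_apply, natVec_apply] at h1 h2
    have h3 : ((k i : ℕ) : ℝ) < (k' i : ℕ) + 1 := by linarith
    have h4 : ((k' i : ℕ) : ℝ) < (k i : ℕ) + 1 := by linarith
    have h3' : (k i : ℕ) < (k' i : ℕ) + 1 := by exact_mod_cast h3
    have h4' : (k' i : ℕ) < (k i : ℕ) + 1 := by exact_mod_cast h4
    exact Fin.ext (by omega)
  conv_lhs => rw [hU]
  rw [integral_iUnion_fintype hpre hd fun k => hF.mono_set (by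
    rw [hU]; exact subset_iUnion (fun k : Fin 2 → Fin T =>
      (fun y => y - natVec k) ⁻¹' halfOpenSquare 1) k)]
  refine Finset.sum_congr rfl fun k _ => ?_
  have h := (measurePreserving_sub_right (volume : Measure Plane) (natVec k)).setIntegral_preimage_emb
    (MeasurableEquiv.subRight (natVec k)).measurableEmbedding (fun y => F (y + natVec k))
    (halfOpenSquare 1)
  simpa using h

/-! ### The energy of a gradient field -/

/-- `∫_S a |ξ + g|²`. -/
def gradEnergy (a : Plane → ℝ) (S : Set Plane) (ξ : Plane) (g : Plane → Plane) : ℝ :=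
  ∫ y in S, a y * ‖ξ + g y‖ ^ 2

theorem gradEnergy_nonneg {a : Plane → ℝ} (ha : ∀ y, 0 ≤ a y) (S : Set Plane) (ξ : Plane)
    (g : Plane → Plane) : 0 ≤ gradEnergy a S ξ g :=
  integral_nonneg fun y => mul_nonneg (ha y) (sq_nonneg _)

theorem integrableOn_gradEnergy {a : Plane → ℝ} (ham : Measurable a) {β : ℝ}
    (ha : ∀ y, 0 ≤ a y ∧ a y ≤ β) {S : Set Plane} (hS : volume S < ⊤) (ξ : Plane)
    {g : Plane → Plane} (hg : MemLp g ⊤ volume) :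
    IntegrableOn (fun y => a y * ‖ξ + g y‖ ^ 2) S := by
  have : IsFiniteMeasure (volume.restrict S) := ⟨by simpa using hS⟩
  have h1 : MemLp (fun y => ξ + g y) ⊤ (volume.restrict S) :=
    (memLp_const ξ).add (hg.mono_measure Measure.restrict_le_self)
  have h2 : Integrable (fun y => ‖ξ + g y‖ ^ 2) (volume.restrict S) :=
    (h1.mono_exponent le_top).integrable_norm_pow two_ne_zero
  refine h2.bdd_mul (c := β) ham.aestronglyMeasurable ?_
  filter_upwards with y
  rw [Real.norm_of_nonneg (ha y).1]; exact (ha y).2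

theorem gradEnergy_mono {a : Plane → ℝ} (ham : Measurable a) {β : ℝ}
    (ha : ∀ y, 0 ≤ a y ∧ a y ≤ β) {S S' : Set Plane} (hSS : S ⊆ S')
    (hfin : volume S' < ⊤) (ξ : Plane) {g : Plane → Plane} (hg : MemLp g ⊤ volume) :
    gradEnergy a S ξ g ≤ gradEnergy a S' ξ g :=
  setIntegral_mono_set (integrableOn_gradEnergy ham ha hfin ξ hg)
    (ae_of_all _ fun y => mul_nonneg (ha y).1 (sq_nonneg _)) (LE.le.eventuallyLE hSS)

/-! ### Functions vanishing outside a square -/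

/-- `c ∈ W^{1,∞}_0(tQ)` with weak gradient `G` (scalar functions). -/
def MemW1infZeroScalar (t : ℝ) (c : Plane → ℝ) (G : Plane → Plane) : Prop :=
  MemW1p ⊤ univ c G ∧ ∀ y, y ∉ square t → c y = 0

/-- Cutting a measurable representative to the part of `S` where it obeys its essential bound makes
bound and support hold at every point, which suits periodization, where values at translated points
are summed. -/
theorem exists_bounded_measurable_rep {E : Type*} [NormedAddCommGroup E] [MeasurableSpace E]
    [BorelSpace E] {F : Plane → E} (hF : MemLp F ⊤ volume) {S : Set Plane} (hS : MeasurableSet S)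
    (h0 : ∀ᵐ y, y ∉ S → F y = 0) :
    ∃ (F' : Plane → E) (C : ℝ), StronglyMeasurable F' ∧ 0 ≤ C ∧ (∀ y, ‖F' y‖ ≤ C) ∧
      (∀ y, y ∉ S → F' y = 0) ∧ F =ᵐ[volume] F' := by
  set C := (eLpNormEssSup F volume).toReal
  have hfin : eLpNormEssSup F volume ≠ ⊤ := by
    have := hF.2.ne
    rwa [eLpNorm_exponent_top] at this
  have hC : ∀ᵐ y, ‖F y‖ ≤ C := by
    filter_upwards [enorm_ae_le_eLpNormEssSup F volume] with y hy
    rw [← toReal_enorm]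
    exact ENNReal.toReal_mono hfin hy
  let F₀ := hF.1.mk F
  have hmeas : StronglyMeasurable F₀ := hF.1.stronglyMeasurable_mk
  have hset : MeasurableSet (S ∩ {y | ‖F₀ y‖ ≤ C}) :=
    hS.inter (measurableSet_le hmeas.norm.measurable measurable_const)
  refine ⟨(S ∩ {y | ‖F₀ y‖ ≤ C}).indicator F₀, C, hmeas.indicator hset, ENNReal.toReal_nonneg,
    fun y => ?_, fun y hy => ?_, ?_⟩
  · by_cases hy : y ∈ S ∩ {y | ‖F₀ y‖ ≤ C}
    · rw [indicator_of_mem hy]; exact hy.2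
    · rw [indicator_of_notMem hy, norm_zero]; exact ENNReal.toReal_nonneg
  · exact indicator_of_notMem (fun h => hy h.1) _
  · filter_upwards [hC, h0, hF.1.ae_eq_mk] with y h1 h2 h3
    by_cases hy : y ∈ S ∩ {y | ‖F₀ y‖ ≤ C}
    · rw [indicator_of_mem hy]; exact h3
    · rw [indicator_of_notMem hy]
      refine h2 fun hyS => hy ⟨hyS, ?_⟩
      change ‖F₀ y‖ ≤ C
      rw [show F₀ y = F y from h3.symm]
      exact h1

/-- Bounded measurable representatives of a function in `W^{1,∞}_0(tQ)` and of its gradient, which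
vanish outside the square. -/
theorem MemW1infZeroScalar.exists_rep {t : ℝ} {c : Plane → ℝ} {G : Plane → Plane}
    (h : MemW1infZeroScalar t c G) :
    ∃ (c' : Plane → ℝ) (G' : Plane → Plane) (C : ℝ), Measurable c' ∧ Measurable G' ∧ 0 ≤ C ∧
      (∀ y, ‖c' y‖ ≤ C) ∧ (∀ y, ‖G' y‖ ≤ C) ∧ (∀ y, y ∉ square t → c' y = 0) ∧
      (∀ y, y ∉ square t → G' y = 0) ∧ G =ᵐ[volume] G' ∧
      ∀ j, IsWeakPartial univ j c' fun y => G' y j := by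
  obtain ⟨⟨hc, hG, hw⟩, h0⟩ := h
  rw [Measure.restrict_univ] at hc hG
  have hcl : IsClosed {y : Plane | ∀ i, 0 ≤ y i ∧ y i ≤ t} := by
    simp only [ofPred_forall]
    have hi : ∀ i, Continuous fun y : Plane => y i := fun i => by fun_prop
    exact isClosed_iInter fun i => (isClosed_le continuous_const (hi i)).inter
      (isClosed_le (hi i) continuous_const)
  have hG0 : ∀ᵐ y, y ∉ square t → G y = 0 := by
    have h1 : ∀ j, ∀ᵐ y, y ∉ {y : Plane | ∀ i, 0 ≤ y i ∧ y i ≤ t} → G y j = 0 := fun j =>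
      (hw j).ae_eq_zero hcl fun x hx => h0 x fun hx' => hx fun i => ⟨(hx' i).1.le, (hx' i).2.le⟩
    filter_upwards [h1 0, h1 1, (ae_eq_closedSquare t).mem_iff] with y h2 h3 h4 hy
    have hy' := fun h => hy (h4.2 h)
    ext i; fin_cases i
    · exact h2 hy'
    · exact h3 hy'
  obtain ⟨c', C₁, m1, p1, b1, z1, e1⟩ :=
    exists_bounded_measurable_rep hc (measurableSet_square t) (ae_of_all _ h0)
  obtain ⟨G', C₂, m2, p2, b2, z2, e2⟩ :=
    exists_bounded_measurable_rep hG (measurableSet_square t) hG0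
  refine ⟨c', G', C₁ + C₂, m1.measurable, m2.measurable, by positivity, fun y => ?_, fun y => ?_,
    z1, z2, e2, fun j => (hw j).congr e1 ?_⟩
  · linarith [b1 y]
  · linarith [b2 y]
  · filter_upwards [e2] with y hy
    rw [hy]

theorem exists_cutoff (r : ℝ) : ∃ η : Plane → ℝ, ContDiff ℝ ∞ η ∧ HasCompactSupport η ∧
    (∀ x, ‖x‖ < r → η x = 1) ∧ ∀ x, ‖x‖ < r → fderiv ℝ η x = 0 := by
  let f : ContDiffBump (0 : Plane) := ⟨max r 1, max r 1 + 1, by positivity, by linarith⟩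
  have h1 : ∀ x, ‖x‖ < r → f x = 1 := fun x hx =>
    f.one_of_mem_closedBall (by
      rw [mem_closedBall_zero_iff]; exact (hx.trans_le (le_max_left _ _)).le)
  refine ⟨f, f.contDiff, f.hasCompactSupport, h1, fun x hx => ?_⟩
  have : f =ᶠ[𝓝 x] fun _ => 1 := by
    filter_upwards [(isOpen_lt continuous_norm continuous_const).mem_nhds hx] with y hy
    exact h1 y hy
  rw [this.fderiv_eq]; simp

theorem norm_lt_of_mem_square {t : ℝ} {y : Plane} (hy : y ∈ halfOpenSquare t) : ‖y‖ < 2 * t + 1 := by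
  have h0 := hy 0
  have h1 := hy 1
  refine lt_of_pow_lt_pow_left₀ 2 (by linarith) ?_
  rw [EuclideanSpace.norm_sq_eq, Fin.sum_univ_two, Real.norm_eq_abs, Real.norm_eq_abs, sq_abs, sq_abs]
  nlinarith

/-- The gradient has zero mean, so the cross term of `|ξ + G|²` integrates to zero, and `|G|²` can
be dropped. -/
theorem lower_bound_zero {a : Plane → ℝ} (ham : Measurable a) {α β : ℝ} (hα : 0 < α)
    (ha : ∀ y, α ≤ a y ∧ a y ≤ β) (ξ : Plane) {t : ℝ} (ht : 0 ≤ t) {c : Plane → ℝ}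
    {G : Plane → Plane} (h : MemW1infZeroScalar t c G) :
    α * t ^ 2 * ‖ξ‖ ^ 2 ≤ gradEnergy a (square t) ξ G := by
  have ha' : ∀ y, 0 ≤ a y ∧ a y ≤ β := fun y => ⟨hα.le.trans (ha y).1, (ha y).2⟩
  have hGL : MemLp G ⊤ volume := by simpa using h.1.2.1
  obtain ⟨c', G', C, -, m2, -, -, b2, z1, z2, e2, hw⟩ := h.exists_rep
  have hGL' : MemLp G' ⊤ volume := (memLp_congr_ae e2).1 hGL
  -- Zero mean follows by testing the weak derivative with a cutoff that is `1` on the square, where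
  -- its own derivative vanishes.
  have hGi : ∀ j, ∫ y in square t, G' y j = 0 := by
    intro j
    obtain ⟨η, hη, hc, h1, hd⟩ := exists_cutoff (2 * t + 1)
    have := (isWeakPartial_univ_iff.1 (hw j)).2.2 η hη hc
    have hl : ∀ y, c' y * fderiv ℝ η y (e j) = 0 := fun y => by
      by_cases hy : y ∈ square t
      · rw [hd y (norm_lt_of_mem_square (square_subset_halfOpenSquare le_rfl hy))]; simp
      · rw [z1 y hy, zero_mul]
    have hr : ∀ y, G' y j * η y = G' y j := fun y => by
      by_cases hy : y ∈ square t
      · rw [h1 y (norm_lt_of_mem_square (square_subset_halfOpenSquare le_rfl hy)), mul_one]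
      · rw [z2 y hy]; simp
    simp only [hl, hr, integral_zero] at this
    rw [setIntegral_eq_integral_of_forall_compl_eq_zero fun y hy => by rw [z2 y hy]; rfl]
    linarith
  have hE : gradEnergy a (square t) ξ G = gradEnergy a (square t) ξ G' := by
    refine integral_congr_ae (ae_restrict_of_ae ?_)
    filter_upwards [e2] with y hy
    rw [hy]
  have hint : ∀ j, IntegrableOn (fun y => G' y j) (square t) := by
    intro j
    have h1 : MemLp (fun y => G' y j) ⊤ (volume.restrict (square t)) := by
      refine MemLp.mono (hGL'.mono_measure Measure.restrict_le_self) ?_ (ae_of_all _ fun y => ?_)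
      · exact (Measurable.aestronglyMeasurable (by fun_prop))
      · exact PiLp.norm_apply_le _ _
    exact h1.integrable le_top
  have i1 : IntegrableOn (fun y => α * ‖ξ‖ ^ 2 + 2 * α * ξ 0 * G' y 0) (square t) :=
    (integrable_const _).add ((hint 0).const_mul _)
  have i2 : IntegrableOn (fun y => 2 * α * ξ 1 * G' y 1) (square t) := (hint 1).const_mul _
  rw [hE]
  calc α * t ^ 2 * ‖ξ‖ ^ 2
      = ∫ y in square t, (α * ‖ξ‖ ^ 2 + 2 * α * ξ 0 * G' y 0 + 2 * α * ξ 1 * G' y 1) := by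
        rw [integral_add i1 i2,
          integral_add (integrable_const _) ((hint 0).const_mul _), integral_const_mul (2 * α * ξ 0),
          integral_const_mul (2 * α * ξ 1), hGi, hGi, setIntegral_const, volume_real_square ht]
        simp; ring
    _ ≤ gradEnergy a (square t) ξ G' := by
        refine setIntegral_mono (i1.add i2) (integrableOn_gradEnergy ham ha' (volume_square_lt_top t) ξ hGL')
          fun y => ?_
        have h1 : α * ‖ξ + G' y‖ ^ 2 ≤ a y * ‖ξ + G' y‖ ^ 2 :=
          mul_le_mul_of_nonneg_right (ha y).1 (sq_nonneg _)
        refine le_trans ?_ h1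
        rw [EuclideanSpace.norm_sq_eq, EuclideanSpace.norm_sq_eq]
        simp only [Fin.sum_univ_two, Real.norm_eq_abs, sq_abs, PiLp.add_apply]
        have := mul_nonneg hα.le (add_nonneg (sq_nonneg (G' y 0)) (sq_nonneg (G' y 1)))
        nlinarith

/-! ### Periodization -/

/-- Averaging a field over the lattice points of `[0, T)²`, and extending it periodically. -/
def periodize (T : ℕ) {E : Type*} [AddCommMonoid E] [Module ℝ E] (F : Plane → E) (y : Plane) : E :=
  (1 / (T : ℝ) ^ 2) • ∑ k : Fin 2 → Fin T, F (fracPart y + natVec k)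

/-- The fractional part jumps across cell boundaries, so the left side cannot be differentiated term
by term. On a ball it agrees with a sum of translates over a range `M` independent of the point,
which can be. -/
theorem sum_natVec_eq_sum_latticeVec {T : ℕ} {F : Plane → ℝ}
    (hF : ∀ y, y ∉ halfOpenSquare T → F y = 0) {y : Plane} {M : ℤ} (hy : ‖y‖ + T + 1 ≤ M) :
    ∑ k : Fin 2 → Fin T, F (fracPart y + natVec k)
      = ∑ m ∈ Fintype.piFinset fun _ : Fin 2 => Finset.Icc (-M) M, F (y + latticeVec m) := by
  classical
  let ι : (Fin 2 → Fin T) → Fin 2 → ℤ := fun k i => ((k i : ℕ) : ℤ) - ⌊y i⌋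
  have hι : Function.Injective ι := fun k k' h => by
    funext i
    have := congrFun h i
    simp only [ι] at this
    exact Fin.ext (by omega)
  have h1 : ∀ k, y + latticeVec (ι k) = fracPart y + natVec k := fun k => by
    ext i
    simp only [PiLp.add_apply, latticeVec_apply, fracPart_apply, natVec_apply, ι, Int.fract]
    push_cast; ring
  have hsub : Finset.univ.image ι ⊆ Fintype.piFinset fun _ : Fin 2 => Finset.Icc (-M) M := by
    intro m hm
    obtain ⟨k, -, rfl⟩ := Finset.mem_image.1 hm
    rw [Fintype.mem_piFinset]
    intro i
    have ha := PiLp.norm_apply_le y i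
    rw [Real.norm_eq_abs, abs_le] at ha
    have hk : ((k i : ℕ) : ℝ) + 1 ≤ T := by exact_mod_cast (k i).2
    have hk0 : (0 : ℝ) ≤ (k i : ℕ) := Nat.cast_nonneg _
    have hf := Int.floor_le (y i)
    have hf' := Int.lt_floor_add_one (y i)
    rw [Finset.mem_Icc]
    constructor
    · have : (-M : ℝ) ≤ (k i : ℕ) - (⌊y i⌋ : ℤ) := by linarith
      exact_mod_cast this
    · have : ((k i : ℕ) : ℝ) - (⌊y i⌋ : ℤ) ≤ M := by linarith
      exact_mod_cast this
  rw [← Finset.sum_subset hsub, Finset.sum_image fun _ _ _ _ h => hι h]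
  · exact Finset.sum_congr rfl fun k _ => by rw [h1]
  · intro m _ hm
    refine hF _ fun hmem => hm (Finset.mem_image.2 ?_)
    have hb : ∀ i, 0 ≤ m i + ⌊y i⌋ ∧ m i + ⌊y i⌋ < T := by
      intro i
      have h2 := hmem i
      simp only [PiLp.add_apply, latticeVec_apply] at h2
      have hf := Int.floor_le (y i)
      have hf' := Int.lt_floor_add_one (y i)
      constructor
      · have : (-1 : ℝ) < ((m i + ⌊y i⌋ : ℤ) : ℝ) := by push_cast; linarith
        have : (-1 : ℤ) < m i + ⌊y i⌋ := by exact_mod_cast this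
        omega
      · have : ((m i + ⌊y i⌋ : ℤ) : ℝ) < T := by push_cast; linarith
        exact_mod_cast this
    refine ⟨fun i => ⟨(m i + ⌊y i⌋).toNat, by have := hb i; omega⟩, Finset.mem_univ _, ?_⟩
    funext i
    have := hb i
    simp only [ι]
    rw [Int.toNat_of_nonneg this.1]
    ring

theorem memW1infPer_periodize {T : ℕ} {c : Plane → ℝ} {G : Plane → Plane} {C : ℝ}
    (hc : Measurable c) (hG : Measurable G) (hcC : ∀ y, ‖c y‖ ≤ C) (hGC : ∀ y, ‖G y‖ ≤ C)
    (hc0 : ∀ y, y ∉ halfOpenSquare T → c y = 0) (hG0 : ∀ y, y ∉ halfOpenSquare T → G y = 0)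
    (hw : ∀ j, IsWeakPartial univ j c fun y => G y j) :
    MemW1infPer (periodize T c) (periodize T G) := by
  have hm : ∀ k : Fin 2 → Fin T, Measurable fun y => fracPart y + natVec k :=
    fun k => measurable_fracPart.add_const _
  refine ⟨fun k y => ?_, ?_, ?_, fun j => ?_⟩
  · have := fracPart_add_latticeVec y k
    simp only [latticeVec] at this
    simp only [periodize, this]
  · refine memLp_top_of_bound (C := ‖(1 / (T : ℝ) ^ 2)‖ * ∑ k : Fin 2 → Fin T, C) ?_
      (ae_of_all _ fun y => ?_)
    · exact ((Finset.measurable_sum Finset.univ fun k _ => hc.comp (hm k)).const_smul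
        (1 / (T : ℝ) ^ 2)).aestronglyMeasurable
    · rw [periodize, norm_smul]
      exact mul_le_mul_of_nonneg_left ((norm_sum_le _ _).trans (Finset.sum_le_sum fun k _ => hcC _))
        (norm_nonneg _)
  · refine memLp_top_of_bound (C := ‖(1 / (T : ℝ) ^ 2)‖ * ∑ k : Fin 2 → Fin T, C) ?_
      (ae_of_all _ fun y => ?_)
    · exact ((Finset.measurable_sum Finset.univ fun k _ => hG.comp (hm k)).const_smul
        (1 / (T : ℝ) ^ 2)).aestronglyMeasurable
    · rw [periodize, norm_smul]
      exact mul_le_mul_of_nonneg_left ((norm_sum_le _ _).trans (Finset.sum_le_sum fun k _ => hGC _))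
        (norm_nonneg _)
  · refine IsWeakPartial.of_forall_ball fun r => ?_
    obtain ⟨M, hM⟩ := exists_int_gt (r + T + 1)
    refine ⟨_, _, (IsWeakPartial.finset_sum
      (Fintype.piFinset fun _ : Fin 2 => Finset.Icc (-M) M)
      fun m _ => (hw j).translate (latticeVec m)).const_mul (1 / (T : ℝ) ^ 2), fun x hx => ?_⟩
    have hx' : ‖x‖ + T + 1 ≤ M := by linarith
    rw [← sum_natVec_eq_sum_latticeVec hc0 hx',
      ← sum_natVec_eq_sum_latticeVec (F := fun y => G y j) (fun y hy => by simp [hG0 y hy]) hx']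
    simp [periodize]

/-- Jensen's inequality for the squared norm: averaging translates does not raise the energy. -/
theorem norm_add_average_sq_le {ι E : Type*} [Fintype ι] [NormedAddCommGroup E] [NormedSpace ℝ E]
    {n : ℝ} (hn : (Fintype.card ι : ℝ) = n) (hn0 : 0 < n) (ξ : E) (v : ι → E) :
    n * ‖ξ + (1 / n) • ∑ k, v k‖ ^ 2 ≤ ∑ k, ‖ξ + v k‖ ^ 2 := by
  have h1 : ξ + (1 / n) • ∑ k, v k = (1 / n) • ∑ k, (ξ + v k) := by
    rw [Finset.sum_add_distrib, smul_add, Finset.sum_const, Finset.card_univ, ← Nat.cast_smul_eq_nsmul ℝ,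
      smul_smul, hn, one_div_mul_cancel hn0.ne', one_smul]
  rw [h1, norm_smul, mul_pow, Real.norm_of_nonneg (by positivity)]
  have h2 : ‖∑ k, (ξ + v k)‖ ^ 2 ≤ n * ∑ k, ‖ξ + v k‖ ^ 2 := by
    calc ‖∑ k, (ξ + v k)‖ ^ 2 ≤ (∑ k, ‖ξ + v k‖) ^ 2 :=
          pow_le_pow_left₀ (norm_nonneg _) (norm_sum_le _ _) 2
      _ ≤ _ := by
          have := sq_sum_le_card_mul_sum_sq (s := Finset.univ) (f := fun k => ‖ξ + v k‖)
          rwa [Finset.card_univ, hn] at this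
  calc n * ((1 / n) ^ 2 * ‖∑ k, (ξ + v k)‖ ^ 2)
      ≤ n * ((1 / n) ^ 2 * (n * ∑ k, ‖ξ + v k‖ ^ 2)) := by gcongr
    _ = ∑ k, ‖ξ + v k‖ ^ 2 := by field_simp

/-- A competitor on a large square induces a periodic one. -/
theorem exists_periodic_of_zero {a : Plane → ℝ} (ham : Measurable a) (hap : IsPeriodic a) {β : ℝ}
    (ha : ∀ y, 0 ≤ a y ∧ a y ≤ β) (ξ : Plane) {t : ℝ} (ht : 0 < t) {T : ℕ} (hT : t ≤ T)
    {c : Plane → ℝ} {G : Plane → Plane} (h : MemW1infZeroScalar t c G) :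
    ∃ φ g, MemW1infPer φ g ∧ (T : ℝ) ^ 2 * gradEnergy a (square 1) ξ g
      ≤ gradEnergy a (square t) ξ G + β * ‖ξ‖ ^ 2 * ((T : ℝ) ^ 2 - t ^ 2) := by
  obtain ⟨c', G', C, m1, m2, hC, b1, b2, z1, z2, e2, hw⟩ := h.exists_rep
  have hT0 : (0 : ℝ) < T := ht.trans_le hT
  have hsub := square_subset_halfOpenSquare hT
  have hper : MemW1infPer (periodize T c') (periodize T G') :=
    memW1infPer_periodize m1 m2 b1 b2 (fun y hy => z1 y fun h => hy (hsub h))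
      (fun y hy => z2 y fun h => hy (hsub h)) hw
  refine ⟨_, _, hper, ?_⟩
  have hL : MemLp G' ⊤ volume := memLp_top_of_bound m2.aestronglyMeasurable C (ae_of_all _ b2)
  have hLp : MemLp (periodize T G') ⊤ volume := by simpa using hper.2.2.1
  have hLk : ∀ k : Plane, MemLp (fun y => G' (y + k)) ⊤ volume := fun k =>
    memLp_top_of_bound (m2.comp (measurable_add_const k)).aestronglyMeasurable C
      (ae_of_all _ fun y => b2 _)
  have hak : ∀ (k : Fin 2 → Fin T) y, a (y + natVec k) = a y := fun k y =>
    hap.add_latticeVec y _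
  have hik : ∀ k : Fin 2 → Fin T, IntegrableOn (fun y => a (y + natVec k) *
      ‖ξ + G' (y + natVec k)‖ ^ 2) (halfOpenSquare 1) := fun k => by
    simp only [hak]
    exact integrableOn_gradEnergy ham ha (volume_halfOpenSquare_lt_top 1) ξ (hLk _)
  -- By periodicity `a` takes the same value at corresponding points of all `T²` cells, so Jensen
  -- applies pointwise on one cell.
  have step1 : (T : ℝ) ^ 2 * gradEnergy a (square 1) ξ (periodize T G')
      ≤ gradEnergy a (halfOpenSquare T) ξ G' := by
    have e1 : gradEnergy a (square 1) ξ (periodize T G')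
        = gradEnergy a (halfOpenSquare 1) ξ (periodize T G') :=
      setIntegral_congr_set (square_ae_eq_halfOpenSquare 1)
    rw [e1, gradEnergy, gradEnergy, setIntegral_halfOpenSquare_nat T
      (integrableOn_gradEnergy ham ha (volume_halfOpenSquare_lt_top _) ξ hL),
      ← integral_finsetSum _ fun k _ => hik k, ← integral_const_mul]
    refine setIntegral_mono_on ((integrableOn_gradEnergy ham ha (volume_halfOpenSquare_lt_top _) ξ
      hLp).const_mul _) (integrable_finsetSum _ fun k _ => hik k)
      (measurableSet_halfOpenSquare 1) fun y hy => ?_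
    simp only [hak, periodize, fracPart_of_mem hy]
    rw [← Finset.mul_sum, mul_left_comm]
    refine mul_le_mul_of_nonneg_left ?_ (ha y).1
    exact norm_add_average_sq_le (by simp) (by positivity) ξ fun k => G' (y + natVec k)
  refine step1.trans ?_
  have hd : halfOpenSquare T = square t ∪ (halfOpenSquare T \ square t) :=
    (union_sdiff_cancel hsub).symm
  have hI := integrableOn_gradEnergy ham ha (volume_halfOpenSquare_lt_top (T : ℝ)) ξ hL
  have e3 : gradEnergy a (square t) ξ G = gradEnergy a (square t) ξ G' := by
    refine integral_congr_ae (ae_restrict_of_ae ?_)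
    filter_upwards [e2] with y hy
    rw [hy]
  have hv : volume.real (halfOpenSquare T \ square t) = (T : ℝ) ^ 2 - t ^ 2 := by
    rw [measureReal_sdiff hsub (measurableSet_square t) (volume_halfOpenSquare_lt_top _).ne,
      volume_real_square ht.le, volume_real_halfOpenSquare hT0.le]
  rw [e3]
  conv_lhs => rw [gradEnergy, hd]
  rw [setIntegral_union disjoint_sdiff_right
    ((measurableSet_halfOpenSquare _).diff (measurableSet_square t)) (hI.mono_set hsub)
    (hI.mono_set sdiff_subset)]
  refine add_le_add le_rfl ?_
  have hfin : volume (halfOpenSquare T \ square t) ≠ ⊤ :=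
    ((measure_mono sdiff_subset).trans_lt (volume_halfOpenSquare_lt_top (T : ℝ))).ne
  -- On the frame between the two squares the gradient vanishes, leaving only `β |ξ|²`.
  calc ∫ y in halfOpenSquare T \ square t, a y * ‖ξ + G' y‖ ^ 2
      ≤ ∫ y in halfOpenSquare T \ square t, β * ‖ξ‖ ^ 2 := by
        refine setIntegral_mono_on (hI.mono_set sdiff_subset) (integrableOn_const hfin)
          ((measurableSet_halfOpenSquare _).diff (measurableSet_square t)) fun y hy => ?_
        rw [z2 y hy.2, add_zero]
        exact mul_le_mul_of_nonneg_right (ha y).2 (sq_nonneg _)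
    _ = _ := by rw [setIntegral_const, hv, smul_eq_mul, mul_comm]

/-! ### Cutting off a periodic function -/

/-- The gradient of a scalar function as a vector of the plane. -/
def gradVec (χ : Plane → ℝ) (y : Plane) : Plane := WithLp.toLp 2 fun j => fderiv ℝ χ y (e j)

@[simp] theorem gradVec_apply (χ : Plane → ℝ) (y : Plane) (j : Fin 2) :
    gradVec χ y j = fderiv ℝ χ y (e j) := rfl

theorem continuous_gradVec {χ : Plane → ℝ} (hχ : ContDiff ℝ ∞ χ) : Continuous (gradVec χ) :=
  (PiLp.continuous_toLp 2 _).comp (continuous_pi fun j => continuous_fderiv_apply_e hχ j)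

theorem exists_deriv_smoothTransition_bound :
    ∃ K, 0 ≤ K ∧ ∀ x, |deriv Real.smoothTransition x| ≤ K := by
  have hc : Continuous (deriv Real.smoothTransition) :=
    (Real.smoothTransition.contDiff (n := 1)).continuous_deriv le_rfl
  obtain ⟨K, hK⟩ := (isCompact_Icc (a := (0 : ℝ)) (b := 1)).exists_bound_of_continuousOn
    hc.continuousOn
  refine ⟨max K 0, le_max_right _ _, fun x => ?_⟩
  by_cases hx : x ∈ Icc (0 : ℝ) 1
  · exact (hK x hx).trans (le_max_left _ _)
  · have : deriv Real.smoothTransition x = 0 := by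
      rcases not_and_or.1 hx with h | h
      · have : Real.smoothTransition =ᶠ[𝓝 x] fun _ => 0 := by
          filter_upwards [Iio_mem_nhds (not_le.1 h)] with y hy
          exact Real.smoothTransition.zero_of_nonpos (le_of_lt hy)
        rw [this.deriv_eq, deriv_const]
      · have : Real.smoothTransition =ᶠ[𝓝 x] fun _ => 1 := by
          filter_upwards [Ioi_mem_nhds (not_le.1 h)] with y hy
          exact Real.smoothTransition.one_of_one_le (le_of_lt hy)
        rw [this.deriv_eq, deriv_const]
    rw [this, abs_zero]; exact le_max_right _ _

/-- The transition layer has width one for every `t`. Thus `K` is independent of `t`, and the layer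
has area of order `t`, negligible against `t²`. -/
theorem exists_cutoff_square : ∃ K : ℝ, 0 ≤ K ∧ ∀ t : ℝ, ∃ χ : Plane → ℝ, ContDiff ℝ ∞ χ ∧
    (∀ y, 0 ≤ χ y ∧ χ y ≤ 1) ∧ (∀ y, y ∉ square t → χ y = 0) ∧ (∀ y, ‖gradVec χ y‖ ≤ K) ∧
    ∀ y : Plane, (∀ i, 1 < y i ∧ y i < t - 1) → χ y = 1 ∧ gradVec χ y = 0 := by
  obtain ⟨K, hK0, hK⟩ := exists_deriv_smoothTransition_bound
  refine ⟨8 * K, by positivity, fun t => ?_⟩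
  let S := Real.smoothTransition
  let σ : ℝ → ℝ := fun x => S x * S (t - x)
  let σ' : ℝ → ℝ := fun x => deriv S x * S (t - x) - S x * deriv S (t - x)
  have hSd : ∀ x, HasDerivAt S (deriv S x) x := fun x =>
    ((Real.smoothTransition.contDiff (n := 1)).differentiable one_ne_zero x).hasDerivAt
  have hσd : ∀ x, HasDerivAt σ (σ' x) x := fun x => by
    have h1 := (hSd x).mul ((hSd (t - x)).comp_const_sub t x)
    exact h1.congr_deriv (by simp only [σ']; ring)
  have hσc : ContDiff ℝ ∞ σ := Real.smoothTransition.contDiff.mul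
    (Real.smoothTransition.contDiff.comp (contDiff_const.sub contDiff_id))
  have hS0 : ∀ x, 0 ≤ S x := Real.smoothTransition.nonneg
  have hS1 : ∀ x, S x ≤ 1 := Real.smoothTransition.le_one
  have hσ0 : ∀ x, 0 ≤ σ x := fun x => mul_nonneg (hS0 _) (hS0 _)
  have hσ1 : ∀ x, σ x ≤ 1 := fun x => mul_le_one₀ (hS1 _) (hS0 _) (hS1 _)
  have hσ'b : ∀ x, |σ' x| ≤ 2 * K := fun x => by
    have h1 : |deriv S x * S (t - x)| ≤ K * 1 := by
      rw [abs_mul, abs_of_nonneg (hS0 (t - x))]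
      exact mul_le_mul (hK x) (hS1 _) (hS0 _) hK0
    have h2 : |S x * deriv S (t - x)| ≤ 1 * K := by
      rw [abs_mul, abs_of_nonneg (hS0 x)]
      exact mul_le_mul (hS1 _) (hK _) (abs_nonneg _) zero_le_one
    refine (abs_sub _ _).trans ?_
    linarith
  have hcoord : ∀ i : Fin 2, ContDiff ℝ ∞ fun y : Plane => y i := fun i => by fun_prop
  let χ : Plane → ℝ := fun y => σ (y 0) * σ (y 1)
  have hχc : ContDiff ℝ ∞ χ := (hσc.comp (hcoord 0)).mul (hσc.comp (hcoord 1))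
  have hχd : ∀ y j, fderiv ℝ χ y (e j) = σ (y 0) * (σ' (y 1) * e j 1) + σ (y 1) * (σ' (y 0) * e j 0) := by
    intro y j
    have hi : ∀ i : Fin 2, HasFDerivAt (fun y : Plane => σ (y i))
        (σ' (y i) • (EuclideanSpace.proj i : Plane →L[ℝ] ℝ)) y := fun i =>
      HasDerivAt.comp_hasFDerivAt (f := fun y : Plane => y i) y (hσd (y i))
        (EuclideanSpace.proj i : Plane →L[ℝ] ℝ).hasFDerivAt
    have hχ2 : HasFDerivAt χ _ y := (hi 0).mul (hi 1)
    rw [hχ2.fderiv]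
    simp
  have hχb : ∀ y j, |fderiv ℝ χ y (e j)| ≤ 4 * K := by
    intro y j
    have he : ∀ i : Fin 2, |e j i| ≤ 1 := fun i => by
      fin_cases i <;> fin_cases j <;> simp [e]
    have hb : ∀ i i' : Fin 2, |σ (y i) * (σ' (y i') * e j i')| ≤ 1 * (2 * K * 1) := fun i i' => by
      rw [abs_mul (σ (y i)), abs_mul (σ' (y i')), abs_of_nonneg (hσ0 _)]
      exact mul_le_mul (hσ1 _) (mul_le_mul (hσ'b _) (he _) (abs_nonneg _) (by positivity))
        (by positivity) zero_le_one
    rw [hχd]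
    refine (abs_add_le _ _).trans ?_
    linarith [hb 0 1, hb 1 0]
  refine ⟨χ, hχc, fun y => ⟨mul_nonneg (hσ0 _) (hσ0 _), mul_le_one₀ (hσ1 _) (hσ0 _) (hσ1 _)⟩,
    fun y hy => ?_, fun y => ?_, fun y hy => ?_⟩
  · have h0 : ∀ i, ¬ (0 < y i ∧ y i < t) → σ (y i) = 0 := fun i hi => by
      simp only [σ]
      rcases not_and_or.1 hi with h | h
      · rw [show S (y i) = 0 from Real.smoothTransition.zero_of_nonpos (not_lt.1 h), zero_mul]
      · rw [show S (t - y i) = 0 from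
          Real.smoothTransition.zero_of_nonpos (sub_nonpos.2 (not_lt.1 h)), mul_zero]
    obtain ⟨i, hi⟩ := not_forall.1 hy
    have := h0 i hi
    fin_cases i
    · exact mul_eq_zero_of_left this _
    · exact mul_eq_zero_of_right _ this
  · refine le_of_sq_le_sq ?_ (by positivity) 
    rw [EuclideanSpace.norm_sq_eq, Fin.sum_univ_two]
    simp only [gradVec_apply, Real.norm_eq_abs]
    have h0 := pow_le_pow_left₀ (abs_nonneg _) (hχb y 0) 2
    have h1 := pow_le_pow_left₀ (abs_nonneg _) (hχb y 1) 2
    nlinarith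
  · have h1 : ∀ y : Plane, (∀ i, 1 < y i ∧ y i < t - 1) → χ y = 1 := fun y hy => by
      have : ∀ i, σ (y i) = 1 := fun i => by
        simp only [σ]
        rw [show S (y i) = 1 from Real.smoothTransition.one_of_one_le (hy i).1.le,
          show S (t - y i) = 1 from Real.smoothTransition.one_of_one_le (by linarith [(hy i).2]),
          one_mul]
      simp only [χ, this, one_mul]
    refine ⟨h1 y hy, ?_⟩
    have ho : IsOpen {y : Plane | ∀ i, 1 < y i ∧ y i < t - 1} := by
      simp only [ofPred_forall]
      have hi : ∀ i, Continuous fun y : Plane => y i := fun i => by fun_prop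
      exact isOpen_iInter_of_finite fun i => (isOpen_lt continuous_const (hi i)).inter
        (isOpen_lt (hi i) continuous_const)
    have : χ =ᶠ[𝓝 y] fun _ => 1 := by
      filter_upwards [ho.mem_nhds hy] with x hx using h1 x hx
    ext j
    rw [gradVec_apply, this.fderiv_eq]; simp

/-- Periodicity is imposed on `φ` only; its weak gradient inherits it almost everywhere by
uniqueness of weak derivatives. -/
theorem MemW1infPer.ae_periodic {φ : Plane → ℝ} {g : Plane → Plane} (h : MemW1infPer φ g)
    (k : Fin 2 → ℤ) : ∀ᵐ y, g (y + latticeVec k) = g y := by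
  have h1 : ∀ j, ∀ᵐ y, g (y + latticeVec k) j = g y j := fun j => by
    have h2 := (h.2.2.2 j).translate (latticeVec k)
    have h3 : (fun x => φ (x + latticeVec k)) = φ := funext fun x => h.1 k x
    rw [h3] at h2
    exact h2.ae_unique (h.2.2.2 j)
  filter_upwards [h1 0, h1 1] with y h2 h3
  ext i; fin_cases i
  · exact h2
  · exact h3

theorem gradEnergy_halfOpenSquare_nat {a : Plane → ℝ} (ham : Measurable a) (hap : IsPeriodic a)
    {β : ℝ} (ha : ∀ y, 0 ≤ a y ∧ a y ≤ β) (ξ : Plane) {φ : Plane → ℝ} {g : Plane → Plane}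
    (h : MemW1infPer φ g) (T : ℕ) :
    gradEnergy a (halfOpenSquare T) ξ g = (T : ℝ) ^ 2 * gradEnergy a (square 1) ξ g := by
  have hg : MemLp g ⊤ volume := by simpa using h.2.2.1
  have e1 : gradEnergy a (square 1) ξ g = gradEnergy a (halfOpenSquare 1) ξ g :=
    setIntegral_congr_set (square_ae_eq_halfOpenSquare 1)
  rw [e1, gradEnergy, setIntegral_halfOpenSquare_nat T
      (integrableOn_gradEnergy ham ha (volume_halfOpenSquare_lt_top _) ξ hg)]
  have : ∀ k : Fin 2 → Fin T, ∫ y in halfOpenSquare 1, a (y + natVec k) * ‖ξ + g (y + natVec k)‖ ^ 2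
      = gradEnergy a (halfOpenSquare 1) ξ g := fun k => by
    refine integral_congr_ae (ae_restrict_of_ae ?_)
    filter_upwards [h.ae_periodic fun i => ((k i : ℕ) : ℤ)] with y hy
    rw [natVec, hy, hap.add_latticeVec]
  simp [this]

/-- A periodic function induces competitors on large squares. -/
theorem exists_zero_of_periodic {a : Plane → ℝ} (ham : Measurable a) (hap : IsPeriodic a) {β : ℝ}
    (ha : ∀ y, 0 ≤ a y ∧ a y ≤ β) (ξ : Plane) {φ : Plane → ℝ} {g : Plane → Plane}
    (h : MemW1infPer φ g) : ∃ C : ℝ, ∀ t : ℝ, 2 ≤ t → ∃ c G, MemW1infZeroScalar t c G ∧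
      gradEnergy a (square t) ξ G ≤ (⌈t⌉₊ : ℝ) ^ 2 * gradEnergy a (square 1) ξ g + C * t := by
  obtain ⟨K, hK0, hK⟩ := exists_cutoff_square
  have hφL : MemLp φ ⊤ volume := by simpa using h.2.1
  have hgL : MemLp g ⊤ volume := by simpa using h.2.2.1
  obtain ⟨φ', C₁, -, hC₁, b₁, -, e₁⟩ := exists_bounded_measurable_rep hφL MeasurableSet.univ
    (ae_of_all _ fun y hy => absurd (mem_univ y) hy)
  obtain ⟨g', C₂, -, hC₂, b₂, -, e₂⟩ := exists_bounded_measurable_rep hgL MeasurableSet.univ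
    (ae_of_all _ fun y hy => absurd (mem_univ y) hy)
  have hφb : ∀ᵐ y, ‖φ y‖ ≤ C₁ := by filter_upwards [e₁] with y hy; rw [hy]; exact b₁ y
  have hgb : ∀ᵐ y, ‖g y‖ ≤ C₂ := by filter_upwards [e₂] with y hy; rw [hy]; exact b₂ y
  set B := ‖ξ‖ + (C₂ + C₁ * K) with hB
  have hβ : 0 ≤ β := (ha 0).1.trans (ha 0).2
  -- `B` bounds `|ξ + G|`, and `4 t` bounds the area `t² - (t - 2)²` of the layer.
  refine ⟨β * B ^ 2 * 4, fun t ht => ?_⟩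
  obtain ⟨χ, hχ, hχ01, hχ0, hχK, hχ1⟩ := hK t
  let G : Plane → Plane := fun y => χ y • g y + φ y • gradVec χ y
  have hGb : ∀ᵐ y, ‖G y‖ ≤ C₂ + C₁ * K := by
    filter_upwards [hφb, hgb] with y h1 h2
    refine (norm_add_le _ _).trans ?_
    rw [norm_smul, norm_smul]
    refine add_le_add ?_ (mul_le_mul h1 (hχK y) (norm_nonneg _) hC₁)
    rw [Real.norm_of_nonneg (hχ01 y).1]
    exact (mul_le_mul (hχ01 y).2 h2 (norm_nonneg _) zero_le_one).trans_eq (one_mul _)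
  have hGm : AEStronglyMeasurable G volume :=
    (hχ.continuous.aestronglyMeasurable.smul hgL.1).add
      (hφL.1.smul (continuous_gradVec hχ).aestronglyMeasurable)
  have hGL : MemLp G ⊤ volume := memLp_top_of_bound hGm _ hGb
  have hc : MemW1infZeroScalar t (fun y => χ y * φ y) G := by
    refine ⟨⟨?_, ?_, fun j => ?_⟩, fun y hy => by simp only [hχ0 y hy, zero_mul]⟩
    · rw [Measure.restrict_univ]
      refine memLp_top_of_bound (hχ.continuous.aestronglyMeasurable.mul hφL.1) C₁ ?_
      filter_upwards [hφb] with y h1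
      rw [norm_mul, Real.norm_of_nonneg (hχ01 y).1]
      exact (mul_le_mul (hχ01 y).2 h1 (norm_nonneg _) zero_le_one).trans_eq (one_mul _)
    · rwa [Measure.restrict_univ]
    · convert (h.2.2.2 j).smooth_mul hχ using 1
      funext y
      simp [G, mul_comm]
  refine ⟨_, G, hc, ?_⟩
  let I : Set Plane := {y | ∀ i, 1 < y i ∧ y i < t - 1}
  have hIm : MeasurableSet I := by
    have : I = ⋂ i, {y : Plane | 1 < y i} ∩ {y | y i < t - 1} := by
      ext y; simp [I]
    rw [this]
    exact MeasurableSet.iInter fun i => (measurableSet_lt (by fun_prop) (by fun_prop)).inter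
      (measurableSet_lt (by fun_prop) (by fun_prop))
  have hIs : I ⊆ square t := fun y hy i => ⟨by linarith [(hy i).1], by linarith [(hy i).2]⟩
  have hIv : volume.real I = (t - 2) ^ 2 := by
    have := volume_openBox 1 (t - 1)
    rw [Measure.real, this, ENNReal.toReal_pow, ENNReal.toReal_ofReal (by linarith)]
    ring
  have hint := integrableOn_gradEnergy ham ha (volume_square_lt_top t) ξ hGL
  have hfin : volume (square t \ I) ≠ ⊤ :=
    ((measure_mono sdiff_subset).trans_lt (volume_square_lt_top t)).ne
  have e1 : gradEnergy a (square t) ξ G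
      = gradEnergy a I ξ G + gradEnergy a (square t \ I) ξ G := by
    conv_lhs => rw [gradEnergy, ← union_sdiff_cancel hIs]
    exact setIntegral_union disjoint_sdiff_right ((measurableSet_square t).diff hIm)
      (hint.mono_set hIs) (hint.mono_set sdiff_subset)
  have e2 : gradEnergy a I ξ G = gradEnergy a I ξ g := by
    refine setIntegral_congr_fun hIm fun y hy => ?_
    simp [G, hχ1 y hy]
  -- The interior is enlarged to the `⌈t⌉²` full cells covering it, each of which costs the same.
  have e3 : gradEnergy a I ξ g ≤ (⌈t⌉₊ : ℝ) ^ 2 * gradEnergy a (square 1) ξ g := by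
    rw [← gradEnergy_halfOpenSquare_nat ham hap ha ξ h]
    exact gradEnergy_mono ham ha
      (hIs.trans (square_subset_halfOpenSquare (Nat.le_ceil t))) (volume_halfOpenSquare_lt_top _) ξ hgL
  have e4 : gradEnergy a (square t \ I) ξ G ≤ β * B ^ 2 * 4 * t := by
    calc gradEnergy a (square t \ I) ξ G ≤ ∫ y in square t \ I, β * B ^ 2 := by
          refine integral_mono_ae (hint.mono_set sdiff_subset) (integrableOn_const hfin)
            (ae_restrict_of_ae ?_)
          filter_upwards [hGb] with y hy
          refine mul_le_mul (ha y).2 (pow_le_pow_left₀ (norm_nonneg _) ?_ 2) (sq_nonneg _) hβ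
          exact (norm_add_le _ _).trans (add_le_add le_rfl hy)
      _ = β * B ^ 2 * (t ^ 2 - (t - 2) ^ 2) := by
          rw [setIntegral_const, measureReal_sdiff hIs hIm (volume_square_lt_top _).ne, hIv,
            volume_real_square (by linarith), smul_eq_mul, mul_comm]
      _ ≤ β * B ^ 2 * (4 * t) := by gcongr; nlinarith
      _ = _ := by ring
  linarith

/-! ### The homogenized quadratic form -/

theorem cellEnergy_le {a : Plane → ℝ} (ha : ∀ y, 0 ≤ a y) (ξ : Plane) {φ : Plane → ℝ}
    {g : Plane → Plane} (h : MemW1infPer φ g) : cellEnergy a ξ ≤ gradEnergy a (square 1) ξ g :=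
  csInf_le ⟨0, by rintro E ⟨φ, g, -, rfl⟩; exact gradEnergy_nonneg ha _ _ _⟩ ⟨φ, g, h, rfl⟩

theorem memW1infPer_zero : MemW1infPer (fun _ => 0) fun _ => 0 := by
  refine ⟨fun _ _ => rfl, MemLp.zero, MemLp.zero, fun j => ?_⟩
  simpa using IsWeakPartial.of_contDiff (u := fun _ => 0) contDiff_const univ j

theorem le_cellEnergy {a : Plane → ℝ} {ξ : Plane} {m : ℝ}
    (h : ∀ φ g, MemW1infPer φ g → m ≤ gradEnergy a (square 1) ξ g) : m ≤ cellEnergy a ξ :=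
  le_csInf ⟨_, _, _, memW1infPer_zero, rfl⟩ (by rintro E ⟨φ, g, hφ, rfl⟩; exact h φ g hφ)

theorem MemW1infPer.const_mul {φ : Plane → ℝ} {g : Plane → Plane} (h : MemW1infPer φ g) (t : ℝ) :
    MemW1infPer (fun y => t * φ y) fun y => t • g y :=
  ⟨fun k y => by simp only [h.1 k y], h.2.1.const_mul t, h.2.2.1.const_smul t,
    fun j => (h.2.2.2 j).const_mul t⟩

theorem MemW1infPer.add {φ φ' : Plane → ℝ} {g g' : Plane → Plane} (h : MemW1infPer φ g)
    (h' : MemW1infPer φ' g') : MemW1infPer (fun y => φ y + φ' y) fun y => g y + g' y :=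
  ⟨fun k y => by simp only [h.1 k y, h'.1 k y], h.2.1.add h'.2.1, h.2.2.1.add h'.2.2.1,
    fun j => (h.2.2.2 j).add (h'.2.2.2 j)⟩

theorem cellEnergy_nonneg {a : Plane → ℝ} (ha : ∀ y, 0 ≤ a y) (ξ : Plane) : 0 ≤ cellEnergy a ξ :=
  le_cellEnergy fun _ _ _ => gradEnergy_nonneg ha _ _ _

theorem cellEnergy_smul {a : Plane → ℝ} (ha : ∀ y, 0 ≤ a y) (t : ℝ) (ξ : Plane) :
    cellEnergy a (t • ξ) = t ^ 2 * cellEnergy a ξ := by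
  have hE : ∀ (t : ℝ) (ξ : Plane) (g : Plane → Plane),
      gradEnergy a (square 1) (t • ξ) (fun y => t • g y) = t ^ 2 * gradEnergy a (square 1) ξ g := by
    intro t ξ g
    rw [gradEnergy, gradEnergy, ← integral_const_mul]
    congr 1; funext y
    rw [← smul_add, norm_smul, mul_pow, Real.norm_eq_abs, sq_abs]; ring
  have hle : ∀ (t : ℝ) (ξ : Plane), t ≠ 0 → cellEnergy a (t • ξ) ≤ t ^ 2 * cellEnergy a ξ := by
    intro t ξ ht
    have : (t ^ 2)⁻¹ * cellEnergy a (t • ξ) ≤ cellEnergy a ξ := by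
      refine le_cellEnergy fun φ g h => ?_
      rw [inv_mul_le_iff₀ (by positivity), ← hE]
      exact cellEnergy_le ha _ (h.const_mul t)
    rwa [inv_mul_le_iff₀ (by positivity)] at this
  rcases eq_or_ne t 0 with rfl | ht
  · have h1 := cellEnergy_le ha (0 : Plane) memW1infPer_zero
    simp [gradEnergy] at h1
    simpa using le_antisymm h1 (cellEnergy_nonneg ha 0)
  · refine le_antisymm (hle t ξ ht) ?_
    have h1 := hle t⁻¹ (t • ξ) (inv_ne_zero ht)
    rw [smul_smul, inv_mul_cancel₀ ht, one_smul, inv_pow, ← div_eq_inv_mul,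
      le_div_iff₀ (by positivity)] at h1
    linarith

/-- If `φ` and `φ'` compete for `ξ` and `η`, then `φ ± φ'` compete for `ξ ± η`; the parallelogram
law in the integrand gives one inequality. The same inequality at `ξ + η` and `ξ - η`, with
homogeneity, is the reverse one. -/
theorem cellEnergy_parallelogram {a : Plane → ℝ} (ham : Measurable a) {β : ℝ}
    (ha : ∀ y, 0 ≤ a y ∧ a y ≤ β) (ξ η : Plane) :
    cellEnergy a (ξ + η) + cellEnergy a (ξ - η) = 2 * cellEnergy a ξ + 2 * cellEnergy a η := by
  have ha0 : ∀ y, 0 ≤ a y := fun y => (ha y).1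
  have hle : ∀ ξ η : Plane, cellEnergy a (ξ + η) + cellEnergy a (ξ - η)
      ≤ 2 * cellEnergy a ξ + 2 * cellEnergy a η := by
    intro ξ η
    have key : ∀ φ g φ' g', MemW1infPer φ g → MemW1infPer φ' g' →
        cellEnergy a (ξ + η) + cellEnergy a (ξ - η)
          ≤ 2 * gradEnergy a (square 1) ξ g + 2 * gradEnergy a (square 1) η g' := by
      intro φ g φ' g' h h'
      have hp := h.add h'
      have hm := h.add (h'.const_mul (-1))
      refine (add_le_add (cellEnergy_le ha0 _ hp) (cellEnergy_le ha0 _ hm)).trans_eq ?_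
      have hi : ∀ (ζ : Plane) {φ : Plane → ℝ} {g : Plane → Plane}, MemW1infPer φ g →
          IntegrableOn (fun y => a y * ‖ζ + g y‖ ^ 2) (square 1) := fun ζ {φ g} h =>
        integrableOn_gradEnergy ham ha (volume_square_lt_top 1) ζ (by simpa using h.2.2.1)
      simp only [gradEnergy]
      rw [← integral_add (hi _ hp) (hi _ hm), ← integral_const_mul, ← integral_const_mul,
        ← integral_add ((hi _ h).const_mul 2) ((hi _ h').const_mul 2)]
      congr 1; funext y
      have := parallelogram_law_with_norm ℝ (ξ + g y) (η + g' y)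
      rw [show ξ + η + (g y + g' y) = ξ + g y + (η + g' y) by abel,
        show ξ - η + (g y + (-1 : ℝ) • g' y) = ξ + g y - (η + g' y) by rw [neg_one_smul]; abel]
      linear_combination a y * this
    -- The two competitors are independent, so the infima are taken one after the other.
    have h1 : ∀ φ' g', MemW1infPer φ' g' →
        (cellEnergy a (ξ + η) + cellEnergy a (ξ - η) - 2 * gradEnergy a (square 1) η g') / 2
          ≤ cellEnergy a ξ := fun φ' g' h' =>
      le_cellEnergy fun φ g h => by linarith [key φ g φ' g' h h']
    have h2 : (cellEnergy a (ξ + η) + cellEnergy a (ξ - η) - 2 * cellEnergy a ξ) / 2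
        ≤ cellEnergy a η := le_cellEnergy fun φ' g' h' => by linarith [h1 φ' g' h']
    linarith
  refine le_antisymm (hle ξ η) ?_
  have h1 := hle (ξ + η) (ξ - η)
  rw [show ξ + η + (ξ - η) = (2 : ℝ) • ξ by rw [two_smul]; abel,
    show ξ + η - (ξ - η) = (2 : ℝ) • η by rw [two_smul]; abel, cellEnergy_smul ha0,
    cellEnergy_smul ha0] at h1
  linarith

/-- Zero mean of a periodic gradient is not used directly. The competitor is cut off on squares of
integer side `n`, where `lower_bound_zero` applies, and the boundary cost per unit area, `C / n`,
tends to zero. -/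
theorem cellEnergy_coercive {a : Plane → ℝ} (ham : Measurable a) (hap : IsPeriodic a) {α β : ℝ}
    (hα : 0 < α) (ha : ∀ y, α ≤ a y ∧ a y ≤ β) (ξ : Plane) : α * ‖ξ‖ ^ 2 ≤ cellEnergy a ξ := by
  have ha' : ∀ y, 0 ≤ a y ∧ a y ≤ β := fun y => ⟨hα.le.trans (ha y).1, (ha y).2⟩
  refine le_cellEnergy fun φ g h => ?_
  obtain ⟨C, hC⟩ := exists_zero_of_periodic ham hap ha' ξ h
  have hlim : Tendsto (fun n : ℕ => gradEnergy a (square 1) ξ g + C / (n : ℝ)) atTop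
      (𝓝 (gradEnergy a (square 1) ξ g + 0)) :=
    tendsto_const_nhds.add (tendsto_const_div_atTop_nhds_zero_nat C)
  rw [add_zero] at hlim
  refine ge_of_tendsto hlim ?_
  filter_upwards [eventually_ge_atTop 2] with n hn
  have hn' : (2 : ℝ) ≤ n := by exact_mod_cast hn
  have hn0 : (0 : ℝ) < n := by linarith
  obtain ⟨c, G, hc, hle⟩ := hC n hn'
  have h1 := (lower_bound_zero ham hα ha ξ hn0.le hc).trans hle
  rw [Nat.ceil_natCast] at h1
  have h2 : gradEnergy a (square 1) ξ g + C / (n : ℝ)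
      = ((n : ℝ) ^ 2 * gradEnergy a (square 1) ξ g + C * n) / (n : ℝ) ^ 2 := by field_simp
  rw [h2, le_div_iff₀ (by positivity)]
  linarith

/-! ### Tangential homogenization -/

theorem perp_sq {s : Plane} (hs : ‖s‖ = 1) : perp s 0 ^ 2 + perp s 1 ^ 2 = 1 := by
  have := EuclideanSpace.norm_sq_eq s
  rw [hs, Fin.sum_univ_two] at this
  simp only [Real.norm_eq_abs, sq_abs] at this
  simp only [perp, PiLp.toLp_apply, Matrix.cons_val_zero, Matrix.cons_val_one]
  linarith

theorem frobSq_eq (M : Mat) : frobSq M = M 0 0 ^ 2 + M 0 1 ^ 2 + (M 1 0 ^ 2 + M 1 1 ^ 2) := by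
  simp [frobSq, Fin.sum_univ_two]

theorem norm_sq_plane (x : Plane) : ‖x‖ ^ 2 = x 0 ^ 2 + x 1 ^ 2 := by
  rw [EuclideanSpace.norm_sq_eq, Fin.sum_univ_two]
  simp

/-- The vector `Mᵀ p`. -/
def rowComb (p : Plane) (M : Mat) : Plane :=
  p 0 • WithLp.toLp 2 (M 0) + p 1 • WithLp.toLp 2 (M 1)

/-- Contraction with the unit vector `p` sends `p ⊗ ξ` to `ξ` and does not increase norms, by
Cauchy–Schwarz. This avoids proving that the weak gradient of a map into a line has the form `p ⊗
g`. -/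
theorem norm_add_rowComb_sq_le {p : Plane} (hp : p 0 ^ 2 + p 1 ^ 2 = 1) (ξ : Plane) (Φ : Mat) :
    ‖ξ + rowComb p Φ‖ ^ 2 ≤ frobSq (tensor p ξ + Φ) := by
  have h : ∀ j, ξ j + (p 0 * Φ 0 j + p 1 * Φ 1 j)
      = p 0 * (p 0 * ξ j + Φ 0 j) + p 1 * (p 1 * ξ j + Φ 1 j) := fun j => by
    linear_combination -ξ j * hp
  have hcs : ∀ x y : ℝ, (p 0 * x + p 1 * y) ^ 2 ≤ x ^ 2 + y ^ 2 := fun x y => by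
    have : x ^ 2 + y ^ 2 = (p 0 ^ 2 + p 1 ^ 2) * (x ^ 2 + y ^ 2) := by rw [hp, one_mul]
    rw [this]
    nlinarith [sq_nonneg (p 0 * y - p 1 * x)]
  rw [norm_sq_plane, frobSq_eq]
  simp only [rowComb, PiLp.add_apply, PiLp.smul_apply, smul_eq_mul, Matrix.add_apply,
    tensor, Matrix.of_apply, h]
  linarith [hcs (p 0 * ξ 0 + Φ 0 0) (p 1 * ξ 0 + Φ 1 0),
    hcs (p 0 * ξ 1 + Φ 0 1) (p 1 * ξ 1 + Φ 1 1)]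

theorem frobSq_tensor_add {p : Plane} (hp : p 0 ^ 2 + p 1 ^ 2 = 1) (ξ g : Plane) :
    frobSq (tensor p ξ + tensor p g) = ‖ξ + g‖ ^ 2 := by
  rw [norm_sq_plane, frobSq_eq]
  simp only [PiLp.add_apply, Matrix.add_apply, tensor, Matrix.of_apply]
  linear_combination ((ξ 0 + g 0) ^ 2 + (ξ 1 + g 1) ^ 2) * hp

theorem MemW1infZeroScalar.vector {t : ℝ} {c : Plane → ℝ} {G : Plane → Plane}
    (h : MemW1infZeroScalar t c G) (s : Plane) :
    MemW1infZero t s (fun y => c y • perp s) fun y => tensor (perp s) (G y) := by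
  refine ⟨fun i => ⟨?_, ?_, fun j => ?_⟩, fun y hy => by simp [h.2 y hy], fun y => ⟨c y, rfl⟩⟩
  · simpa [mul_comm] using h.1.1.const_mul (perp s i)
  · exact h.1.2.1.const_smul (perp s i)
  · simpa [mul_comm, tensor] using (h.1.2.2 j).const_mul (perp s i)

theorem MemW1infZero.scalar {t : ℝ} {s : Plane} {φ : Plane → Plane} {Φ : Plane → Mat}
    (h : MemW1infZero t s φ Φ) :
    MemW1infZeroScalar t (fun y => perp s 0 * φ y 0 + perp s 1 * φ y 1)
      fun y => rowComb (perp s) (Φ y) := by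
  refine ⟨⟨?_, ?_, fun j => ?_⟩, fun y hy => by simp [h.2.1 y hy]⟩
  · exact ((h.1 0).1.const_mul _).add ((h.1 1).1.const_mul _)
  · have h0 : MemLp (fun y => WithLp.toLp 2 (Φ y 0)) ⊤ (volume.restrict univ) := (h.1 0).2.1
    have h1 : MemLp (fun y => WithLp.toLp 2 (Φ y 1)) ⊤ (volume.restrict univ) := (h.1 1).2.1
    exact (h0.const_smul (perp s 0)).add (h1.const_smul (perp s 1))
  · simpa [rowComb] using (((h.1 0).2.2 j).const_mul (perp s 0)).add
      (((h.1 1).2.2 j).const_mul (perp s 1))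

theorem integrableOn_frobSq {a : Plane → ℝ} (ham : Measurable a) {β : ℝ}
    (ha : ∀ y, 0 ≤ a y ∧ a y ≤ β) (t : ℝ) (M : Mat) {s : Plane} {φ : Plane → Plane}
    {Φ : Plane → Mat} (h : MemW1infZero t s φ Φ) :
    IntegrableOn (fun y => a y * frobSq (M + Φ y)) (square t) := by
  have hi : ∀ i, IntegrableOn
      (fun y => a y * ‖WithLp.toLp 2 (M i) + WithLp.toLp 2 (Φ y i)‖ ^ 2) (square t) := fun i =>
    integrableOn_gradEnergy ham ha (volume_square_lt_top t) (WithLp.toLp 2 (M i))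
      (by simpa using (h.1 i).2.1)
  refine ((hi 0).add (hi 1)).congr_fun (fun y _ => ?_) (measurableSet_square t)
  simp only [Pi.add_apply, norm_sq_plane, frobSq_eq, PiLp.add_apply, Matrix.add_apply]
  ring

/-- Periodizing arbitrary competitors bounds the limit from below; cutting off a nearly optimal
periodic function bounds it from above. The errors come from replacing `t` by `⌈t⌉` and from the
boundary layer, and both vanish after division by `t²`. -/
theorem tendsto_tangentialCell {a : Plane → ℝ} (ham : Measurable a) (hap : IsPeriodic a) {β : ℝ}
    (ha : ∀ y, 0 ≤ a y ∧ a y ≤ β) {f : Plane → Mat → ℝ} (hf : ∀ y M, f y M = a y * frobSq M)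
    {s : Plane} (hs : ‖s‖ = 1) (ξ : Plane) :
    Tendsto (tangentialCell f s (tensor (perp s) ξ)) atTop (𝓝 (cellEnergy a ξ)) := by
  have hp := perp_sq hs
  have ha0 : ∀ y, 0 ≤ a y := fun y => (ha y).1
  have hceil : Tendsto (fun t : ℝ => ((⌈t⌉₊ : ℝ) / t) ^ 2) atTop (𝓝 1) := by
    simpa using (tendsto_nat_ceil_div_atTop (R := ℝ)).pow 2
  have hbdd : ∀ t : ℝ, ∀ E ∈ {E : ℝ | ∃ φ Φ, MemW1infZero t s φ Φ ∧
      E = 1 / t ^ 2 * ∫ y in square t, f y (tensor (perp s) ξ + Φ y)}, 0 ≤ E := by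
    rintro t E ⟨φ, Φ, -, rfl⟩
    refine mul_nonneg (by positivity) (integral_nonneg fun y => ?_)
    rw [hf]
    exact mul_nonneg (ha0 y) (by rw [frobSq_eq]; positivity)
  have hzero : ∀ t : ℝ, MemW1infZeroScalar t (fun _ => 0) fun _ => 0 := fun t =>
    ⟨memW1infPer_zero.2, fun _ _ => rfl⟩
  refine tendsto_order.2 ⟨fun m hm => ?_, fun m hm => ?_⟩
  · have hlim : Tendsto (fun t : ℝ => ((⌈t⌉₊ : ℝ) / t) ^ 2 * cellEnergy a ξ
        - β * ‖ξ‖ ^ 2 * (((⌈t⌉₊ : ℝ) / t) ^ 2 - 1)) atTop (𝓝 (cellEnergy a ξ)) := by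
      have := (hceil.mul_const (cellEnergy a ξ)).sub
        ((hceil.sub_const 1).const_mul (β * ‖ξ‖ ^ 2))
      simpa using this
    filter_upwards [hlim.eventually_const_lt hm, eventually_gt_atTop 0] with t ht ht0
    refine ht.trans_le (le_csInf ⟨_, _, _, (hzero t).vector s, rfl⟩ ?_)
    rintro E ⟨φ, Φ, hφ, rfl⟩
    obtain ⟨φ', g, hg, hle⟩ := exists_periodic_of_zero ham hap ha ξ ht0 (Nat.le_ceil t) hφ.scalar
    have h1 := mul_le_mul_of_nonneg_left (cellEnergy_le ha0 ξ hg) (sq_nonneg (⌈t⌉₊ : ℝ))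
    have h2 : gradEnergy a (square t) ξ (fun y => rowComb (perp s) (Φ y))
        ≤ ∫ y in square t, f y (tensor (perp s) ξ + Φ y) := by
      simp only [hf]
      refine integral_mono (integrableOn_gradEnergy ham ha (volume_square_lt_top t) ξ
        (by simpa using hφ.scalar.1.2.1)) (integrableOn_frobSq ham ha t _ hφ) fun y => ?_
      exact mul_le_mul_of_nonneg_left (norm_add_rowComb_sq_le hp ξ (Φ y)) (ha0 y)
    rw [one_div_mul_eq_div, le_div_iff₀ (by positivity)]
    have h3 : (((⌈t⌉₊ : ℝ) / t) ^ 2 * cellEnergy a ξ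
        - β * ‖ξ‖ ^ 2 * (((⌈t⌉₊ : ℝ) / t) ^ 2 - 1)) * t ^ 2
        = (⌈t⌉₊ : ℝ) ^ 2 * cellEnergy a ξ - β * ‖ξ‖ ^ 2 * ((⌈t⌉₊ : ℝ) ^ 2 - t ^ 2) := by
      field_simp
    rw [h3]
    linarith
  · obtain ⟨φ, g, hg, hE⟩ : ∃ φ g, MemW1infPer φ g ∧ gradEnergy a (square 1) ξ g < m := by
      by_contra! hcon
      exact absurd hm (not_lt.2 (le_cellEnergy hcon))
    obtain ⟨C, hC⟩ := exists_zero_of_periodic ham hap ha ξ hg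
    have hlim : Tendsto (fun t : ℝ => ((⌈t⌉₊ : ℝ) / t) ^ 2 * gradEnergy a (square 1) ξ g
        + C / t) atTop (𝓝 (gradEnergy a (square 1) ξ g)) := by
      have := (hceil.mul_const (gradEnergy a (square 1) ξ g)).add
        (tendsto_const_nhds (x := C) |>.div_atTop tendsto_id)
      simpa using this
    filter_upwards [hlim.eventually_lt_const hE, eventually_ge_atTop 2] with t ht ht2
    have ht0 : 0 < t := by linarith
    refine lt_of_le_of_lt ?_ ht
    obtain ⟨c, G, hc, hle⟩ := hC t ht2
    refine (csInf_le ⟨0, hbdd t⟩ ⟨_, _, hc.vector s, rfl⟩).trans ?_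
    simp only [hf, frobSq_tensor_add hp]
    rw [one_div_mul_eq_div, div_le_iff₀ (by positivity)]
    refine hle.trans_eq ?_
    field_simp

theorem TfHom_eq_cellEnergy {a : Plane → ℝ} (ham : Measurable a) (hap : IsPeriodic a) {β : ℝ}
    (ha : ∀ y, 0 ≤ a y ∧ a y ≤ β) {f : Plane → Mat → ℝ} (hf : ∀ y M, f y M = a y * frobSq M)
    {s : Plane} (hs : ‖s‖ = 1) (ξ : Plane) :
    TfHom f s (tensor (perp s) ξ) = cellEnergy a ξ :=
  (tendsto_tangentialCell ham hap ha hf hs ξ).limUnder_eq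

/-! ### Polar coordinates -/

/-- The point with polar coordinates `(ρ, θ)`. -/
def pol (ρ θ : ℝ) : Plane := !₂[ρ * Real.cos θ, ρ * Real.sin θ]

@[simp] theorem pol_zero (ρ θ : ℝ) : pol ρ θ 0 = ρ * Real.cos θ := rfl

@[simp] theorem pol_one (ρ θ : ℝ) : pol ρ θ 1 = ρ * Real.sin θ := rfl

theorem norm_pol {ρ : ℝ} (hρ : 0 ≤ ρ) (θ : ℝ) : ‖pol ρ θ‖ = ρ := by
  refine (sq_eq_sq₀ (norm_nonneg _) hρ).1 ?_
  rw [norm_sq_plane, pol_zero, pol_one]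
  linear_combination ρ ^ 2 * Real.cos_sq_add_sin_sq θ

theorem contDiff_pol {n : ℕ∞ω} : ContDiff ℝ n fun p : ℝ × ℝ => pol p.1 p.2 := by
  rw [contDiff_piLp]
  intro i
  fin_cases i
  · exact contDiff_fst.mul (Real.contDiff_cos.comp contDiff_snd)
  · exact contDiff_fst.mul (Real.contDiff_sin.comp contDiff_snd)

theorem isOpen_annulus (r R : ℝ) : IsOpen (annulus r R) :=
  (isOpen_lt continuous_const continuous_norm).inter (isOpen_lt continuous_norm continuous_const)

/-- Continuity is asked only on the closed annulus, because the vortex density, a multiple of `1 /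
dualForm`, is singular at the origin. -/
theorem setIntegral_annulus_eq {r R : ℝ} (hr : 0 < r) (hR : r ≤ R) {F : Plane → ℝ}
    (hF : ContinuousOn F {x | r ≤ ‖x‖ ∧ ‖x‖ ≤ R}) :
    ∫ x in annulus r R, F x = ∫ ρ in r..R, ∫ θ in (-Real.pi)..Real.pi, ρ * F (pol ρ θ) := by
  have hmp : MeasurePreserving (fun x : Plane => (x 0, x 1)) :=
    (volume_preserving_finTwoArrow ℝ).comp (PiLp.volume_preserving_ofLp (Fin 2))
  let Φ : Plane ≃ᵐ ℝ × ℝ := (MeasurableEquiv.toLp 2 (Fin 2 → ℝ)).symm.trans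
    MeasurableEquiv.finTwoArrow
  have hΦs : ∀ p : ℝ × ℝ, Φ.symm p = !₂[p.1, p.2] := fun p => by
    rw [MeasurableEquiv.symm_apply_eq]; rfl
  have hmpΦ : MeasurePreserving Φ := hmp
  have hm := (isOpen_annulus r R).measurableSet
  have hS : MeasurableSet (Ioo r R ×ˢ (univ : Set ℝ)) := measurableSet_Ioo.prod .univ
  have hcont : ContinuousOn (fun p : ℝ × ℝ => p.1 * F (pol p.1 p.2))
      (Icc r R ×ˢ Icc (-Real.pi) Real.pi) := by
    refine continuous_fst.continuousOn.mul (hF.comp (contDiff_pol (n := 0)).continuous.continuousOn ?_)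
    rintro ⟨ρ, θ⟩ ⟨h1, -⟩
    have : ‖pol ρ θ‖ = ρ := norm_pol (hr.le.trans h1.1) θ
    exact ⟨by rw [this]; exact h1.1, by rw [this]; exact h1.2⟩
  have hint : IntegrableOn (fun p : ℝ × ℝ => p.1 * F (pol p.1 p.2))
      (Ioo r R ×ˢ Ioo (-Real.pi) Real.pi) (volume.prod volume) :=
    (hcont.integrableOn_compact (isCompact_Icc.prod isCompact_Icc)).mono_set
      (prod_mono Ioo_subset_Icc_self Ioo_subset_Icc_self)
  calc ∫ x in annulus r R, F x = ∫ x, (annulus r R).indicator F x := (integral_indicator hm).symm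
    _ = ∫ p, (annulus r R).indicator F (Φ.symm p) := by
        rw [← hmpΦ.symm.integral_comp Φ.symm.measurableEmbedding]
    _ = ∫ p in polarCoord.target, p.1 • (annulus r R).indicator F (Φ.symm (polarCoord.symm p)) :=
        (integral_comp_polarCoord_symm _).symm
    _ = ∫ p in polarCoord.target,
          (Ioo r R ×ˢ (univ : Set ℝ)).indicator (fun p : ℝ × ℝ => p.1 * F (pol p.1 p.2)) p := by
        refine setIntegral_congr_fun polarCoord.open_target.measurableSet ?_
        rintro ⟨ρ, θ⟩ hp
        have hρ : 0 < ρ := hp.1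
        have h1 : Φ.symm (polarCoord.symm (ρ, θ)) = pol ρ θ := by rw [hΦs]; rfl
        have h2 : pol ρ θ ∈ annulus r R ↔ (ρ, θ) ∈ Ioo r R ×ˢ (univ : Set ℝ) := by
          simp [annulus, norm_pol hρ.le]
        simp only [h1, smul_eq_mul]
        by_cases h : (ρ, θ) ∈ Ioo r R ×ˢ (univ : Set ℝ)
        · rw [indicator_of_mem h, indicator_of_mem (h2.2 h)]
        · rw [indicator_of_notMem h, indicator_of_notMem (fun h' => h (h2.1 h')), mul_zero]
    _ = ∫ p in Ioo r R ×ˢ Ioo (-Real.pi) Real.pi, p.1 * F (pol p.1 p.2) := by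
        rw [setIntegral_indicator hS]
        congr 2
        ext ⟨ρ, θ⟩
        simp only [polarCoord_target, mem_inter_iff, mem_prod, mem_Ioi, mem_Ioo, mem_univ, and_true]
        constructor
        · rintro ⟨⟨_, h⟩, h'⟩; exact ⟨h', h⟩
        · rintro ⟨h', h⟩; exact ⟨⟨hr.trans h'.1, h⟩, h'⟩
    _ = _ := by
        rw [Measure.volume_eq_prod, setIntegral_prod _ hint, intervalIntegral.integral_of_le hR,
          ← integral_Ioc_eq_integral_Ioo]
        refine setIntegral_congr_fun measurableSet_Ioc fun ρ _ => ?_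
        simp only
        rw [intervalIntegral.integral_of_le (by linarith [Real.pi_pos]),
          ← integral_Ioc_eq_integral_Ioo]

theorem intervalIntegral_swap {f : ℝ → ℝ → ℝ} (hf : Continuous (Function.uncurry f)) (a b c d : ℝ)
    (hab : a ≤ b) (hcd : c ≤ d) :
    ∫ x in a..b, ∫ y in c..d, f x y = ∫ y in c..d, ∫ x in a..b, f x y := by
  simp only [intervalIntegral.integral_of_le hab, intervalIntegral.integral_of_le hcd]
  refine integral_integral_swap ?_
  rw [Measure.prod_restrict]
  exact (hf.continuousOn.integrableOn_compact (isCompact_Icc.prod isCompact_Icc)).mono_set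
    (prod_mono Ioc_subset_Icc_self Ioc_subset_Icc_self)

/-- Stokes' theorem on a rectangle, for functions that are periodic in the second variable. -/
theorem integral_jacobian_eq {A B : ℝ × ℝ → ℝ} (hA : ContDiff ℝ ∞ A) (hB : ContDiff ℝ ∞ B)
    {r R : ℝ} (hR : r ≤ R) (hAR : ∀ θ, A (R, θ) = 0)
    (hAp : ∀ ρ, A (ρ, Real.pi) = A (ρ, -Real.pi))
    (hBp : ∀ ρ, fderiv ℝ B (ρ, Real.pi) = fderiv ℝ B (ρ, -Real.pi)) :
    ∫ ρ in r..R, ∫ θ in (-Real.pi)..Real.pi,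
        (fderiv ℝ A (ρ, θ) (1, 0) * fderiv ℝ B (ρ, θ) (0, 1)
          - fderiv ℝ A (ρ, θ) (0, 1) * fderiv ℝ B (ρ, θ) (1, 0))
      = -∫ θ in (-Real.pi)..Real.pi, A (r, θ) * fderiv ℝ B (r, θ) (0, 1) := by
  have hpi : -Real.pi ≤ Real.pi := by linarith [Real.pi_pos]
  have hB1 : ContDiff ℝ 1 (fderiv ℝ B) := hB.fderiv_right (by norm_cast)
  have hA' : ∀ v, Continuous fun p => fderiv ℝ A p v := fun v =>
    (hA.continuous_fderiv (by simp)).clm_apply continuous_const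
  have hB' : ∀ v, Continuous fun p => fderiv ℝ B p v := fun v =>
    (hB.continuous_fderiv (by simp)).clm_apply continuous_const
  -- Adding `A ∂_ρ∂_θ B` to each product yields the exact derivatives `∂_ρ (A ∂_θ B)` and `∂_θ (A
  -- ∂_ρ B)`; by symmetry of second derivatives the additions cancel in the difference. The second
  -- integrates to zero by periodicity.
  let B2 : ℝ × ℝ → ℝ := fun p => fderiv ℝ (fderiv ℝ B) p (1, 0) (0, 1)
  have hB2 : Continuous B2 :=
    ((hB1.continuous_fderiv one_ne_zero).clm_apply continuous_const).clm_apply continuous_const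
  have hsymm : ∀ p, fderiv ℝ (fderiv ℝ B) p (0, 1) (1, 0) = B2 p := fun p =>
    (hB.contDiffAt.isSymmSndFDerivAt (by simp; exact WithTop.coe_le_coe.2 le_top)).eq _ _
  have hline1 : ∀ θ ρ : ℝ, HasDerivAt (fun ρ : ℝ => (ρ, θ)) ((1 : ℝ), (0 : ℝ)) ρ := fun θ ρ =>
    (hasDerivAt_id ρ).prodMk (hasDerivAt_const ρ θ)
  have hline2 : ∀ ρ θ : ℝ, HasDerivAt (fun θ : ℝ => (ρ, θ)) ((0 : ℝ), (1 : ℝ)) θ := fun ρ θ =>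
    (hasDerivAt_const θ ρ).prodMk (hasDerivAt_id θ)
  have hAd : ∀ p, HasFDerivAt A (fderiv ℝ A p) p := fun p =>
    (hA.differentiable (by simp) p).hasFDerivAt
  have hBd : ∀ v p, HasFDerivAt (fun p => fderiv ℝ B p v)
      ((ContinuousLinearMap.apply ℝ ℝ v).comp (fderiv ℝ (fderiv ℝ B) p)) p := fun v p =>
    (ContinuousLinearMap.apply ℝ ℝ v).hasFDerivAt.comp p
      (hB1.differentiable one_ne_zero p).hasFDerivAt
  have c1 : Continuous (Function.uncurry fun ρ θ : ℝ =>
      fderiv ℝ A (ρ, θ) (1, 0) * fderiv ℝ B (ρ, θ) (0, 1) + A (ρ, θ) * B2 (ρ, θ)) :=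
    ((hA' _).mul (hB' _)).add (hA.continuous.mul hB2)
  have c2 : Continuous (Function.uncurry fun ρ θ : ℝ =>
      fderiv ℝ A (ρ, θ) (0, 1) * fderiv ℝ B (ρ, θ) (1, 0) + A (ρ, θ) * B2 (ρ, θ)) :=
    ((hA' _).mul (hB' _)).add (hA.continuous.mul hB2)
  have hsec : ∀ {h : ℝ → ℝ → ℝ}, Continuous (Function.uncurry h) → ∀ ρ, Continuous fun θ => h ρ θ :=
    fun hh ρ => hh.comp (continuous_const.prodMk continuous_id)
  have hsec' : ∀ {h : ℝ → ℝ → ℝ}, Continuous (Function.uncurry h) → ∀ θ, Continuous fun ρ => h ρ θ :=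
    fun hh θ => hh.comp (continuous_id.prodMk continuous_const)
  have e1 : ∫ ρ in r..R, ∫ θ in (-Real.pi)..Real.pi,
      (fderiv ℝ A (ρ, θ) (1, 0) * fderiv ℝ B (ρ, θ) (0, 1) + A (ρ, θ) * B2 (ρ, θ))
      = -∫ θ in (-Real.pi)..Real.pi, A (r, θ) * fderiv ℝ B (r, θ) (0, 1) := by
    rw [intervalIntegral_swap c1 _ _ _ _ hR hpi, ← intervalIntegral.integral_neg]
    congr 1; funext θ
    rw [intervalIntegral.integral_eq_sub_of_hasDerivAt
      (f := fun ρ => A (ρ, θ) * fderiv ℝ B (ρ, θ) (0, 1)) (fun ρ _ => ?_)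
      ((hsec' c1 θ).intervalIntegrable _ _)]
    · rw [hAR]; ring
    · have h1 : HasDerivAt (fun ρ => A (ρ, θ)) (fderiv ℝ A (ρ, θ) (1, 0)) ρ :=
        (hAd (ρ, θ)).comp_hasDerivAt ρ (hline1 θ ρ)
      have h2 : HasDerivAt (fun ρ => fderiv ℝ B (ρ, θ) (0, 1)) (B2 (ρ, θ)) ρ :=
        (HasFDerivAt.comp_hasDerivAt (l := fun p => fderiv ℝ B p (0, 1)) (l' := _) ρ
          (hBd (0, 1) (ρ, θ)) (hline1 θ ρ)).congr_deriv rfl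
      exact h1.mul h2
  have e2 : ∀ ρ, ∫ θ in (-Real.pi)..Real.pi,
      (fderiv ℝ A (ρ, θ) (0, 1) * fderiv ℝ B (ρ, θ) (1, 0) + A (ρ, θ) * B2 (ρ, θ)) = 0 := by
    intro ρ
    rw [intervalIntegral.integral_eq_sub_of_hasDerivAt
      (f := fun θ => A (ρ, θ) * fderiv ℝ B (ρ, θ) (1, 0)) (fun θ _ => ?_)
      ((hsec c2 ρ).intervalIntegrable _ _)]
    · rw [hAp, hBp, sub_self]
    · have h1 : HasDerivAt (fun θ => A (ρ, θ)) (fderiv ℝ A (ρ, θ) (0, 1)) θ :=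
        (hAd (ρ, θ)).comp_hasDerivAt θ (hline2 ρ θ)
      have h2 : HasDerivAt (fun θ => fderiv ℝ B (ρ, θ) (1, 0)) (B2 (ρ, θ)) θ := by
        rw [← hsymm]
        exact (HasFDerivAt.comp_hasDerivAt (l := fun p => fderiv ℝ B p (1, 0)) (l' := _) θ
          (hBd (1, 0) (ρ, θ)) (hline2 ρ θ)).congr_deriv rfl
      exact h1.mul h2
  rw [← e1]
  congr 1; funext ρ
  have e3 := intervalIntegral.integral_sub ((hsec c1 ρ).intervalIntegrable (-Real.pi) Real.pi)
    ((hsec c2 ρ).intervalIntegrable (μ := volume) (-Real.pi) Real.pi)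
  rw [e2 ρ, sub_zero] at e3
  rw [← e3]
  congr 1; funext θ
  ring

theorem pol_eq (ρ θ : ℝ) : pol ρ θ = (ρ * Real.cos θ) • e 0 + (ρ * Real.sin θ) • e 1 :=
  plane_eq (pol ρ θ)

theorem hasDerivAt_pol_radius (ρ θ : ℝ) : HasDerivAt (fun ρ => pol ρ θ) (pol 1 θ) ρ := by
  simp only [pol_eq]
  exact (((hasDerivAt_id ρ).mul_const _).smul_const _).add
    (((hasDerivAt_id ρ).mul_const _).smul_const _)

theorem perp_pol (ρ θ : ℝ) :
    perp (pol ρ θ) = (ρ * -Real.sin θ) • e 0 + (ρ * Real.cos θ) • e 1 := by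
  rw [plane_eq (perp (pol ρ θ))]
  simp [perp]

theorem hasDerivAt_pol_angle (ρ θ : ℝ) : HasDerivAt (fun θ => pol ρ θ) (perp (pol ρ θ)) θ := by
  rw [perp_pol]
  simp only [pol_eq]
  exact (((Real.hasDerivAt_cos θ).const_mul _).smul_const _).add
    (((Real.hasDerivAt_sin θ).const_mul _).smul_const _)

theorem pol_pi (ρ : ℝ) : pol ρ Real.pi = pol ρ (-Real.pi) := by
  ext i; fin_cases i <;> simp [pol]

theorem clm_apply_eq {E : Type*} [NormedAddCommGroup E] [NormedSpace ℝ E] (L : Plane →L[ℝ] E)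
    (v : Plane) : L v = v 0 • L (e 0) + v 1 • L (e 1) := by
  conv_lhs => rw [plane_eq v]
  simp

theorem hasDerivAt_comp_pol_radius {E : Type*} [NormedAddCommGroup E] [NormedSpace ℝ E]
    {U : Plane → E} (hU : Differentiable ℝ U) (ρ θ : ℝ) :
    HasDerivAt (fun ρ => U (pol ρ θ)) (fderiv ℝ U (pol ρ θ) (pol 1 θ)) ρ :=
  (hU (pol ρ θ)).hasFDerivAt.comp_hasDerivAt ρ (hasDerivAt_pol_radius ρ θ)

theorem hasDerivAt_comp_pol_angle {E : Type*} [NormedAddCommGroup E] [NormedSpace ℝ E]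
    {U : Plane → E} (hU : Differentiable ℝ U) (ρ θ : ℝ) :
    HasDerivAt (fun θ => U (pol ρ θ)) (fderiv ℝ U (pol ρ θ) (perp (pol ρ θ))) θ :=
  (hU (pol ρ θ)).hasFDerivAt.comp_hasDerivAt θ (hasDerivAt_pol_angle ρ θ)

theorem fderiv_comp_pol {U : Plane → ℝ} (hU : ContDiff ℝ ∞ U) (ρ θ : ℝ) :
    fderiv ℝ (fun p : ℝ × ℝ => U (pol p.1 p.2)) (ρ, θ) (1, 0) = fderiv ℝ U (pol ρ θ) (pol 1 θ) ∧
    fderiv ℝ (fun p : ℝ × ℝ => U (pol p.1 p.2)) (ρ, θ) (0, 1)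
      = fderiv ℝ U (pol ρ θ) (perp (pol ρ θ)) := by
  have hd : HasFDerivAt (fun p : ℝ × ℝ => U (pol p.1 p.2)) _ (ρ, θ) :=
    ((hU.comp contDiff_pol).differentiable (by simp) (ρ, θ)).hasFDerivAt
  have hUd := hU.differentiable (by simp)
  constructor
  · have h1 := hd.comp_hasDerivAt ρ ((hasDerivAt_id ρ).prodMk (hasDerivAt_const ρ θ))
    exact HasDerivAt.unique (f := fun ρ => U (pol ρ θ)) h1 (hasDerivAt_comp_pol_radius hUd ρ θ)
  · have h1 := hd.comp_hasDerivAt θ ((hasDerivAt_const θ ρ).prodMk (hasDerivAt_id θ))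
    exact HasDerivAt.unique (f := fun θ => U (pol ρ θ)) h1 (hasDerivAt_comp_pol_angle hUd ρ θ)

/-- Stokes' theorem on an annulus, for functions `A` that vanish on the outer circle. -/
theorem setIntegral_annulus_jacobian {A B : Plane → ℝ} (hA : ContDiff ℝ ∞ A) (hB : ContDiff ℝ ∞ B)
    {r R : ℝ} (hr : 0 < r) (hR : r ≤ R) (hAR : ∀ x, ‖x‖ = R → A x = 0) :
    ∫ x in annulus r R, (fderiv ℝ A x (e 0) * fderiv ℝ B x (e 1)
        - fderiv ℝ A x (e 1) * fderiv ℝ B x (e 0))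
      = -∫ θ in (-Real.pi)..Real.pi, A (pol r θ) * fderiv ℝ B (pol r θ) (perp (pol r θ)) := by
  have hA' := fun j => continuous_fderiv_apply_e hA j
  have hB' := fun j => continuous_fderiv_apply_e hB j
  have hc : Continuous fun x => fderiv ℝ A x (e 0) * fderiv ℝ B x (e 1)
      - fderiv ℝ A x (e 1) * fderiv ℝ B x (e 0) :=
    ((hA' 0).mul (hB' 1)).sub ((hA' 1).mul (hB' 0))
  rw [setIntegral_annulus_eq hr hR hc.continuousOn]
  have h := integral_jacobian_eq (hA.comp contDiff_pol) (hB.comp contDiff_pol) hR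
    (fun θ => hAR _ (norm_pol (hr.le.trans hR) θ)) (fun ρ => by simp only [Function.comp, pol_pi])
    (fun ρ => by
      have e1 := fderiv_comp_pol hB ρ Real.pi
      have e2 := fderiv_comp_pol hB ρ (-Real.pi)
      have e3 : pol 1 Real.pi = pol 1 (-Real.pi) := pol_pi 1
      rw [pol_pi, e3] at e1
      ext <;> simp [Function.comp_def, e1, e2])
  simp only [Function.comp_def, fderiv_comp_pol hA, fderiv_comp_pol hB] at h
  rw [← h]
  congr 1; funext ρ; congr 1; funext θ
  -- The Jacobian of `(A, B)` in the variables `(ρ, θ)` is `ρ` times the Jacobian in `x`, which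
  -- accounts for the polar weight.
  simp only [clm_apply_eq _ (pol 1 θ), clm_apply_eq _ (perp (pol ρ θ))]
  simp only [perp, pol_zero, pol_one, PiLp.toLp_apply, Matrix.cons_val_zero, Matrix.cons_val_one,
    smul_eq_mul]
  linear_combination (-ρ * (fderiv ℝ A (pol ρ θ) (e 0) * fderiv ℝ B (pol ρ θ) (e 1)
        - fderiv ℝ A (pol ρ θ) (e 1) * fderiv ℝ B (pol ρ θ) (e 0))) * Real.cos_sq_add_sin_sq θ

/-! ### Fourier coefficients on circles -/

theorem circlePoint_coe (r θ : ℝ) : circlePoint r (θ : Angle) = pol r θ := by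
  have h : (AddCircle.toCircle (θ : Angle) : ℂ) = Complex.exp (θ * Complex.I) := by
    rw [AddCircle.toCircle_apply_mk, Circle.coe_exp]
    congr 2
    have := Real.pi_pos.ne'
    rw [div_self (by positivity), one_mul]
  simp only [circlePoint, pol, h, Complex.exp_ofReal_mul_I_re, Complex.exp_ofReal_mul_I_im]

theorem continuous_circlePoint (r : ℝ) : Continuous (circlePoint r) := by
  refine (PiLp.continuous_toLp 2 _).comp (continuous_pi fun i => ?_)
  have h : Continuous fun θ : Angle => (AddCircle.toCircle θ : ℂ) :=
    continuous_induced_dom.comp AddCircle.continuous_toCircle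
  fin_cases i
  · exact continuous_const.mul (Complex.continuous_re.comp h)
  · exact continuous_const.mul (Complex.continuous_im.comp h)

theorem fourierCoeff_angle (f : Angle → ℂ) (k : ℤ) :
    fourierCoeff f k = (1 / (2 * Real.pi)) •
      ∫ θ in (-Real.pi)..Real.pi, fourier (-k) (θ : Angle) * f θ := by
  rw [fourierCoeff_eq_intervalIntegral f k (-Real.pi), show -Real.pi + 2 * Real.pi = Real.pi by ring]
  rfl

theorem integral_angle {E : Type*} [NormedAddCommGroup E] [NormedSpace ℝ E] (f : Angle → E) :
    ∫ θ in (-Real.pi)..Real.pi, f (θ : Angle) = ∫ θ : Angle, f θ := by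
  have := AddCircle.intervalIntegral_preimage (2 * Real.pi) (-Real.pi) f
  rwa [show -Real.pi + 2 * Real.pi = Real.pi by ring] at this

theorem integral_haar_angle {E : Type*} [NormedAddCommGroup E] [NormedSpace ℝ E] (f : Angle → E) :
    ∫ θ, f θ ∂AddCircle.haarAddCircle
      = (1 / (2 * Real.pi)) • ∫ θ in (-Real.pi)..Real.pi, f (θ : Angle) := by
  rw [AddCircle.integral_haarAddCircle, integral_angle, one_div]

/-- Parseval's identity in `L²`, brought back to continuous functions; `1 / (2π)` normalizes the
Haar measure. -/
theorem hasSum_conj_fourierCoeff_mul {f g : Angle → ℂ} (hf : Continuous f) (hg : Continuous g) :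
    HasSum (fun k => (starRingEnd ℂ) (fourierCoeff f k) * fourierCoeff g k)
      ((1 / (2 * Real.pi)) • ∫ θ in (-Real.pi)..Real.pi, (starRingEnd ℂ) (f θ) * g θ) := by
  let F := ContinuousMap.toLp (E := ℂ) 2 AddCircle.haarAddCircle ℂ ⟨f, hf⟩
  let G := ContinuousMap.toLp (E := ℂ) 2 AddCircle.haarAddCircle ℂ ⟨g, hg⟩
  have h := fourierBasis.hasSum_inner_mul_inner F G
  have hF : ∀ k, fourierCoeff F k = fourierCoeff f k := fun k => fourierCoeff_toLp ⟨f, hf⟩ k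
  have hG : ∀ k, fourierCoeff G k = fourierCoeff g k := fun k => fourierCoeff_toLp ⟨g, hg⟩ k
  have e1 : (fun k => (starRingEnd ℂ) (fourierCoeff f k) * fourierCoeff g k)
      = fun k => inner ℂ F (fourierBasis k) * inner ℂ (fourierBasis k) G := by
    funext k
    rw [← hF, ← hG, ← fourierBasis_repr, ← fourierBasis_repr, HilbertBasis.repr_apply_apply,
      HilbertBasis.repr_apply_apply, inner_conj_symm]
  have e2 : ((1 / (2 * Real.pi)) • ∫ θ in (-Real.pi)..Real.pi, (starRingEnd ℂ) (f θ) * g θ)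
      = inner ℂ F G := by
    rw [← integral_haar_angle fun θ => (starRingEnd ℂ) (f θ) * g θ, L2.inner_def]
    refine integral_congr_ae ?_
    filter_upwards [ContinuousMap.coeFn_toLp (p := 2) (𝕜 := ℂ) AddCircle.haarAddCircle
      (⟨f, hf⟩ : C(Angle, ℂ)), ContinuousMap.coeFn_toLp (p := 2) (𝕜 := ℂ) AddCircle.haarAddCircle
      (⟨g, hg⟩ : C(Angle, ℂ))] with θ h1 h2
    rw [h1, h2]
    simp [mul_comm]
  rw [e1, e2]
  exact h

theorem hasSum_norm_sq_fourierCoeff {f : Angle → ℂ} (hf : Continuous f) :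
    HasSum (fun k => ‖fourierCoeff f k‖ ^ 2)
      (1 / (2 * Real.pi) * ∫ θ in (-Real.pi)..Real.pi, ‖f θ‖ ^ 2) := by
  have h := hasSum_conj_fourierCoeff_mul hf hf
  simp only [Complex.conj_mul'] at h
  have h2 := Complex.hasSum_re h
  convert h2 using 1
  · funext k; norm_cast
  · rw [Complex.smul_re, smul_eq_mul]
    congr 1
    have : ∀ θ : ℝ, ((‖f θ‖ : ℂ) ^ 2) = ((‖f θ‖ ^ 2 : ℝ) : ℂ) := fun θ => by push_cast; rfl
    simp only [this, intervalIntegral.integral_ofReal, Complex.ofReal_re]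

theorem sum_norm_sq_fourierCoeff_le {f : Angle → ℂ} (hf : Continuous f) (s : Finset ℤ) :
    ∑ k ∈ s, ‖fourierCoeff f k‖ ^ 2
      ≤ 1 / (2 * Real.pi) * ∫ θ in (-Real.pi)..Real.pi, ‖f θ‖ ^ 2 :=
  sum_le_hasSum s (fun _ _ => sq_nonneg _) (hasSum_norm_sq_fourierCoeff hf)

/-- Integration by parts; the endpoints `±π` are one point of the circle, so the boundary terms
cancel. -/
theorem fourierCoeff_of_hasDerivAt {f f' : Angle → ℂ} (hf' : Continuous f')
    (h : ∀ θ : ℝ, HasDerivAt (fun x : ℝ => f x) (f' θ) θ) (k : ℤ) :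
    fourierCoeff f' k = Complex.I * k * fourierCoeff f k := by
  have hc : ∀ n : ℤ, Continuous fun x : ℝ => fourier n (x : Angle) := fun n =>
    (map_continuous (fourier n)).comp (AddCircle.continuous_mk' _)
  have hib := intervalIntegral.integral_mul_deriv_eq_deriv_mul
    (a := -Real.pi) (b := Real.pi) (fun x _ => hasDerivAt_fourier_neg (2 * Real.pi) k x)
    (fun x _ => h x) ((continuous_const.mul (hc (-k))).intervalIntegrable _ _)
    ((hf'.comp (AddCircle.continuous_mk' _)).intervalIntegrable _ _)
  have hpi : ((Real.pi : ℝ) : Angle) = ((-Real.pi : ℝ) : Angle) := by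
    rw [← AddCircle.coe_add_period (2 * Real.pi) (-Real.pi)]
    congr 1; ring
  rw [hpi, sub_self, zero_sub] at hib
  rw [fourierCoeff_angle, fourierCoeff_angle, hib]
  have hk : ((-2 * Real.pi * Complex.I * k / ((2 * Real.pi : ℝ) : ℂ)) : ℂ) = -(Complex.I * k) := by
    have : (Real.pi : ℂ) ≠ 0 := by exact_mod_cast Real.pi_pos.ne'
    push_cast
    field_simp
  simp only [hk]
  simp only [mul_assoc, neg_mul, intervalIntegral.integral_neg,
    intervalIntegral.integral_const_mul, neg_neg]
  simp only [Complex.real_smul]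
  ring

/-! ### The trace inequality -/

theorem hasDerivAt_fourierCoeff_circle {U : Plane → ℂ} (hU : ContDiff ℝ ∞ U) (k : ℤ) (ρ : ℝ) :
    HasDerivAt (fun ρ => fourierCoeff (fun θ => U (circlePoint ρ θ)) k)
      (fourierCoeff (fun θ => fderiv ℝ U (circlePoint ρ θ) (circlePoint 1 θ)) k) ρ := by
  simp only [fourierCoeff_angle, circlePoint_coe]
  refine HasDerivAt.const_smul (1 / (2 * Real.pi)) ?_
  have hc : Continuous fun x : ℝ => fourier (-k) (x : Angle) :=
    (map_continuous (fourier (-k))).comp (AddCircle.continuous_mk' _)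
  have hU' : Continuous fun p : ℝ × ℝ => fderiv ℝ U (pol p.1 p.2) (pol 1 p.2) :=
    ((hU.continuous_fderiv (by simp)).comp (contDiff_pol (n := 0)).continuous).clm_apply
      ((contDiff_pol (n := 0)).continuous.comp (continuous_const.prodMk continuous_snd))
  have hF' : Continuous fun p : ℝ × ℝ => fourier (-k) (p.2 : Angle) *
      fderiv ℝ U (pol p.1 p.2) (pol 1 p.2) := (hc.comp continuous_snd).mul hU'
  have hF : ∀ ρ, Continuous fun θ : ℝ => fourier (-k) (θ : Angle) * U (pol ρ θ) := fun ρ =>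
    hc.mul (hU.continuous.comp ((contDiff_pol (n := 0)).continuous.comp
      (continuous_const.prodMk continuous_id)))
  obtain ⟨C, hC⟩ := ((isCompact_Icc (a := ρ - 1) (b := ρ + 1)).prod
    (isCompact_Icc (a := -Real.pi) (b := Real.pi))).exists_bound_of_continuousOn hF'.continuousOn
  have hpi : -Real.pi ≤ Real.pi := by linarith [Real.pi_pos]
  refine (intervalIntegral.hasDerivAt_integral_of_dominated_loc_of_deriv_le (s := Ioo (ρ - 1) (ρ + 1))
    (bound := fun _ => C)
    (F' := fun ρ θ => fourier (-k) (θ : Angle) * fderiv ℝ U (pol ρ θ) (pol 1 θ))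
    (Ioo_mem_nhds (by linarith) (by linarith)) ?_ ((hF ρ).intervalIntegrable _ _) ?_ ?_ ?_ ?_).2
  · exact Eventually.of_forall fun ρ => (hF ρ).aestronglyMeasurable
  · exact (hF'.comp (continuous_const.prodMk continuous_id)).aestronglyMeasurable
  · refine ae_of_all _ fun θ hθ x hx => hC (x, θ) ⟨Ioo_subset_Icc_self hx, ?_⟩
    rw [uIoc_of_le hpi] at hθ
    exact Ioc_subset_Icc_self hθ
  · exact intervalIntegrable_const
  · exact ae_of_all _ fun θ _ x _ =>
      (hasDerivAt_comp_pol_radius (hU.differentiable (by simp)) x θ).const_mul _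

/-- Integrate the derivative of `(R - ρ) / (R - r) * ‖y ρ‖²`, which is `‖y r‖²` at `r` and `0` at
`R`, and apply Young's inequality to `K ‖y‖ ‖y'‖`. The term from the linear cutoff carries only one
`K`; `K ≤ K²`, true for `K = |k|` with `k` an integer, absorbs it. -/
theorem mul_norm_sq_le_integral {y y' : ℝ → ℂ} (hy : ∀ ρ, HasDerivAt y (y' ρ) ρ)
    (hy' : Continuous y') {r R : ℝ} (hrR : r < R) {K : ℝ} (hK0 : 0 ≤ K) (hK : K ≤ K ^ 2) :
    K * ‖y r‖ ^ 2 ≤ ∫ ρ in r..R, ((1 / (R - r) + 1) * (K ^ 2 * ‖y ρ‖ ^ 2) + ‖y' ρ‖ ^ 2) := by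
  have hyc : Continuous y := continuous_iff_continuousAt.2 fun ρ => (hy ρ).continuousAt
  have hL : 0 < R - r := sub_pos.2 hrR
  have hd : ∀ ρ, HasDerivAt (fun ρ => (R - ρ) / (R - r) * ‖y ρ‖ ^ 2)
      (-1 / (R - r) * ‖y ρ‖ ^ 2 + (R - ρ) / (R - r) * (2 * inner ℝ (y ρ) (y' ρ))) ρ := fun ρ =>
    (((hasDerivAt_id ρ).const_sub R).div_const (R - r)).mul (hy ρ).norm_sq
  have hc : Continuous fun ρ => -1 / (R - r) * ‖y ρ‖ ^ 2
      + (R - ρ) / (R - r) * (2 * inner ℝ (y ρ) (y' ρ)) := by fun_prop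
  have h1 := intervalIntegral.integral_eq_sub_of_hasDerivAt (a := r) (b := R)
    (fun ρ _ => hd ρ) (hc.intervalIntegrable _ _)
  rw [sub_self, zero_div, zero_mul, div_self hL.ne', one_mul, zero_sub] at h1
  have h2 : K * ‖y r‖ ^ 2 = ∫ ρ in r..R, -K * (-1 / (R - r) * ‖y ρ‖ ^ 2
      + (R - ρ) / (R - r) * (2 * inner ℝ (y ρ) (y' ρ))) := by
    rw [intervalIntegral.integral_const_mul, h1]; ring
  rw [h2]
  refine intervalIntegral.integral_mono_on hrR.le ((continuous_const.mul hc).intervalIntegrable _ _)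
    (Continuous.intervalIntegrable (by fun_prop) _ _) fun ρ hρ => ?_
  have hχ0 : 0 ≤ (R - ρ) / (R - r) := div_nonneg (by linarith [hρ.2]) hL.le
  have hχ1 : (R - ρ) / (R - r) ≤ 1 := by rw [div_le_one hL]; linarith [hρ.1]
  have h3 : |inner ℝ (y ρ) (y' ρ)| ≤ ‖y ρ‖ * ‖y' ρ‖ := abs_real_inner_le_norm _ _
  have h4 : -((R - ρ) / (R - r) * inner ℝ (y ρ) (y' ρ)) ≤ ‖y ρ‖ * ‖y' ρ‖ := by
    refine (neg_le_abs _).trans ?_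
    rw [abs_mul, abs_of_nonneg hχ0]
    exact (mul_le_mul hχ1 h3 (abs_nonneg _) zero_le_one).trans_eq (one_mul _)
  have h5 : K * (1 / (R - r) * ‖y ρ‖ ^ 2) ≤ K ^ 2 * (1 / (R - r) * ‖y ρ‖ ^ 2) :=
    mul_le_mul_of_nonneg_right hK (by positivity)
  have h6 := mul_le_mul_of_nonneg_left h4 hK0
  have h7 : 2 * (K * (‖y ρ‖ * ‖y' ρ‖)) ≤ K ^ 2 * ‖y ρ‖ ^ 2 + ‖y' ρ‖ ^ 2 := by
    nlinarith [sq_nonneg (K * ‖y ρ‖ - ‖y' ρ‖)]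
  have h8 : -1 / (R - r) = -(1 / (R - r)) := by ring
  rw [h8]
  nlinarith

/-- The squared norm of the gradient of a complex function. -/
def gradSq (U : Plane → ℂ) (x : Plane) : ℝ := ‖fderiv ℝ U x (e 0)‖ ^ 2 + ‖fderiv ℝ U x (e 1)‖ ^ 2

theorem continuous_gradSq {U : Plane → ℂ} (hU : ContDiff ℝ ∞ U) : Continuous (gradSq U) := by
  have h : ∀ j, Continuous fun x => fderiv ℝ U x (e j) := fun j =>
    (hU.continuous_fderiv (by simp)).clm_apply continuous_const
  exact ((h 0).norm.pow 2).add ((h 1).norm.pow 2)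

theorem norm_fderiv_apply_sq_le (U : Plane → ℂ) (x v : Plane) :
    ‖fderiv ℝ U x v‖ ^ 2 ≤ ‖v‖ ^ 2 * gradSq U x := by
  rw [clm_apply_eq, norm_sq_plane, gradSq]
  have h1 : ‖v 0 • fderiv ℝ U x (e 0) + v 1 • fderiv ℝ U x (e 1)‖
      ≤ |v 0| * ‖fderiv ℝ U x (e 0)‖ + |v 1| * ‖fderiv ℝ U x (e 1)‖ := by
    refine (norm_add_le _ _).trans ?_
    rw [norm_smul, norm_smul, Real.norm_eq_abs, Real.norm_eq_abs]
  refine (pow_le_pow_left₀ (norm_nonneg _) h1 2).trans ?_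
  rw [← sq_abs (v 0), ← sq_abs (v 1)]
  nlinarith [sq_nonneg (|v 0| * ‖fderiv ℝ U x (e 1)‖ - |v 1| * ‖fderiv ℝ U x (e 0)‖)]

theorem norm_perp (x : Plane) : ‖perp x‖ = ‖x‖ := by
  refine (sq_eq_sq₀ (norm_nonneg _) (norm_nonneg _)).1 ?_
  rw [norm_sq_plane, norm_sq_plane]
  simp [perp]; ring

theorem continuous_perp : Continuous perp := by
  refine (PiLp.continuous_toLp 2 _).comp (continuous_pi fun i => ?_)
  fin_cases i <;> simp <;> fun_prop

theorem norm_circlePoint {ρ : ℝ} (hρ : 0 ≤ ρ) (θ : Angle) : ‖circlePoint ρ θ‖ = ρ := by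
  obtain ⟨x, rfl⟩ := QuotientAddGroup.mk_surjective θ
  exact (congrArg norm (circlePoint_coe ρ x)).trans (norm_pol hρ x)

theorem continuous_fourierCoeff_radial {U : Plane → ℂ} (hU : ContDiff ℝ ∞ U) (k : ℤ) :
    Continuous fun ρ =>
      fourierCoeff (fun θ => fderiv ℝ U (circlePoint ρ θ) (circlePoint 1 θ)) k := by
  simp only [fourierCoeff_angle, circlePoint_coe]
  refine Continuous.const_smul ?_ (1 / (2 * Real.pi))
  refine intervalIntegral.continuous_parametric_intervalIntegral_of_continuous' ?_ _ _
  have hc : Continuous fun x : ℝ => fourier (-k) (x : Angle) :=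
    (map_continuous (fourier (-k))).comp (AddCircle.continuous_mk' _)
  exact (hc.comp continuous_snd).mul (((hU.continuous_fderiv (by simp)).comp
    (contDiff_pol (n := 0)).continuous).clm_apply
    ((contDiff_pol (n := 0)).continuous.comp (continuous_const.prodMk continuous_snd)))

theorem fourierCoeff_angular {U : Plane → ℂ} (hU : ContDiff ℝ ∞ U) (ρ : ℝ) (k : ℤ) :
    fourierCoeff (fun θ => fderiv ℝ U (circlePoint ρ θ) (perp (circlePoint ρ θ))) k
      = Complex.I * k * fourierCoeff (fun θ => U (circlePoint ρ θ)) k := by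
  refine fourierCoeff_of_hasDerivAt ?_ (fun θ => ?_) k
  · exact ((hU.continuous_fderiv (by simp)).comp (continuous_circlePoint ρ)).clm_apply
      (continuous_perp.comp (continuous_circlePoint ρ))
  · simp only [circlePoint_coe]
    exact hasDerivAt_comp_pol_angle (hU.differentiable (by simp)) ρ θ

theorem sum_fourierCoeff_fderiv_le {U : Plane → ℂ} (hU : ContDiff ℝ ∞ U) (s : Finset ℤ) (ρ B : ℝ)
    {w : Angle → Plane} (hw : Continuous w) (hwB : ∀ θ, ‖w θ‖ ≤ B) :
    ∑ k ∈ s, ‖fourierCoeff (fun θ => fderiv ℝ U (circlePoint ρ θ) (w θ)) k‖ ^ 2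
      ≤ B ^ 2 * ∫ θ in (-Real.pi)..Real.pi, gradSq U (pol ρ θ) := by
  have hpi : -Real.pi ≤ Real.pi := by linarith [Real.pi_pos]
  have hpi1 : 1 / (2 * Real.pi) ≤ 1 := by
    rw [div_le_one (by positivity)]; linarith [Real.pi_gt_three]
  have hf : Continuous fun θ : Angle => fderiv ℝ U (circlePoint ρ θ) (w θ) :=
    ((hU.continuous_fderiv (by simp)).comp (continuous_circlePoint ρ)).clm_apply hw
  have hfr : Continuous fun θ : ℝ => ‖fderiv ℝ U (circlePoint ρ θ) (w θ)‖ ^ 2 :=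
    (hf.comp (AddCircle.continuous_mk' _)).norm.pow 2
  have hG : Continuous fun θ : ℝ => gradSq U (pol ρ θ) :=
    (continuous_gradSq hU).comp ((contDiff_pol (n := 0)).continuous.comp
      (continuous_const.prodMk continuous_id))
  refine (sum_norm_sq_fourierCoeff_le hf s).trans ?_
  refine (mul_le_of_le_one_left (intervalIntegral.integral_nonneg hpi fun θ _ => sq_nonneg _)
    hpi1).trans ?_
  rw [← intervalIntegral.integral_const_mul]
  refine intervalIntegral.integral_mono_on hpi (hfr.intervalIntegrable _ _)
    ((continuous_const.mul hG).intervalIntegrable _ _) fun θ _ => ?_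
  refine (norm_fderiv_apply_sq_le U _ _).trans ?_
  rw [circlePoint_coe]
  refine mul_le_mul_of_nonneg_right (pow_le_pow_left₀ (norm_nonneg _) (hwB _) 2) ?_
  exact add_nonneg (sq_nonneg _) (sq_nonneg _)

/-- The one-dimensional estimate is summed over frequencies. The hypotheses are the Bessel bounds
for the angular derivative, whose vector has length `ρ`, and for the radial one. The factor `1 / r`
restores the polar weight `ρ ≥ r`. -/
theorem sum_weighted_le_integral {c d : ℤ → ℝ → ℂ} (hcd : ∀ k ρ, HasDerivAt (c k) (d k ρ) ρ)
    (hd : ∀ k, Continuous (d k)) {I : ℝ → ℝ} (hI : Continuous I) (hI0 : ∀ ρ, 0 ≤ I ρ)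
    {r R : ℝ} (hr : 0 < r) (hR : r < R) (s : Finset ℤ)
    (h1 : ∀ ρ, 0 ≤ ρ → ∑ k ∈ s, |(k : ℝ)| ^ 2 * ‖c k ρ‖ ^ 2 ≤ ρ ^ 2 * I ρ)
    (h2 : ∀ ρ, ∑ k ∈ s, ‖d k ρ‖ ^ 2 ≤ I ρ) :
    ∑ k ∈ s, |(k : ℝ)| * ‖c k r‖ ^ 2
      ≤ ((1 / (R - r) + 1) * R ^ 2 + 1) / r * ∫ ρ in r..R, ρ * I ρ := by
  have hL : 0 < R - r := sub_pos.2 hR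
  obtain ⟨M, hMdef⟩ : ∃ M, M = 1 / (R - r) + 1 := ⟨_, rfl⟩
  have hM : 0 ≤ M := by rw [hMdef]; positivity
  have hcc : ∀ k, Continuous (c k) := fun k =>
    continuous_iff_continuousAt.2 fun ρ => (hcd k ρ).continuousAt
  have hck : ∀ k : ℤ, Continuous fun ρ => M * (|(k : ℝ)| ^ 2 * ‖c k ρ‖ ^ 2) + ‖d k ρ‖ ^ 2 := fun k =>
    (continuous_const.mul (continuous_const.mul ((hcc k).norm.pow 2))).add ((hd k).norm.pow 2)
  rw [← hMdef]
  calc ∑ k ∈ s, |(k : ℝ)| * ‖c k r‖ ^ 2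
      ≤ ∑ k ∈ s, ∫ ρ in r..R, (M * (|(k : ℝ)| ^ 2 * ‖c k ρ‖ ^ 2) + ‖d k ρ‖ ^ 2) := by
        refine Finset.sum_le_sum fun k _ => ?_
        rw [hMdef]
        refine mul_norm_sq_le_integral (hcd k) (hd k) hR (abs_nonneg _) ?_
        rw [sq_abs]
        have : |k| ≤ k ^ 2 := by
          rw [← sq_abs]
          exact Int.le_self_sq _
        exact_mod_cast this
    _ = ∫ ρ in r..R, ∑ k ∈ s, (M * (|(k : ℝ)| ^ 2 * ‖c k ρ‖ ^ 2) + ‖d k ρ‖ ^ 2) :=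
        (intervalIntegral.integral_finsetSum fun k _ => (hck k).intervalIntegrable _ _).symm
    _ ≤ ∫ ρ in r..R, (M * R ^ 2 + 1) / r * (ρ * I ρ) := by
        refine intervalIntegral.integral_mono_on hR.le
          ((continuous_finsetSum _ fun k _ => hck k).intervalIntegrable _ _)
          ((continuous_const.mul (continuous_id.mul hI)).intervalIntegrable _ _) fun ρ hρ => ?_
        have hρ0 : 0 ≤ ρ := hr.le.trans hρ.1
        rw [Finset.sum_add_distrib, ← Finset.mul_sum]
        have h4 : M * (ρ ^ 2 * I ρ) ≤ M * (R ^ 2 * I ρ) :=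
          mul_le_mul_of_nonneg_left (mul_le_mul_of_nonneg_right
            (pow_le_pow_left₀ hρ0 hρ.2 2) (hI0 ρ)) hM
        have h5 := mul_le_mul_of_nonneg_left (h1 ρ hρ0) hM
        have h6 : (M * R ^ 2 + 1) * I ρ ≤ (M * R ^ 2 + 1) / r * (ρ * I ρ) := by
          rw [div_mul_eq_mul_div, le_div_iff₀ hr, mul_assoc]
          refine mul_le_mul_of_nonneg_left ?_ (by positivity)
          rw [mul_comm]
          exact mul_le_mul_of_nonneg_right hρ.1 (hI0 ρ)
        linarith [h2 ρ]
    _ = _ := intervalIntegral.integral_const_mul _ _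

/-- This is the embedding of `H¹` of the annulus into `H^{1/2}` of the inner circle, one Fourier
mode at a time. Finite sets of frequencies suffice: they give summability, and limits can be taken
inside them. -/
theorem trace_inequality {U : Plane → ℂ} (hU : ContDiff ℝ ∞ U) {r R : ℝ} (hr : 0 < r) (hR : r < R)
    (s : Finset ℤ) :
    ∑ k ∈ s, |(k : ℝ)| * ‖fourierCoeff (fun θ => U (circlePoint r θ)) k‖ ^ 2
      ≤ ((1 / (R - r) + 1) * R ^ 2 + 1) / r * ∫ x in annulus r R, gradSq U x := by
  have hpi : -Real.pi ≤ Real.pi := by linarith [Real.pi_pos]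
  have hG : Continuous fun p : ℝ × ℝ => gradSq U (pol p.1 p.2) :=
    (continuous_gradSq hU).comp (contDiff_pol (n := 0)).continuous
  rw [setIntegral_annulus_eq hr hR.le (continuous_gradSq hU).continuousOn]
  simp only [intervalIntegral.integral_const_mul]
  refine sum_weighted_le_integral (fun k ρ => hasDerivAt_fourierCoeff_circle hU k ρ)
    (continuous_fourierCoeff_radial hU)
    (intervalIntegral.continuous_parametric_intervalIntegral_of_continuous' hG _ _)
    (fun ρ => intervalIntegral.integral_nonneg hpi fun θ _ =>
      add_nonneg (sq_nonneg _) (sq_nonneg _)) hr hR s (fun ρ hρ => ?_) fun ρ => ?_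
  · have h1 := sum_fourierCoeff_fderiv_le hU s ρ ρ
      (continuous_perp.comp (continuous_circlePoint ρ))
      fun θ => by rw [Function.comp_apply, norm_perp, norm_circlePoint hρ]
    simp only [Function.comp_apply, fourierCoeff_angular hU, norm_mul, Complex.norm_I, one_mul,
      Complex.norm_intCast, mul_pow] at h1
    exact h1
  · have h2 := sum_fourierCoeff_fderiv_le hU s ρ 1 (continuous_circlePoint 1)
      fun θ => (norm_circlePoint zero_le_one θ).le
    rwa [one_pow, one_mul] at h2

/-! ### The circulation of a smooth map on a circle -/

/-- `toC` as a continuous linear map. -/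
def toCL : Plane →L[ℝ] ℂ :=
  (Complex.equivRealProdCLM.symm : ℝ × ℝ →L[ℝ] ℂ).comp
    ((EuclideanSpace.proj 0 : Plane →L[ℝ] ℝ).prod (EuclideanSpace.proj 1 : Plane →L[ℝ] ℝ))

theorem toCL_apply (p : Plane) : toCL p = toC p := rfl

theorem norm_toC (p : Plane) : ‖toC p‖ = ‖p‖ := by
  refine (sq_eq_sq₀ (norm_nonneg _) (norm_nonneg _)).1 ?_
  rw [norm_sq_plane, ← Complex.normSq_eq_norm_sq, Complex.normSq_apply]
  simp [toC]; ring

theorem contDiff_toC_comp {v : Plane → Plane} (hv : ContDiff ℝ ∞ v) :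
    ContDiff ℝ ∞ fun x => toC (v x) := toCL.contDiff.comp hv

theorem fderiv_toC_comp {v : Plane → Plane} (hv : Differentiable ℝ v) (x h : Plane) :
    fderiv ℝ (fun x => toC (v x)) x h = toC (fderiv ℝ v x h) := by
  have : HasFDerivAt (fun x => toC (v x)) (toCL.comp (fderiv ℝ v x)) x :=
    toCL.hasFDerivAt.comp x (hv x).hasFDerivAt
  rw [this.fderiv]; rfl

theorem fderiv_component {v : Plane → Plane} (hv : Differentiable ℝ v) (x h : Plane) (i : Fin 2) :
    fderiv ℝ (fun x => v x i) x h = fderiv ℝ v x h i := by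
  have : HasFDerivAt (fun x => v x i) ((EuclideanSpace.proj i : Plane →L[ℝ] ℝ).comp (fderiv ℝ v x)) x :=
    (EuclideanSpace.proj i : Plane →L[ℝ] ℝ).hasFDerivAt.comp x (hv x).hasFDerivAt
  rw [this.fderiv]; rfl

/-- The circulation `∮ (u ∂_θ w - w ∂_θ u) dθ` of the map `v = (u, w)` on `∂B_r`. -/
def circulation (v : Plane → Plane) (r : ℝ) : ℝ :=
  ∫ θ in (-Real.pi)..Real.pi, (v (pol r θ) 0 * fderiv ℝ v (pol r θ) (perp (pol r θ)) 1
    - v (pol r θ) 1 * fderiv ℝ v (pol r θ) (perp (pol r θ)) 0)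

/-- The integrand of the circulation is the imaginary part of the conjugate of `v` times `∂_θ v`. By
Parseval the circulation is the same weighted sum as the degree in `circleDegree_eq_tsum`. -/
theorem hasSum_circulation {v : Plane → Plane} (hv : ContDiff ℝ ∞ v) (r : ℝ) :
    HasSum (fun k : ℤ => (k : ℝ) * ‖fourierCoeff (fun θ => toC (v (circlePoint r θ))) k‖ ^ 2)
      (1 / (2 * Real.pi) * circulation v r) := by
  have hU := contDiff_toC_comp hv
  have hvd := hv.differentiable (by simp)
  have hc0 : Continuous fun θ : Angle => toC (v (circlePoint r θ)) :=
    hU.continuous.comp (continuous_circlePoint r)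
  have hc1 : Continuous fun θ : Angle =>
      fderiv ℝ (fun x => toC (v x)) (circlePoint r θ) (perp (circlePoint r θ)) :=
    ((hU.continuous_fderiv (by simp)).comp (continuous_circlePoint r)).clm_apply
      (continuous_perp.comp (continuous_circlePoint r))
  have h := Complex.hasSum_im (hasSum_conj_fourierCoeff_mul hc0 hc1)
  convert h using 1
  · funext k
    rw [fourierCoeff_angular hU, mul_left_comm, Complex.conj_mul', ← Complex.ofReal_pow,
      mul_assoc, ← Complex.ofReal_intCast, ← Complex.ofReal_mul, Complex.I_mul_im, Complex.ofReal_re]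
  · rw [Complex.smul_im, smul_eq_mul]
    congr 1
    have hint : IntervalIntegrable (fun θ : ℝ => (starRingEnd ℂ) (toC (v (circlePoint r θ))) *
        fderiv ℝ (fun x => toC (v x)) (circlePoint r θ) (perp (circlePoint r θ))) volume
        (-Real.pi) Real.pi :=
      (((Complex.continuous_conj.comp hc0).mul hc1).comp
        (AddCircle.continuous_mk' _)).intervalIntegrable _ _
    have := Complex.imCLM.intervalIntegral_comp_comm hint
    simp only [Complex.imCLM_apply] at this
    rw [← this, circulation]
    congr 1; funext θ
    simp only [circlePoint_coe, fderiv_toC_comp hvd]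
    simp [toC, Complex.mul_im]
    ring

/-! ### Square integrable functions -/

section SquareIntegrable

variable {X : Type*} [MeasurableSpace X] {μ : Measure X}

theorem integral_sq_eq_eLpNorm {f : X → ℝ} (hf : MemLp f 2 μ) :
    ∫ x, f x ^ 2 ∂μ = (eLpNorm f 2 μ).toReal ^ 2 := by
  have h0 : 0 ≤ ∫ x, f x ^ 2 ∂μ := integral_nonneg fun x => sq_nonneg _
  rw [hf.eLpNorm_eq_integral_rpow_norm (by norm_num) (by norm_num)]
  simp only [ENNReal.toReal_ofNat, Real.rpow_ofNat, Real.norm_eq_abs, sq_abs]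
  rw [ENNReal.toReal_ofReal (Real.rpow_nonneg h0 _), ← Real.rpow_natCast, ← Real.rpow_mul h0]
  norm_num

theorem tendsto_integral_sq {f : ℕ → X → ℝ} (hf : ∀ n, MemLp (f n) 2 μ)
    (h : Tendsto (fun n => eLpNorm (f n) 2 μ) atTop (𝓝 0)) :
    Tendsto (fun n => ∫ x, f n x ^ 2 ∂μ) atTop (𝓝 0) := by
  simp only [fun n => integral_sq_eq_eLpNorm (hf n)]
  have := ((ENNReal.tendsto_toReal ENNReal.zero_ne_top).comp h).pow 2
  simpa using this

theorem tendsto_integral_mul {f g : ℕ → X → ℝ} {F G : X → ℝ} (hf : ∀ n, MemLp (f n) 2 μ)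
    (hg : ∀ n, MemLp (g n) 2 μ) (hF : MemLp F 2 μ) (hG : MemLp G 2 μ)
    (hfF : Tendsto (fun n => eLpNorm (fun x => f n x - F x) 2 μ) atTop (𝓝 0))
    (hgG : Tendsto (fun n => eLpNorm (fun x => g n x - G x) 2 μ) atTop (𝓝 0)) :
    Tendsto (fun n => ∫ x, f n x * g n x ∂μ) atTop (𝓝 (∫ x, F x * G x ∂μ)) := by
  refine tendsto_integral_of_L1' _ (hF.integrable_mul hG).aestronglyMeasurable
    (Eventually.of_forall fun n => (hf n).integrable_mul (hg n)) ?_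
  have hle : ∀ n, eLpNorm ((fun x => f n x * g n x) - fun x => F x * G x) 1 μ
      ≤ eLpNorm (fun x => f n x - F x) 2 μ * eLpNorm (fun x => g n x - G x) 2 μ
        + eLpNorm (fun x => f n x - F x) 2 μ * eLpNorm G 2 μ
        + eLpNorm F 2 μ * eLpNorm (fun x => g n x - G x) 2 μ := by
    intro n
    have hd1 := (hf n).sub hF
    have hd2 := (hg n).sub hG
    have heq : ((fun x => f n x * g n x) - fun x => F x * G x)
        = ((f n - F) • (g n - G) + (f n - F) • G) + F • (g n - G) := by
      funext x; simp; ring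
    rw [heq]
    refine (eLpNorm_add_le ((hd1.1.smul hd2.1).add (hd1.1.smul hG.1)) (hF.1.smul hd2.1)
      le_rfl).trans (add_le_add ((eLpNorm_add_le (hd1.1.smul hd2.1) (hd1.1.smul hG.1)
      le_rfl).trans (add_le_add ?_ ?_)) ?_)
    · exact eLpNorm_smul_le_mul_eLpNorm hd2.1 hd1.1
    · exact eLpNorm_smul_le_mul_eLpNorm hG.1 hd1.1
    · exact eLpNorm_smul_le_mul_eLpNorm hd2.1 hF.1
  refine tendsto_of_tendsto_of_tendsto_of_le_of_le tendsto_const_nhds ?_ (fun _ => zero_le) hle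
  have h1 := ENNReal.Tendsto.mul hfF (Or.inr ENNReal.zero_ne_top) hgG (Or.inr ENNReal.zero_ne_top)
  have h2 := ENNReal.Tendsto.mul_const hfF (Or.inr hG.eLpNorm_ne_top)
  have h3 := ENNReal.Tendsto.const_mul (a := eLpNorm F 2 μ) hgG (Or.inr hF.eLpNorm_ne_top)
  simpa using (h1.add h2).add h3

end SquareIntegrable

theorem annulus_subset_closedBall (r R : ℝ) : annulus r R ⊆ Metric.closedBall 0 R := fun x hx => by
  simpa using hx.2.le

instance instIsFiniteMeasureAnnulus (r R : ℝ) : IsFiniteMeasure (volume.restrict (annulus r R)) :=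
  ⟨by
    rw [Measure.restrict_apply_univ]
    exact (measure_mono (annulus_subset_closedBall r R)).trans_lt
      (isCompact_closedBall _ _).measure_lt_top⟩

theorem memLp_annulus_of_continuous {E : Type*} [NormedAddCommGroup E]
    {f : Plane → E} (hf : Continuous f) (p : ℝ≥0∞) (r R : ℝ) :
    MemLp f p (volume.restrict (annulus r R)) := by
  obtain ⟨C, hC⟩ := (isCompact_closedBall (0 : Plane) R).exists_bound_of_continuousOn hf.continuousOn
  refine MemLp.of_bound hf.aestronglyMeasurable C ?_
  filter_upwards [ae_restrict_mem (isOpen_annulus r R).measurableSet] with x hx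
  exact hC x (annulus_subset_closedBall r R hx)

/-! ### Continuity of the degree -/

/-- Young's inequality with a free parameter: the multiple of `‖b‖²` can be made small, while the
large constant falls on the difference. -/
theorem abs_norm_sq_sub_le (a b : ℂ) {η : ℝ} (hη : 0 < η) :
    |‖a‖ ^ 2 - ‖b‖ ^ 2| ≤ (1 + 1 / η) * ‖a - b‖ ^ 2 + η * ‖b‖ ^ 2 := by
  have h1 : |‖a‖ - ‖b‖| ≤ ‖a - b‖ := abs_norm_sub_norm_le a b
  have h2 : ‖a‖ + ‖b‖ ≤ ‖a - b‖ + 2 * ‖b‖ := by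
    have := (abs_le.1 h1).2; linarith
  have h3 : |‖a‖ ^ 2 - ‖b‖ ^ 2| = |‖a‖ - ‖b‖| * (‖a‖ + ‖b‖) := by
    rw [sq_sub_sq, abs_mul, abs_of_nonneg (by positivity : 0 ≤ ‖a‖ + ‖b‖), mul_comm]
  rw [h3]
  refine (mul_le_mul h1 h2 (by positivity) (norm_nonneg _)).trans ?_
  have h4 : 2 * (‖a - b‖ * ‖b‖) ≤ 1 / η * ‖a - b‖ ^ 2 + η * ‖b‖ ^ 2 := by
    have h5 : 0 ≤ 1 / η * (‖a - b‖ - η * ‖b‖) ^ 2 := by positivity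
    have h6 : 1 / η * (‖a - b‖ - η * ‖b‖) ^ 2
        = 1 / η * ‖a - b‖ ^ 2 - 2 * (‖a - b‖ * ‖b‖) + η * ‖b‖ ^ 2 := by field_simp; ring
    linarith
  nlinarith

/-- The degree is a quadratic expression controlled by the `H^{1/2}` seminorm. Termwise comparison
bounds the error by `(1 + 1/η) δ n + η S`; one fixes `η` first and then sends `n` to infinity. -/
theorem tendsto_of_hasSum_weighted {a : ℕ → ℤ → ℂ} {b : ℤ → ℂ} {δ D : ℕ → ℝ}
    (hb : Summable fun k : ℤ => |(k : ℝ)| * ‖b k‖ ^ 2) (hδ : Tendsto δ atTop (𝓝 0))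
    (h : ∀ n (s : Finset ℤ), ∑ k ∈ s, |(k : ℝ)| * ‖a n k - b k‖ ^ 2 ≤ δ n)
    (hD : ∀ n, HasSum (fun k : ℤ => (k : ℝ) * ‖a n k‖ ^ 2) (D n)) :
    Tendsto D atTop (𝓝 (∑' k : ℤ, (k : ℝ) * ‖b k‖ ^ 2)) := by
  obtain ⟨S, hS⟩ := hb
  have hS0 : 0 ≤ S := hS.nonneg fun k => by positivity
  have hb' : HasSum (fun k : ℤ => (k : ℝ) * ‖b k‖ ^ 2) (∑' k : ℤ, (k : ℝ) * ‖b k‖ ^ 2) := by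
    refine Summable.hasSum (Summable.of_norm ?_)
    simpa [abs_mul] using hS.summable
  have key : ∀ n (η : ℝ), 0 < η →
      |D n - ∑' k : ℤ, (k : ℝ) * ‖b k‖ ^ 2| ≤ (1 + 1 / η) * δ n + η * S := by
    intro n η hη
    have hs : Summable fun k : ℤ => |(k : ℝ)| * ‖a n k - b k‖ ^ 2 :=
      summable_of_sum_le (fun k => by positivity) (h n)
    have hle : ∑' k : ℤ, |(k : ℝ)| * ‖a n k - b k‖ ^ 2 ≤ δ n :=
      hs.tsum_le_of_sum_le (h n)
    have h1 := (hD n).sub hb'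
    have h2 := (hs.hasSum.mul_left (1 + 1 / η)).add (hS.mul_left η)
    have h3 : ∀ k : ℤ, |(k : ℝ) * ‖a n k‖ ^ 2 - (k : ℝ) * ‖b k‖ ^ 2|
        ≤ (1 + 1 / η) * (|(k : ℝ)| * ‖a n k - b k‖ ^ 2) + η * (|(k : ℝ)| * ‖b k‖ ^ 2) := by
      intro k
      rw [← mul_sub, abs_mul]
      have := mul_le_mul_of_nonneg_left (abs_norm_sq_sub_le (a n k) (b k) hη) (abs_nonneg (k : ℝ))
      linarith
    have h4 := hasSum_le (fun k => (le_abs_self _).trans (h3 k)) h1 h2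
    have h5 := hasSum_le (fun k => (neg_le_abs _).trans (h3 k)) h1.neg h2
    have h6 := mul_le_mul_of_nonneg_left hle (by positivity : 0 ≤ 1 + 1 / η)
    exact abs_le.2 ⟨by linarith, by linarith⟩
  refine Metric.tendsto_atTop.2 fun ε hε => ?_
  -- `S + 1` replaces `S`, which may be zero.
  obtain ⟨η, hηdef⟩ : ∃ η, η = ε / (2 * (S + 1)) := ⟨_, rfl⟩
  have hη : 0 < η := by rw [hηdef]; positivity
  have hηS : η * S < ε / 2 := by
    have : η * (S + 1) = ε / 2 := by rw [hηdef]; field_simp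
    nlinarith
  have hlim : Tendsto (fun n => (1 + 1 / η) * δ n) atTop (𝓝 0) := by
    simpa using hδ.const_mul (1 + 1 / η)
  obtain ⟨N, hN⟩ := eventually_atTop.1 (hlim.eventually (gt_mem_nhds (half_pos hε)))
  refine ⟨N, fun n hn => ?_⟩
  rw [Real.dist_eq]
  linarith [key n η hη, hN n hn]

/-- The `i k` of the derivative and the `-i` of the rotated map multiply to `k`, leaving squared
moduli. -/
theorem circleDegree_eq_tsum (h : Angle → ℂ) :
    circleDegree h = ∑' k : ℤ, (k : ℝ) * ‖fourierCoeff h k‖ ^ 2 := by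
  rw [circleDegree, halfDuality, ← mul_assoc, one_div_mul_cancel (by positivity), one_mul]
  refine tsum_congr fun k => ?_
  rw [fourierCoeff.const_mul]
  have : Complex.I * (k : ℂ) * (-Complex.I * fourierCoeff h k) = (k : ℂ) * fourierCoeff h k := by
    linear_combination (-(k : ℂ) * fourierCoeff h k) * Complex.I_mul_I
  rw [this, map_mul, mul_left_comm, Complex.mul_conj', map_intCast, ← Complex.ofReal_pow,
    ← Complex.ofReal_intCast, ← Complex.ofReal_mul, Complex.ofReal_re]

/-- Traces are taken with respect to `volume`, of mass `2π`, and Fourier coefficients with respect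
to the normalized Haar measure. The comparison carries measurability and `L²` convergence from one
to the other. -/
theorem haarAddCircle_le_volume : (AddCircle.haarAddCircle : Measure Angle) ≤ volume := by
  rw [AddCircle.volume_eq_smul_haarAddCircle]
  intro s
  rw [Measure.smul_apply, smul_eq_mul]
  refine le_mul_of_one_le_left zero_le ?_
  rw [ENNReal.one_le_ofReal]
  linarith [Real.pi_gt_three]

theorem tendsto_fourierCoeff {u : ℕ → Angle → ℂ} {h : Angle → ℂ} (hu : ∀ n, Continuous (u n))
    (hm : AEStronglyMeasurable h volume)
    (hlim : Tendsto (fun n => eLpNorm (fun θ => u n θ - h θ) 2 volume) atTop (𝓝 0)) (k : ℤ) :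
    Tendsto (fun n => fourierCoeff (u n) k) atTop (𝓝 (fourierCoeff h k)) := by
  have hac : (AddCircle.haarAddCircle : Measure Angle) ≪ volume :=
    Measure.absolutelyContinuous_of_le haarAddCircle_le_volume
  have hm' : AEStronglyMeasurable h AddCircle.haarAddCircle := hm.mono_ac hac
  have hf : Continuous fun θ : Angle => fourier (-k) θ := map_continuous (fourier (-k))
  refine tendsto_integral_of_L1' _ (hf.aestronglyMeasurable.smul hm')
    (Eventually.of_forall fun n => ((hf.smul (hu n)).integrable_of_hasCompactSupport
      (HasCompactSupport.of_compactSpace _))) ?_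
  refine tendsto_of_tendsto_of_tendsto_of_le_of_le tendsto_const_nhds hlim (fun _ => zero_le)
    fun n => ?_
  have hd : AEStronglyMeasurable (fun θ => u n θ - h θ) AddCircle.haarAddCircle :=
    (hu n).aestronglyMeasurable.sub hm'
  refine le_trans (le_of_eq ?_) ((eLpNorm_le_eLpNorm_of_exponent_le one_le_two hd).trans
    (eLpNorm_mono_measure _ haarAddCircle_le_volume))
  refine eLpNorm_congr_norm_ae (Eventually.of_forall fun θ => ?_)
  rw [Pi.sub_apply, Pi.smul_apply', ← smul_sub, norm_smul, fourier_apply, Circle.norm_coe, one_mul]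

theorem MemW1pVec.memLp_grad {r R : ℝ} {w : Plane → Plane} {G : Plane → Mat}
    (h : MemW1pVec 2 (annulus r R) w G) (i j : Fin 2) :
    MemLp (fun x => G x i j) 2 (volume.restrict (annulus r R)) :=
  (EuclideanSpace.proj j : Plane →L[ℝ] ℝ).comp_memLp' (h i).2.1

theorem gradSq_toC_sub {v u : Plane → Plane} (hv : Differentiable ℝ v) (hu : Differentiable ℝ u)
    (x : Plane) : gradSq (fun x => toC (v x - u x)) x
      = ∑ j, ∑ i, (fderiv ℝ v x (e j) i - fderiv ℝ u x (e j) i) ^ 2 := by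
  rw [gradSq, fderiv_toC_comp (v := fun x => v x - u x) (hv.sub hu),
    fderiv_toC_comp (v := fun x => v x - u x) (hv.sub hu), norm_toC, norm_toC, norm_sq_plane,
    norm_sq_plane, fderiv_fun_sub (hv x) (hu x)]
  simp [Fin.sum_univ_two]

theorem integral_gradSq_toC_sub_le {r R : ℝ} {v u : Plane → Plane} (hv : ContDiff ℝ ∞ v)
    (hu : ContDiff ℝ ∞ u) {G : Plane → Mat}
    (hG : ∀ i j, MemLp (fun x => G x i j) 2 (volume.restrict (annulus r R))) :
    ∫ x in annulus r R, gradSq (fun x => toC (v x - u x)) x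
      ≤ 2 * ∑ j, ∑ i, ((∫ x in annulus r R, (fderiv ℝ v x (e j) i - G x i j) ^ 2)
        + ∫ x in annulus r R, (fderiv ℝ u x (e j) i - G x i j) ^ 2) := by
  have hm : ∀ {v : Plane → Plane}, ContDiff ℝ ∞ v → ∀ i j,
      MemLp (fun x => fderiv ℝ v x (e j) i) 2 (volume.restrict (annulus r R)) := fun hv i j =>
    memLp_annulus_of_continuous ((EuclideanSpace.proj i : Plane →L[ℝ] ℝ).continuous.comp
      ((hv.continuous_fderiv (by simp)).clm_apply continuous_const)) _ _ _
  simp only [gradSq_toC_sub (hv.differentiable (by simp)) (hu.differentiable (by simp))]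
  have hi : ∀ i j, Integrable (fun x => (fderiv ℝ v x (e j) i - fderiv ℝ u x (e j) i) ^ 2)
      (volume.restrict (annulus r R)) := fun i j => ((hm hv i j).sub (hm hu i j)).integrable_sq
  rw [integral_finsetSum _ fun j _ => integrable_finsetSum _ fun i _ => hi i j, Finset.mul_sum]
  refine Finset.sum_le_sum fun j _ => ?_
  rw [integral_finsetSum _ fun i _ => hi i j, Finset.mul_sum]
  refine Finset.sum_le_sum fun i _ => ?_
  have h1 := ((hm hv i j).sub (hG i j)).integrable_sq
  have h2 := ((hm hu i j).sub (hG i j)).integrable_sq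
  simp only [Pi.sub_apply] at h1 h2
  rw [← integral_add h1 h2, ← integral_const_mul]
  refine integral_mono (hi i j) ((h1.add h2).const_mul 2)
    fun x => ?_
  dsimp only
  nlinarith [sq_nonneg (fderiv ℝ v x (e j) i - G x i j + (fderiv ℝ u x (e j) i - G x i j))]

/-- The circulations of a smooth approximation converge to the degree of the trace. -/
theorem tendsto_circulation {r R : ℝ} (hr : 0 < r) (hR : r < R) {G : Plane → Mat}
    {h : Angle → ℂ} {v : ℕ → Plane → Plane} (hv : ∀ n, ContDiff ℝ ∞ (v n))
    (hG : ∀ i j, MemLp (fun x => G x i j) 2 (volume.restrict (annulus r R)))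
    (hvG : ∀ i j, Tendsto (fun n => eLpNorm (fun x => fderiv ℝ (v n) x (e j) i - G x i j) 2
      (volume.restrict (annulus r R))) atTop (𝓝 0))
    (hvh : Tendsto (fun n => eLpNorm (fun θ => toC (v n (circlePoint r θ)) - h θ) 2 volume)
      atTop (𝓝 0)) (hh : MemHHalfCircle h) :
    Tendsto (fun n => circulation (v n) r) atTop (𝓝 (2 * Real.pi * circleDegree h)) := by
  have hm : ∀ n i j, MemLp (fun x => fderiv ℝ (v n) x (e j) i - G x i j) 2
      (volume.restrict (annulus r R)) := fun n i j =>
    (memLp_annulus_of_continuous ((EuclideanSpace.proj i : Plane →L[ℝ] ℝ).continuous.comp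
      (((hv n).continuous_fderiv (by simp)).clm_apply continuous_const)) _ _ _).sub (hG i j)
  have hI := fun i j => tendsto_integral_sq (fun n => hm n i j) (hvG i j)
  have hc : ∀ n, Continuous fun θ : Angle => toC (v n (circlePoint r θ)) := fun n =>
    (contDiff_toC_comp (hv n)).continuous.comp (continuous_circlePoint r)
  have hF := tendsto_fourierCoeff hc hh.1 hvh
  obtain ⟨K, hK⟩ : ∃ K, K = ((1 / (R - r) + 1) * R ^ 2 + 1) / r := ⟨_, rfl⟩
  have hK0 : 0 ≤ K := by
    have := sub_pos.2 hR
    rw [hK]; positivity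
  obtain ⟨I, hIdef⟩ : ∃ I : ℕ → Fin 2 → Fin 2 → ℝ, ∀ n i j,
    I n i j = ∫ x in annulus r R, (fderiv ℝ (v n) x (e j) i - G x i j) ^ 2 := ⟨_, fun _ _ _ => rfl⟩
  simp only [← hIdef] at hI
  have hlim : Tendsto (fun n => 1 / (2 * Real.pi) * circulation (v n) r) atTop
      (𝓝 (circleDegree h)) := by
    rw [circleDegree_eq_tsum]
    refine tendsto_of_hasSum_weighted (δ := fun n => K * (2 * ∑ j, ∑ i, I n i j)) hh.2.2 ?_ ?_
      fun n => hasSum_circulation (hv n) r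
    · have : Tendsto (fun n => K * (2 * ∑ j, ∑ i, I n i j)) atTop
          (𝓝 (K * (2 * ∑ j : Fin 2, ∑ i : Fin 2, (0 : ℝ)))) :=
        (tendsto_finsetSum _ fun j _ => tendsto_finsetSum _ fun i _ => hI i j).const_mul 2
          |>.const_mul K
      simpa using this
    · intro n s
      -- The trace inequality applies to differences of smooth approximations only. On a finite set
      -- of frequencies, `m → ∞` replaces `v m` by the trace `h`, using convergence of each
      -- coefficient.
      have hl : Tendsto (fun m => ∑ k ∈ s, |(k : ℝ)| *
          ‖fourierCoeff (fun θ => toC (v n (circlePoint r θ))) k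
            - fourierCoeff (fun θ => toC (v m (circlePoint r θ))) k‖ ^ 2) atTop
          (𝓝 (∑ k ∈ s, |(k : ℝ)| * ‖fourierCoeff (fun θ => toC (v n (circlePoint r θ))) k
            - fourierCoeff h k‖ ^ 2)) :=
        tendsto_finsetSum _ fun k _ => (((hF k).const_sub _).norm.pow 2).const_mul _
      have hr' : Tendsto (fun m => K * (2 * ∑ j, ∑ i, (I n i j + I m i j))) atTop
          (𝓝 (K * (2 * ∑ j, ∑ i, (I n i j + 0)))) :=
        ((tendsto_finsetSum _ fun j _ => tendsto_finsetSum _ fun i _ =>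
          (hI i j).const_add _).const_mul 2).const_mul K
      simp only [add_zero] at hr'
      refine le_of_tendsto_of_tendsto' hl hr' fun m => ?_
      have h1 := trace_inequality (contDiff_toC_comp ((hv n).sub (hv m))) hr hR s
      have h2 := integral_gradSq_toC_sub_le (hv n) (hv m) hG
      simp only [← hIdef] at h2
      rw [← hK] at h1
      refine le_trans (le_of_eq ?_) (h1.trans (mul_le_mul_of_nonneg_left h2 hK0))
      refine Finset.sum_congr rfl fun k _ => ?_
      congr 3
      have hi : ∀ n, Integrable (fun θ : Angle => fourier (-k) θ • toC (v n (circlePoint r θ)))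
          AddCircle.haarAddCircle := fun n =>
        ((map_continuous (fourier (-k))).smul (hc n)).integrable_of_hasCompactSupport
          (HasCompactSupport.of_compactSpace _)
      rw [fourierCoeff, fourierCoeff, ← integral_sub (hi n) (hi m), fourierCoeff]
      refine integral_congr_ae (ae_of_all _ fun θ => ?_)
      simp only [← smul_sub, ← toCL_apply, map_sub]
  have := hlim.const_mul (2 * Real.pi)
  simpa only [← mul_assoc, mul_one_div_cancel Real.two_pi_pos.ne', one_mul] using this

/-! ### Passing to the limit in quadratic expressions -/

theorem tendsto_integral_continuous_mul_mul {r R : ℝ} {η : Plane → ℝ} (hη : Continuous η)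
    {f g : ℕ → Plane → ℝ} {F G : Plane → ℝ}
    (hf : ∀ n, MemLp (f n) 2 (volume.restrict (annulus r R)))
    (hg : ∀ n, MemLp (g n) 2 (volume.restrict (annulus r R)))
    (hF : MemLp F 2 (volume.restrict (annulus r R)))
    (hG : MemLp G 2 (volume.restrict (annulus r R)))
    (hfF : Tendsto (fun n => eLpNorm (fun x => f n x - F x) 2 (volume.restrict (annulus r R)))
      atTop (𝓝 0))
    (hgG : Tendsto (fun n => eLpNorm (fun x => g n x - G x) 2 (volume.restrict (annulus r R)))
      atTop (𝓝 0)) :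
    Tendsto (fun n => ∫ x in annulus r R, η x * (f n x * g n x)) atTop
      (𝓝 (∫ x in annulus r R, η x * (F x * G x))) := by
  obtain ⟨C, hC⟩ := (isCompact_closedBall (0 : Plane) R).exists_bound_of_continuousOn hη.continuousOn
  have hb : ∀ᵐ x ∂volume.restrict (annulus r R), ‖η x‖ ≤ C := by
    filter_upwards [ae_restrict_mem (isOpen_annulus r R).measurableSet] with x hx
    exact hC x (annulus_subset_closedBall r R hx)
  have hm : ∀ {u : Plane → ℝ}, MemLp u 2 (volume.restrict (annulus r R)) →
      MemLp (fun x => η x * u x) 2 (volume.restrict (annulus r R)) := fun hu =>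
    hu.of_le_mul (c := C) (hη.aestronglyMeasurable.mul hu.1) (hb.mono fun x hx => by
      rw [norm_mul]; exact mul_le_mul_of_nonneg_right hx (norm_nonneg _))
  simp only [← mul_assoc]
  refine tendsto_integral_mul (fun n => hm (hf n)) hg (hm hF) hG ?_ hgG
  have h0 := ENNReal.Tendsto.const_mul (a := ENNReal.ofReal C) hfF (Or.inr ENNReal.ofReal_ne_top)
  rw [mul_zero] at h0
  refine tendsto_of_tendsto_of_tendsto_of_le_of_le tendsto_const_nhds h0 (fun _ => zero_le)
    fun n => eLpNorm_le_mul_eLpNorm_of_ae_le_mul (hb.mono fun x hx => ?_) _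
  rw [← mul_sub, norm_mul]
  exact mul_le_mul_of_nonneg_right hx (norm_nonneg _)

/-- The sequence `v` of smooth maps converges to `w`, with gradient `G`, in `H¹(A_{r,R}; ℝ²)`. -/
structure SmoothApprox (r R : ℝ) (w : Plane → Plane) (G : Plane → Mat) (v : ℕ → Plane → Plane) :
    Prop where
  smooth : ∀ n, ContDiff ℝ ∞ (v n)
  memLp_val : ∀ i, MemLp (fun x => w x i) 2 (volume.restrict (annulus r R))
  memLp_grad : ∀ i j, MemLp (fun x => G x i j) 2 (volume.restrict (annulus r R))
  tendsto_val : ∀ i, Tendsto (fun n => eLpNorm (fun x => v n x i - w x i) 2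
    (volume.restrict (annulus r R))) atTop (𝓝 0)
  tendsto_grad : ∀ i j, Tendsto (fun n => eLpNorm (fun x => fderiv ℝ (v n) x (e j) i - G x i j) 2
    (volume.restrict (annulus r R))) atTop (𝓝 0)

namespace SmoothApprox

variable {r R : ℝ} {w : Plane → Plane} {G : Plane → Mat} {v : ℕ → Plane → Plane}

theorem continuous_val (h : SmoothApprox r R w G v) (n : ℕ) (i : Fin 2) :
    Continuous fun x => v n x i :=
  (EuclideanSpace.proj i : Plane →L[ℝ] ℝ).continuous.comp (h.smooth n).continuous

theorem continuous_grad (h : SmoothApprox r R w G v) (n : ℕ) (i j : Fin 2) :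
    Continuous fun x => fderiv ℝ (v n) x (e j) i :=
  (EuclideanSpace.proj i : Plane →L[ℝ] ℝ).continuous.comp
    (((h.smooth n).continuous_fderiv (by simp)).clm_apply continuous_const)

theorem tendsto_val_mul_val (h : SmoothApprox r R w G v) {η : Plane → ℝ} (hη : Continuous η)
    (i k : Fin 2) : Tendsto (fun n => ∫ x in annulus r R, η x * (v n x i * v n x k)) atTop
      (𝓝 (∫ x in annulus r R, η x * (w x i * w x k))) :=
  tendsto_integral_continuous_mul_mul hη
    (fun n => memLp_annulus_of_continuous (h.continuous_val n i) _ _ _)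
    (fun n => memLp_annulus_of_continuous (h.continuous_val n k) _ _ _)
    (h.memLp_val i) (h.memLp_val k) (h.tendsto_val i) (h.tendsto_val k)

theorem tendsto_val_mul_grad (h : SmoothApprox r R w G v) {η : Plane → ℝ} (hη : Continuous η)
    (i k j : Fin 2) :
    Tendsto (fun n => ∫ x in annulus r R, η x * (v n x i * fderiv ℝ (v n) x (e j) k)) atTop
      (𝓝 (∫ x in annulus r R, η x * (w x i * G x k j))) :=
  tendsto_integral_continuous_mul_mul hη
    (fun n => memLp_annulus_of_continuous (h.continuous_val n i) _ _ _)
    (fun n => memLp_annulus_of_continuous (h.continuous_grad n k j) _ _ _)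
    (h.memLp_val i) (h.memLp_grad k j) (h.tendsto_val i) (h.tendsto_grad k j)

theorem tendsto_grad_mul_grad (h : SmoothApprox r R w G v) {η : Plane → ℝ} (hη : Continuous η)
    (i j k l : Fin 2) :
    Tendsto (fun n => ∫ x in annulus r R,
        η x * (fderiv ℝ (v n) x (e j) i * fderiv ℝ (v n) x (e l) k)) atTop
      (𝓝 (∫ x in annulus r R, η x * (G x i j * G x k l))) :=
  tendsto_integral_continuous_mul_mul hη
    (fun n => memLp_annulus_of_continuous (h.continuous_grad n i j) _ _ _)
    (fun n => memLp_annulus_of_continuous (h.continuous_grad n k l) _ _ _)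
    (h.memLp_grad i j) (h.memLp_grad k l) (h.tendsto_grad i j) (h.tendsto_grad k l)

theorem integrable_continuous_mul {u : Plane → ℝ}
    (hu : Integrable u (volume.restrict (annulus r R))) {η : Plane → ℝ} (hη : Continuous η) :
    Integrable (fun x => η x * u x) (volume.restrict (annulus r R)) := by
  obtain ⟨C, hC⟩ := (isCompact_closedBall (0 : Plane) R).exists_bound_of_continuousOn hη.continuousOn
  refine hu.bdd_mul (c := C) hη.aestronglyMeasurable ?_
  filter_upwards [ae_restrict_mem (isOpen_annulus r R).measurableSet] with x hx
  exact hC x (annulus_subset_closedBall r R hx)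

/-- The gradient of an `S¹`-valued map is tangential. -/
theorem ae_orthogonal (h : SmoothApprox r R w G v)
    (hw : ∀ᵐ x ∂(volume.restrict (annulus r R)), ‖w x‖ = 1) (j : Fin 2) :
    ∀ᵐ x ∂(volume.restrict (annulus r R)), w x 0 * G x 0 j + w x 1 * G x 1 j = 0 := by
  have hi : ∀ k, Integrable (fun x => w x k * G x k j) (volume.restrict (annulus r R)) := fun k =>
    (h.memLp_val k).integrable_mul (h.memLp_grad k j)
  rw [ae_restrict_iff' (isOpen_annulus r R).measurableSet]
  refine (isOpen_annulus r R).ae_eq_zero_of_integral_contDiff_smul_eq_zero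
    (IntegrableOn.locallyIntegrableOn ((hi 0).add (hi 1))) fun η hη hc hs => ?_
  have hηc := hη.continuous
  rw [← setIntegral_eq_integral_of_forall_compl_eq_zero (s := annulus r R) fun x hx => by
    rw [image_eq_zero_of_notMem_tsupport fun h' => hx (hs h'), zero_smul]]
  have hη' : Continuous fun x => fderiv ℝ η x (e j) := continuous_fderiv_apply_e hη j
  have hL := (h.tendsto_val_mul_grad hηc 0 0 j).add (h.tendsto_val_mul_grad hηc 1 1 j)
  have hR := ((h.tendsto_val_mul_val hη' 0 0).add (h.tendsto_val_mul_val hη' 1 1)).const_mul (-1 / 2)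
  -- For smooth maps `v · ∂ⱼv = ½ ∂ⱼ|v|²`, integrated by parts. In the limit `|w|² = 1`, and the
  -- right side becomes a multiple of the integral of `∂ⱼη`, which is zero.
  have heq : ∀ n, (∫ x in annulus r R, η x * (v n x 0 * fderiv ℝ (v n) x (e j) 0))
      + ∫ x in annulus r R, η x * (v n x 1 * fderiv ℝ (v n) x (e j) 1)
      = -1 / 2 * ((∫ x in annulus r R, fderiv ℝ η x (e j) * (v n x 0 * v n x 0))
        + ∫ x in annulus r R, fderiv ℝ η x (e j) * (v n x 1 * v n x 1)) := by
    intro n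
    have hvd := (h.smooth n).differentiable (by simp)
    have hk : ∀ k, (∫ x in annulus r R, η x * (v n x k * fderiv ℝ (v n) x (e j) k))
        = -1 / 2 * ∫ x in annulus r R, fderiv ℝ η x (e j) * (v n x k * v n x k) := by
      intro k
      have hvk : ContDiff ℝ ∞ fun x => v n x k :=
        (EuclideanSpace.proj k : Plane →L[ℝ] ℝ).contDiff.comp (h.smooth n)
      have h1 := (IsWeakPartial.of_contDiff (u := fun x => v n x k * v n x k)
        ((hvk.mul hvk).of_le (by simp)) (annulus r R) j).2.2 η hη hc hs
      have h2 : ∀ x, fderiv ℝ (fun x => v n x k * v n x k) x (e j)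
          = 2 * (v n x k * fderiv ℝ (v n) x (e j) k) := by
        intro x
        have hd : DifferentiableAt ℝ (fun x => v n x k) x := hvk.differentiable (by simp) x
        rw [fderiv_fun_mul hd hd]
        simp only [_root_.add_apply, _root_.smul_apply, smul_eq_mul,
          fderiv_component hvd]
        ring
      simp only [h2] at h1
      have h3 : ∀ x, 2 * (v n x k * fderiv ℝ (v n) x (e j) k) * η x
          = 2 * (η x * (v n x k * fderiv ℝ (v n) x (e j) k)) := fun x => by ring
      simp only [h3, integral_const_mul] at h1
      simp only [mul_comm (fderiv ℝ η _ _)]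
      linarith
    rw [hk 0, hk 1]; ring
  have hlim := tendsto_nhds_unique hL (hR.congr fun n => (heq n).symm)
  have h1 : ∫ x in annulus r R, η x • (w x 0 * G x 0 j + w x 1 * G x 1 j)
      = (∫ x in annulus r R, η x * (w x 0 * G x 0 j))
        + ∫ x in annulus r R, η x * (w x 1 * G x 1 j) := by
    rw [← integral_add (integrable_continuous_mul (hi 0) hηc)
      (integrable_continuous_mul (hi 1) hηc)]
    simp only [smul_eq_mul, mul_add]
  have hii : ∀ k, Integrable (fun x => w x k * w x k) (volume.restrict (annulus r R)) := fun k =>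
    (h.memLp_val k).integrable_mul (h.memLp_val k)
  have h2 : (∫ x in annulus r R, fderiv ℝ η x (e j) * (w x 0 * w x 0))
      + ∫ x in annulus r R, fderiv ℝ η x (e j) * (w x 1 * w x 1)
      = ∫ x in annulus r R, (1 : ℝ) * fderiv ℝ η x (e j) := by
    rw [← integral_add (integrable_continuous_mul (hii 0) hη')
      (integrable_continuous_mul (hii 1) hη')]
    refine integral_congr_ae (hw.mono fun x hx => ?_)
    have : w x 0 ^ 2 + w x 1 ^ 2 = 1 := by rw [← norm_sq_plane, hx, one_pow]
    dsimp only
    linear_combination fderiv ℝ η x (e j) * this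
  have h3 := (IsWeakPartial.of_contDiff (u := fun _ => (1 : ℝ)) contDiff_const
    (annulus r R) j).2.2 η hη hc hs
  rw [h1, hlim, h2, h3]
  simp

/-- The angular velocity of the map `w`: the vector `ξ` such that `∇w = w^⊥ ⊗ ξ`. -/
theorem ae_grad_eq_tensor (h : SmoothApprox r R w G v)
    (hw : ∀ᵐ x ∂(volume.restrict (annulus r R)), ‖w x‖ = 1) :
    ∀ᵐ x ∂(volume.restrict (annulus r R)), G x = tensor (perp (w x))
      !₂[w x 0 * G x 1 0 - w x 1 * G x 0 0, w x 0 * G x 1 1 - w x 1 * G x 0 1] := by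
  filter_upwards [hw, h.ae_orthogonal hw 0, h.ae_orthogonal hw 1] with x hx h0 h1
  have hn : w x 0 ^ 2 + w x 1 ^ 2 = 1 := by rw [← norm_sq_plane, hx, one_pow]
  ext i j
  fin_cases i <;> fin_cases j <;> simp [tensor, perp]
  · linear_combination -G x 0 0 * hn + w x 0 * h0
  · linear_combination -G x 0 1 * hn + w x 0 * h1
  · linear_combination -G x 1 0 * hn + w x 1 * h0
  · linear_combination -G x 1 1 * hn + w x 1 * h1

/-- A tangential gradient has rank at most one; this removes the Jacobian term from the limit of
Stokes' identity. -/
theorem ae_det_eq_zero (h : SmoothApprox r R w G v)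
    (hw : ∀ᵐ x ∂(volume.restrict (annulus r R)), ‖w x‖ = 1) :
    ∀ᵐ x ∂(volume.restrict (annulus r R)), G x 0 0 * G x 1 1 - G x 0 1 * G x 1 0 = 0 := by
  filter_upwards [h.ae_grad_eq_tensor hw] with x hx
  rw [hx]
  simp only [tensor, Matrix.of_apply]
  ring

end SmoothApprox

/-! ### Stokes' identity for the circulation, and its limit. -/

theorem integral_combination {X : Type*} [MeasurableSpace X] {μ : Measure X}
    {f₁ f₂ f₃ f₄ f₅ f₆ : X → ℝ} (h₁ : Integrable f₁ μ) (h₂ : Integrable f₂ μ)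
    (h₃ : Integrable f₃ μ) (h₄ : Integrable f₄ μ) (h₅ : Integrable f₅ μ) (h₆ : Integrable f₆ μ) :
    ∫ x, (f₁ x - f₂ x - (f₃ x - f₄ x) + 2 * (f₅ x - f₆ x)) ∂μ
      = (∫ x, f₁ x ∂μ) - (∫ x, f₂ x ∂μ) - ((∫ x, f₃ x ∂μ) - ∫ x, f₄ x ∂μ)
        + 2 * ((∫ x, f₅ x ∂μ) - ∫ x, f₆ x ∂μ) := by
  have h12 : Integrable (fun x => f₁ x - f₂ x) μ := h₁.sub h₂
  have h34 : Integrable (fun x => f₃ x - f₄ x) μ := h₃.sub h₄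
  have h56 : Integrable (fun x => f₅ x - f₆ x) μ := h₅.sub h₆
  have h : Integrable (fun x => f₁ x - f₂ x - (f₃ x - f₄ x)) μ := h12.sub h34
  rw [integral_add h (h56.const_mul 2), integral_sub h12 h34, integral_sub h₁ h₂,
    integral_sub h₃ h₄, integral_const_mul, integral_sub h₅ h₆]

/-- Difference of Stokes' theorem for the pairs `(H v₀, v₁)` and `(H v₁, v₀)`. Only the inner circle
contributes, and there `H` is the constant `c`. Both pairs produce the Jacobian of `v`, hence the
factor `2`. -/
theorem setIntegral_annulus_circulation {v : Plane → Plane} (hv : ContDiff ℝ ∞ v) {H : Plane → ℝ}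
    (hH : ContDiff ℝ ∞ H) {r R c : ℝ} (hr : 0 < r) (hR : r ≤ R) (hHR : ∀ x, ‖x‖ = R → H x = 0)
    (hHr : ∀ x, ‖x‖ = r → H x = c) :
    (∫ x in annulus r R, (fderiv ℝ H x (e 0) * (v x 0 * fderiv ℝ v x (e 1) 1)
        - fderiv ℝ H x (e 0) * (v x 1 * fderiv ℝ v x (e 1) 0)
        - (fderiv ℝ H x (e 1) * (v x 0 * fderiv ℝ v x (e 0) 1)
          - fderiv ℝ H x (e 1) * (v x 1 * fderiv ℝ v x (e 0) 0))
        + 2 * (H x * (fderiv ℝ v x (e 0) 0 * fderiv ℝ v x (e 1) 1)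
          - H x * (fderiv ℝ v x (e 1) 0 * fderiv ℝ v x (e 0) 1))))
      = -(c * circulation v r) := by
  have hvd := hv.differentiable (by simp)
  have hvk : ∀ k : Fin 2, ContDiff ℝ ∞ fun x => v x k := fun k =>
    (EuclideanSpace.proj k : Plane →L[ℝ] ℝ).contDiff.comp hv
  have hprod : ∀ (k j : Fin 2) (x : Plane), fderiv ℝ (fun x => H x * v x k) x (e j)
      = H x * fderiv ℝ v x (e j) k + v x k * fderiv ℝ H x (e j) := by
    intro k j x
    rw [fderiv_fun_mul (hH.differentiable (by simp) x) ((hvk k).differentiable (by simp) x)]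
    simp only [_root_.add_apply, _root_.smul_apply, smul_eq_mul,
      fderiv_component hvd]
  have h0 := setIntegral_annulus_jacobian (hH.mul (hvk 0)) (hvk 1) hr hR
    fun x hx => by rw [hHR x hx, zero_mul]
  have h1 := setIntegral_annulus_jacobian (hH.mul (hvk 1)) (hvk 0) hr hR
    fun x hx => by rw [hHR x hx, zero_mul]
  have hp : ∀ θ, H (pol r θ) = c := fun θ => hHr _ (norm_pol hr.le θ)
  have hpc : Continuous fun θ => pol r θ :=
    (contDiff_pol (n := 0)).continuous.comp (continuous_const.prodMk continuous_id)
  have hc1 : ∀ k : Fin 2, Continuous fun x => v x k := fun k => (hvk k).continuous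
  have hc2 : ∀ k j : Fin 2, Continuous fun x => fderiv ℝ v x (e j) k := fun k j =>
    (EuclideanSpace.proj k : Plane →L[ℝ] ℝ).continuous.comp
      ((hv.continuous_fderiv (by simp)).clm_apply continuous_const)
  have hc3 : ∀ k : Fin 2, Continuous fun θ => fderiv ℝ v (pol r θ) (perp (pol r θ)) k := fun k =>
    (EuclideanSpace.proj k : Plane →L[ℝ] ℝ).continuous.comp
      (((hv.continuous_fderiv (by simp)).comp hpc).clm_apply (continuous_perp.comp hpc))
  have hcH := hH.continuous
  have hcH' := fun j => continuous_fderiv_apply_e hH j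
  simp only [hprod, fderiv_component hvd, hp] at h0 h1
  have hi : ∀ k l : Fin 2, IntervalIntegrable (fun θ => v (pol r θ) k *
      fderiv ℝ v (pol r θ) (perp (pol r θ)) l) volume (-Real.pi) Real.pi := fun k l =>
    (((hc1 k).comp hpc).mul (hc3 l)).intervalIntegrable _ _
  rw [circulation, intervalIntegral.integral_sub (hi 0 1) (hi 1 0), mul_sub,
    ← intervalIntegral.integral_const_mul, ← intervalIntegral.integral_const_mul]
  simp only [mul_assoc] at h0 h1
  have : ∀ a b : ℝ, -(a - b) = -a - -b := fun a b => by ring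
  have hint : ∀ k l : Fin 2, Integrable (fun x =>
      (H x * fderiv ℝ v x (e 0) k + v x k * fderiv ℝ H x (e 0)) * fderiv ℝ v x (e 1) l
        - (H x * fderiv ℝ v x (e 1) k + v x k * fderiv ℝ H x (e 1)) * fderiv ℝ v x (e 0) l)
      (volume.restrict (annulus r R)) := fun k l =>
    (memLp_annulus_of_continuous (((((hcH.mul (hc2 k 0)).add ((hc1 k).mul (hcH' 0))).mul
      (hc2 l 1))).sub ((((hcH.mul (hc2 k 1)).add ((hc1 k).mul (hcH' 1))).mul (hc2 l 0))))
      1 r R).integrable le_rfl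
  rw [this, ← h0, ← h1, ← integral_sub (hint 0 1) (hint 1 0)]
  congr 1; funext x; ring

namespace SmoothApprox

variable {r R : ℝ} {w : Plane → Plane} {G : Plane → Mat} {v : ℕ → Plane → Plane}

/-- The topological lower bound: `∇H × ξ` has a prescribed integral. -/
theorem setIntegral_cross (h : SmoothApprox r R w G v)
    (hw : ∀ᵐ x ∂(volume.restrict (annulus r R)), ‖w x‖ = 1) {H : Plane → ℝ}
    (hH : ContDiff ℝ ∞ H) {c d : ℝ} (hr : 0 < r) (hR : r ≤ R) (hHR : ∀ x, ‖x‖ = R → H x = 0)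
    (hHr : ∀ x, ‖x‖ = r → H x = c) (hd : Tendsto (fun n => circulation (v n) r) atTop (𝓝 d)) :
    ∫ x in annulus r R, (fderiv ℝ H x (e 0) * (w x 0 * G x 1 1 - w x 1 * G x 0 1)
      - fderiv ℝ H x (e 1) * (w x 0 * G x 1 0 - w x 1 * G x 0 0)) = -(c * d) := by
  have hcH := hH.continuous
  have hcH' := fun j => continuous_fderiv_apply_e hH j
  have key := ((((h.tendsto_val_mul_grad (hcH' 0) 0 1 1).sub
    (h.tendsto_val_mul_grad (hcH' 0) 1 0 1)).sub
    ((h.tendsto_val_mul_grad (hcH' 1) 0 1 0).sub (h.tendsto_val_mul_grad (hcH' 1) 1 0 0))).add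
    (((h.tendsto_grad_mul_grad hcH 0 0 1 1).sub
      (h.tendsto_grad_mul_grad hcH 0 1 1 0)).const_mul 2))
  have hcirc := fun n => setIntegral_annulus_circulation (h.smooth n) hH hr hR hHR hHr
  have hi1 : ∀ i k j l, Integrable (fun x => fderiv ℝ H x (e l) * (w x i * G x k j))
      (volume.restrict (annulus r R)) := fun i k j l =>
    integrable_continuous_mul ((h.memLp_val i).integrable_mul (h.memLp_grad k j)) (hcH' l)
  have hi2 : ∀ i k j l, Integrable (fun x => H x * (G x i l * G x k j))
      (volume.restrict (annulus r R)) := fun i k j l =>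
    integrable_continuous_mul ((h.memLp_grad i l).integrable_mul (h.memLp_grad k j)) hcH
  have hn1 : ∀ n i k j l, Integrable (fun x => fderiv ℝ H x (e l) *
      (v n x i * fderiv ℝ (v n) x (e j) k)) (volume.restrict (annulus r R)) := fun n i k j l =>
    (memLp_annulus_of_continuous ((hcH' l).mul
      ((h.continuous_val n i).mul (h.continuous_grad n k j))) 1 r R).integrable le_rfl
  have hn2 : ∀ n i k j l, Integrable (fun x => H x *
      (fderiv ℝ (v n) x (e l) i * fderiv ℝ (v n) x (e j) k)) (volume.restrict (annulus r R)) :=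
    fun n i k j l => (memLp_annulus_of_continuous (hcH.mul
      ((h.continuous_grad n i l).mul (h.continuous_grad n k j))) 1 r R).integrable le_rfl
  have hlim := tendsto_nhds_unique key ((hd.const_mul c).neg.congr fun n => by
    rw [← hcirc n]
    exact integral_combination (hn1 n _ _ _ _) (hn1 n _ _ _ _) (hn1 n _ _ _ _) (hn1 n _ _ _ _)
      (hn2 n _ _ _ _) (hn2 n _ _ _ _))
  rw [← hlim, ← integral_combination (hi1 _ _ _ _) (hi1 _ _ _ _) (hi1 _ _ _ _) (hi1 _ _ _ _)
    (hi2 _ _ _ _) (hi2 _ _ _ _)]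
  -- The limit map has zero Jacobian, so the terms containing undifferentiated `H` disappear.
  refine integral_congr_ae ((h.ae_det_eq_zero hw).mono fun x hx => ?_)
  linear_combination (-2 * H x) * hx

end SmoothApprox

/-! ### The dual quadratic form -/

/-- The coefficients of a positive definite matrix `[[a, b], [b, c]]` with determinant `D²`. -/
structure IsEllipticForm (a b c D : ℝ) : Prop where
  a_pos : 0 < a
  c_pos : 0 < c
  D_pos : 0 < D
  sq_eq : D ^ 2 = a * c - b ^ 2

/-- The quadratic form of the adjugate of `[[a, b], [b, c]]`. -/
def dualForm (a b c : ℝ) (x : Plane) : ℝ := c * x 0 ^ 2 - 2 * b * x 0 * x 1 + a * x 1 ^ 2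

theorem contDiff_coord (i : Fin 2) : ContDiff ℝ ∞ fun x : Plane => x i :=
  (EuclideanSpace.proj i : Plane →L[ℝ] ℝ).contDiff

theorem contDiff_dualForm (a b c : ℝ) : ContDiff ℝ ∞ (dualForm a b c) := by
  have h0 := contDiff_coord 0
  have h1 := contDiff_coord 1
  unfold dualForm
  fun_prop

theorem fderiv_dualForm (a b c : ℝ) (x v : Plane) :
    fderiv ℝ (dualForm a b c) x v
      = 2 * ((c * x 0 - b * x 1) * v 0 + (a * x 1 - b * x 0) * v 1) := by
  have hp : ∀ i : Fin 2, HasFDerivAt (fun x : Plane => x i)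
      (EuclideanSpace.proj i : Plane →L[ℝ] ℝ) x := fun i =>
    (EuclideanSpace.proj i : Plane →L[ℝ] ℝ).hasFDerivAt
  have h := ((((hp 0).pow 2).const_mul c).sub (((hp 0).const_mul (2 * b)).mul (hp 1))).add
    (((hp 1).pow 2).const_mul a)
  have h' : HasFDerivAt (dualForm a b c) _ x := h
  rw [h'.fderiv]
  simp
  ring

theorem dualForm_pol (a b c ρ θ : ℝ) : dualForm a b c (pol ρ θ) = ρ ^ 2 * dualForm a b c (pol 1 θ) := by
  simp only [dualForm, pol_zero, pol_one]; ring

theorem continuous_pol_angle (ρ : ℝ) : Continuous fun θ => pol ρ θ :=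
  (contDiff_pol (n := 0)).continuous.comp (continuous_const.prodMk continuous_id)

namespace IsEllipticForm

variable {a b c D : ℝ}

/-- The adjugate has eigenvalues with sum `a + c` and product `D²`, so both lie between `D² / (a +
c)` and `a + c`. These two bounds fix the levels `s` and `t` at which the test function becomes
constant. -/
theorem dualForm_le (h : IsEllipticForm a b c D) (x : Plane) :
    dualForm a b c x ≤ (a + c) * ‖x‖ ^ 2 := by
  have h1 : a * ((a + c) * ‖x‖ ^ 2 - dualForm a b c x) = (a * x 0 + b * x 1) ^ 2 + D ^ 2 * x 1 ^ 2 := by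
    rw [norm_sq_plane, h.sq_eq, dualForm]; ring
  have h2 : 0 ≤ a * ((a + c) * ‖x‖ ^ 2 - dualForm a b c x) := by rw [h1]; positivity
  linarith [nonneg_of_mul_nonneg_right h2 h.a_pos]

theorem le_dualForm (h : IsEllipticForm a b c D) (x : Plane) :
    D ^ 2 / (a + c) * ‖x‖ ^ 2 ≤ dualForm a b c x := by
  have hac : 0 < a + c := add_pos h.a_pos h.c_pos
  rw [div_mul_eq_mul_div, div_le_iff₀ hac]
  have h1 : dualForm a b c x * (a + c) - D ^ 2 * ‖x‖ ^ 2
      = (c * x 0 - b * x 1) ^ 2 + (a * x 1 - b * x 0) ^ 2 := by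
    rw [norm_sq_plane, h.sq_eq, dualForm]; ring
  have h2 : 0 ≤ dualForm a b c x * (a + c) - D ^ 2 * ‖x‖ ^ 2 := by rw [h1]; positivity
  linarith

theorem dualForm_pos (h : IsEllipticForm a b c D) {x : Plane} (hx : x ≠ 0) :
    0 < dualForm a b c x :=
  (mul_pos (div_pos (pow_pos h.D_pos 2) (add_pos h.a_pos h.c_pos))
    (pow_pos (norm_pos_iff.2 hx) 2)).trans_le (h.le_dualForm x)

theorem dualForm_pol_pos (h : IsEllipticForm a b c D) {ρ : ℝ} (hρ : 0 < ρ) (θ : ℝ) :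
    0 < dualForm a b c (pol ρ θ) :=
  h.dualForm_pos (norm_pos_iff.1 (by rw [norm_pol hρ.le]; exact hρ))

theorem continuous_inv_dualForm_pol (h : IsEllipticForm a b c D) :
    Continuous fun θ => 1 / dualForm a b c (pol 1 θ) :=
  continuous_const.div ((contDiff_dualForm a b c).continuous.comp (continuous_pol_angle 1))
    fun θ => (h.dualForm_pol_pos one_pos θ).ne'

/-- An antiderivative is `arctan ((a tan θ - b) / D)`, which increases from `-π/2` to `π/2`. This
angular integral produces the constant `2π D` in both the lower and the upper bound. -/
theorem integral_inv_dualForm_half (h : IsEllipticForm a b c D) :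
    ∫ θ in (-(Real.pi / 2))..(Real.pi / 2), D * (1 / dualForm a b c (pol 1 θ)) = Real.pi := by
  have hD := h.D_pos
  have hpi : -(Real.pi / 2) < Real.pi / 2 := by linarith [Real.pi_pos]
  have hd : ∀ x ∈ Ioo (-(Real.pi / 2)) (Real.pi / 2),
      HasDerivAt (fun θ => Real.arctan ((a * Real.tan θ - b) / D))
        (D * (1 / dualForm a b c (pol 1 x))) x := by
    intro x hx
    have hc := Real.cos_pos_of_mem_Ioo hx
    have hn := (h.dualForm_pol_pos one_pos x).ne'
    convert ((((Real.hasDerivAt_tan_of_mem_Ioo hx).const_mul a).sub_const b).div_const D).arctan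
      using 1
    have h1 : 1 + ((a * Real.tan x - b) / D) ^ 2
        = a * dualForm a b c (pol 1 x) / (D ^ 2 * Real.cos x ^ 2) := by
      rw [eq_div_iff (by positivity), Real.tan_eq_sin_div_cos]
      field_simp
      rw [h.sq_eq, dualForm, pol_zero, pol_one]
      ring
    rw [h1]
    have ha := h.a_pos.ne'
    field_simp
  have htop : Tendsto (fun t : ℝ => (a * t - b) / D) atTop atTop :=
    (tendsto_atTop_add_const_right _ (-b) (tendsto_id.const_mul_atTop h.a_pos)).atTop_div_const hD
  have hbot : Tendsto (fun t : ℝ => (a * t - b) / D) atBot atBot :=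
    (tendsto_atBot_add_const_right _ (-b) (tendsto_id.const_mul_atBot h.a_pos)).atBot_div_const hD
  rw [intervalIntegral.integral_eq_sub_of_hasDerivAt_of_tendsto hpi hd
    ((continuous_const.mul h.continuous_inv_dualForm_pol).intervalIntegrable _ _)
    (((Real.tendsto_arctan_atBot.comp hbot).comp Real.tendsto_tan_neg_pi_div_two).mono_right
      nhdsWithin_le_nhds)
    (((Real.tendsto_arctan_atTop.comp htop).comp Real.tendsto_tan_pi_div_two).mono_right
      nhdsWithin_le_nhds)]
  ring

theorem integral_inv_dualForm (h : IsEllipticForm a b c D) :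
    ∫ θ in (-Real.pi)..Real.pi, D * (1 / dualForm a b c (pol 1 θ)) = 2 * Real.pi := by
  have hper : Function.Periodic (fun θ => D * (1 / dualForm a b c (pol 1 θ))) Real.pi := by
    intro θ
    simp only [dualForm, pol_zero, pol_one, Real.cos_add_pi, Real.sin_add_pi]
    ring
  have hint : ∀ s t, IntervalIntegrable (fun θ => D * (1 / dualForm a b c (pol 1 θ))) volume s t :=
    fun s t => (continuous_const.mul h.continuous_inv_dualForm_pol).intervalIntegrable s t
  have h0 := h.integral_inv_dualForm_half
  have h1 := hper.intervalIntegral_add_eq (-(Real.pi / 2)) (-Real.pi)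
  have h2 := hper.intervalIntegral_add_eq (-(Real.pi / 2)) 0
  rw [show -(Real.pi / 2) + Real.pi = Real.pi / 2 by ring, h0] at h1 h2
  rw [neg_add_cancel] at h1
  rw [zero_add] at h2
  rw [← intervalIntegral.integral_add_adjacent_intervals (hint (-Real.pi) 0) (hint 0 Real.pi),
    ← h1, ← h2]
  ring

end IsEllipticForm

/-! ### The radial test function -/

/-- A smooth approximation of `1/(2τ)` on `(s, t)`, supported in `[s, t]`. -/
def radialDensity (s t τ : ℝ) : ℝ :=
  Real.smoothTransition (τ / s - 1) * Real.smoothTransition (2 - 2 * τ / t) * (2 * τ)⁻¹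

section RadialDensity

variable {s t : ℝ}

theorem radialDensity_of_le (hs : 0 < s) {τ : ℝ} (hτ : τ ≤ s) : radialDensity s t τ = 0 := by
  rw [radialDensity, Real.smoothTransition.zero_of_nonpos, zero_mul, zero_mul]
  rw [sub_nonpos, div_le_one hs]; exact hτ

theorem radialDensity_of_ge (ht : 0 < t) {τ : ℝ} (hτ : t ≤ τ) : radialDensity s t τ = 0 := by
  rw [radialDensity, Real.smoothTransition.zero_of_nonpos (x := 2 - 2 * τ / t), mul_zero, zero_mul]
  rw [sub_nonpos, le_div_iff₀ ht]; linarith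

theorem radialDensity_of_mem (hs : 0 < s) (ht : 0 < t) {τ : ℝ} (h1 : 2 * s ≤ τ) (h2 : τ ≤ t / 2) :
    radialDensity s t τ = (2 * τ)⁻¹ := by
  rw [radialDensity, Real.smoothTransition.one_of_one_le, Real.smoothTransition.one_of_one_le,
    one_mul, one_mul]
  · rw [le_sub_comm, div_le_iff₀ ht]; linarith
  · rw [le_sub_iff_add_le, le_div_iff₀ hs]; linarith

theorem radialDensity_nonneg (hs : 0 < s) (τ : ℝ) : 0 ≤ radialDensity s t τ := by
  rcases le_total τ s with h | h
  · rw [radialDensity_of_le hs h]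
  · have : 0 ≤ τ := hs.le.trans h
    have h1 := Real.smoothTransition.nonneg (τ / s - 1)
    have h2 := Real.smoothTransition.nonneg (2 - 2 * τ / t)
    rw [radialDensity]; positivity

/-- The cutoffs lie between `0` and `1`, so they can only lower `1 / (2τ)` for positive `τ`. The
pointwise duality bound needs exactly this. -/
theorem mul_radialDensity_le_one {τ : ℝ} : 2 * τ * radialDensity s t τ ≤ 1 := by
  rcases eq_or_ne τ 0 with rfl | h
  · simp
  · have h1 := mul_le_one₀ (Real.smoothTransition.le_one (τ / s - 1))
      (Real.smoothTransition.nonneg _) (Real.smoothTransition.le_one (2 - 2 * τ / t))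
    rw [radialDensity, mul_comm, mul_assoc, inv_mul_cancel₀ (by positivity), mul_one]
    exact h1

theorem contDiff_radialDensity (hs : 0 < s) : ContDiff ℝ ∞ (radialDensity s t) := by
  refine contDiff_iff_contDiffAt.2 fun τ => ?_
  rcases lt_or_ge τ s with h | h
  · refine contDiffAt_const (c := (0 : ℝ)) |>.congr_of_eventuallyEq ?_
    filter_upwards [gt_mem_nhds h] with x hx
    exact radialDensity_of_le hs hx.le
  · have h0 : (2 * τ) ≠ 0 := by have := hs.trans_le h; positivity
    have hS : ContDiff ℝ ∞ Real.smoothTransition := Real.smoothTransition.contDiff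
    have h1 : ContDiff ℝ ∞ fun τ : ℝ => Real.smoothTransition (τ / s - 1) :=
      hS.comp ((contDiff_id.div_const s).sub contDiff_const)
    have h2 : ContDiff ℝ ∞ fun τ : ℝ => Real.smoothTransition (2 - 2 * τ / t) :=
      hS.comp (contDiff_const.sub ((contDiff_const.mul contDiff_id).div_const t))
    exact (h1.mul h2).contDiffAt.mul ((contDiff_const.mul contDiff_id).contDiffAt.inv h0)

theorem continuous_radialDensity (hs : 0 < s) : Continuous (radialDensity s t) :=
  (contDiff_radialDensity hs).continuous

/-- The primitive of `radialDensity`, an approximation of `½ log` between two constants. -/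
def radialPrimitive (s t x : ℝ) : ℝ := ∫ τ in s..x, radialDensity s t τ

theorem hasDerivAt_radialPrimitive (hs : 0 < s) (x : ℝ) :
    HasDerivAt (radialPrimitive s t) (radialDensity s t x) x :=
  ((continuous_radialDensity hs).integral_hasStrictDerivAt s x).hasDerivAt

theorem contDiff_radialPrimitive (hs : 0 < s) : ContDiff ℝ ∞ (radialPrimitive s t) := by
  have h : deriv (radialPrimitive s t) = radialDensity s t :=
    funext fun x => (hasDerivAt_radialPrimitive hs x).deriv
  exact contDiff_infty_iff_deriv.2 ⟨fun x => (hasDerivAt_radialPrimitive hs x).differentiableAt,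
    h ▸ contDiff_radialDensity hs⟩

theorem radialPrimitive_of_le (hs : 0 < s) {x : ℝ} (hx : x ≤ s) : radialPrimitive s t x = 0 := by
  rw [radialPrimitive, intervalIntegral.integral_symm, neg_eq_zero]
  refine intervalIntegral.integral_zero_ae (ae_of_all _ fun τ hτ => ?_)
  rw [uIoc_of_le hx] at hτ
  exact radialDensity_of_le hs hτ.2

theorem radialPrimitive_of_ge (hs : 0 < s) (ht : 0 < t) {x : ℝ} (hx : t ≤ x) :
    radialPrimitive s t x = radialPrimitive s t t := by
  have hc := continuous_radialDensity (t := t) hs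
  rw [radialPrimitive, ← intervalIntegral.integral_add_adjacent_intervals
    (hc.intervalIntegrable s t) (hc.intervalIntegrable t x), ← radialPrimitive, add_eq_left]
  refine intervalIntegral.integral_zero_ae (ae_of_all _ fun τ hτ => ?_)
  rw [uIoc_of_le hx] at hτ
  exact radialDensity_of_ge ht hτ.1.le

/-- Only `[2 s, t / 2]`, where both cutoffs are `1`, is kept; the loss is the constant `4` inside
the logarithm. -/
theorem le_radialPrimitive (hs : 0 < s) (hst : 4 * s ≤ t) :
    1 / 2 * Real.log (t / (4 * s)) ≤ radialPrimitive s t t := by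
  have ht : 0 < t := by linarith
  have hc := continuous_radialDensity (t := t) hs
  have h1 : ∫ τ in (2 * s)..(t / 2), radialDensity s t τ ≤ radialPrimitive s t t :=
    intervalIntegral.integral_mono_interval (by linarith) (by linarith) (by linarith)
      (ae_of_all _ fun τ => radialDensity_nonneg hs τ) (hc.intervalIntegrable _ _)
  refine le_trans (le_of_eq ?_) h1
  have h2 : ∫ τ in (2 * s)..(t / 2), radialDensity s t τ = ∫ τ in (2 * s)..(t / 2), 1 / 2 * (1 / τ) := by
    refine intervalIntegral.integral_congr fun τ hτ => ?_
    rw [uIcc_of_le (by linarith)] at hτ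
    rw [radialDensity_of_mem hs ht hτ.1 hτ.2, mul_inv]
    ring
  rw [h2, intervalIntegral.integral_const_mul, integral_one_div_of_pos (by positivity) (by positivity)]
  congr 2
  field_simp
  norm_num

end RadialDensity

namespace IsEllipticForm

variable {a b c D : ℝ}

/-- On each ray `τ = ρ² q(θ)` turns the integral into `1 / q(θ)` times an increment of the
primitive. By the choice of `s` and `t` the ray crosses the whole support of the density, so the
increment does not depend on `θ`; the angular integral then contributes `2π / D`. -/
theorem setIntegral_radialDensity (h : IsEllipticForm a b c D) {r R s t : ℝ} (hr : 0 < r)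
    (hR : r ≤ R) (hs : s = (a + c) * r ^ 2) (ht : t = D ^ 2 / (a + c) * R ^ 2) :
    ∫ x in annulus r R, 2 * radialDensity s t (dualForm a b c x)
      = 2 * Real.pi / D * radialPrimitive s t t := by
  have hac : 0 < a + c := add_pos h.a_pos h.c_pos
  have hD := h.D_pos
  have hR0 : 0 < R := hr.trans_le hR
  have hs0 : 0 < s := by rw [hs]; positivity
  have ht0 : 0 < t := by rw [ht]; positivity
  have hc := continuous_radialDensity (t := t) hs0
  have hF : Continuous fun x => 2 * radialDensity s t (dualForm a b c x) :=
    continuous_const.mul (hc.comp (contDiff_dualForm a b c).continuous)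
  have hpi : -Real.pi ≤ Real.pi := by linarith [Real.pi_pos]
  rw [setIntegral_annulus_eq hr hR hF.continuousOn, intervalIntegral_swap
    (f := fun ρ θ => ρ * (2 * radialDensity s t (dualForm a b c (pol ρ θ)))) (continuous_fst.mul
      (hF.comp (contDiff_pol (n := 0)).continuous)) _ _ _ _ hR hpi]
  have hinner : ∀ θ, ∫ ρ in r..R, ρ * (2 * radialDensity s t (dualForm a b c (pol ρ θ)))
      = radialPrimitive s t t / D * (D * (1 / dualForm a b c (pol 1 θ))) := by
    intro θ
    have hn := h.dualForm_pol_pos one_pos θ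
    have h1 := intervalIntegral.integral_comp_mul_deriv (a := r) (b := R)
      (f := fun ρ => ρ ^ 2 * dualForm a b c (pol 1 θ))
      (f' := fun ρ => 2 * ρ * dualForm a b c (pol 1 θ)) (g := radialDensity s t)
      (fun ρ _ => by simpa using (hasDerivAt_pow 2 ρ).mul_const (dualForm a b c (pol 1 θ)))
      (by fun_prop) hc
    have h2 : radialPrimitive s t (R ^ 2 * dualForm a b c (pol 1 θ)) = radialPrimitive s t t := by
      refine radialPrimitive_of_ge hs0 ht0 ?_
      have := h.le_dualForm (pol 1 θ)
      rw [norm_pol zero_le_one, one_pow, mul_one] at this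
      rw [ht, mul_comm]
      exact mul_le_mul_of_nonneg_left this (by positivity)
    have h3 : radialPrimitive s t (r ^ 2 * dualForm a b c (pol 1 θ)) = 0 := by
      refine radialPrimitive_of_le hs0 ?_
      have := h.dualForm_le (pol 1 θ)
      rw [norm_pol zero_le_one, one_pow, mul_one] at this
      rw [hs, mul_comm (a + c)]
      exact mul_le_mul_of_nonneg_left this (by positivity)
    have h4 : ∫ τ in (r ^ 2 * dualForm a b c (pol 1 θ))..(R ^ 2 * dualForm a b c (pol 1 θ)),
        radialDensity s t τ = radialPrimitive s t t := by
      have := intervalIntegral.integral_interval_sub_left (hc.intervalIntegrable (μ := volume) s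
        (R ^ 2 * dualForm a b c (pol 1 θ))) (hc.intervalIntegrable s
        (r ^ 2 * dualForm a b c (pol 1 θ)))
      rw [← this, ← radialPrimitive, ← radialPrimitive, h2, h3, sub_zero]
    rw [h4] at h1
    have h5 : ∀ ρ, ρ * (2 * radialDensity s t (dualForm a b c (pol ρ θ)))
        = (1 / dualForm a b c (pol 1 θ)) * ((radialDensity s t ∘ fun ρ =>
          ρ ^ 2 * dualForm a b c (pol 1 θ)) ρ * (2 * ρ * dualForm a b c (pol 1 θ))) := by
      intro ρ
      rw [Function.comp_apply, dualForm_pol]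
      field_simp
    simp only [h5, intervalIntegral.integral_const_mul, h1]
    field_simp
  simp only [hinner, intervalIntegral.integral_const_mul, h.integral_inv_dualForm]
  ring

/-- A duality estimate for the quadratic form of `[[a, b], [b, c]]`. -/
theorem duality_le (h : IsEllipticForm a b c D) (p₀ p₁ x y l : ℝ) :
    2 * l * (p₀ * y - p₁ * x) - l ^ 2 * ((a * p₀ ^ 2 + 2 * b * p₀ * p₁ + c * p₁ ^ 2) / D ^ 2)
      ≤ a * x ^ 2 + 2 * b * x * y + c * y ^ 2 := by
  have hD := h.D_pos
  have hn : ∀ u v : ℝ, 0 ≤ a * u ^ 2 + 2 * b * u * v + c * v ^ 2 := by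
    intro u v
    have h1 : a * (a * u ^ 2 + 2 * b * u * v + c * v ^ 2) = (a * u + b * v) ^ 2 + D ^ 2 * v ^ 2 := by
      rw [h.sq_eq]; ring
    exact nonneg_of_mul_nonneg_right (h1 ▸ by positivity) h.a_pos
  -- The subtracted vector is `l A⁻¹ (-p₁, p₀)`, where the form minus the linear term is smallest.
  -- Expanding the square gives the claim.
  have h2 := hn (x - l * ((-c * p₁ - b * p₀) / D ^ 2)) (y - l * ((b * p₁ + a * p₀) / D ^ 2))
  have h3 : a * (x - l * ((-c * p₁ - b * p₀) / D ^ 2)) ^ 2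
      + 2 * b * (x - l * ((-c * p₁ - b * p₀) / D ^ 2)) * (y - l * ((b * p₁ + a * p₀) / D ^ 2))
      + c * (y - l * ((b * p₁ + a * p₀) / D ^ 2)) ^ 2
      = (a * x ^ 2 + 2 * b * x * y + c * y ^ 2) - (2 * l * (p₀ * y - p₁ * x)
        - l ^ 2 * ((a * p₀ ^ 2 + 2 * b * p₀ * p₁ + c * p₁ ^ 2) / D ^ 2)) := by
    have : a * c = D ^ 2 + b ^ 2 := by rw [h.sq_eq]; ring
    field_simp
    have ha : c = (D ^ 2 + b ^ 2) / a := by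
      rw [eq_div_iff h.a_pos.ne', ← this]; ring
    have := h.a_pos.ne'
    rw [ha]
    field_simp
    ring
  linarith

end IsEllipticForm

/-! ### The lower bound -/

theorem fderiv_radial {a b c s t : ℝ} (hs : 0 < s) (L : ℝ) (x v : Plane) :
    fderiv ℝ (fun x => L - radialPrimitive s t (dualForm a b c x)) x v
      = -(radialDensity s t (dualForm a b c x) * fderiv ℝ (dualForm a b c) x v) := by
  have h1 := ((hasDerivAt_radialPrimitive (t := t) hs (dualForm a b c x)).comp_hasFDerivAt x
    ((contDiff_dualForm a b c).differentiable (by simp) x).hasFDerivAt).const_sub L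
  have h2 : HasFDerivAt (fun x => L - radialPrimitive s t (dualForm a b c x)) _ x := h1
  rw [h2.fderiv]
  simp

/-- The gradient of the test function is `-φ ∇q`, with `φ` the density at `q`, and `⟨A∇q, ∇q⟩ = 4 D²
q`. So the quadratic term of the duality estimate is `4 q φ² ≤ 2 φ`, by `2 q φ ≤ 1`. -/
theorem IsEllipticForm.pointwise_le {a b c D : ℝ} (h : IsEllipticForm a b c D) {s t : ℝ}
    (hs : 0 < s) (L l : ℝ) (x : Plane) (ξ₀ ξ₁ : ℝ) :
    2 * l * (fderiv ℝ (fun x => L - radialPrimitive s t (dualForm a b c x)) x (e 0) * ξ₁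
        - fderiv ℝ (fun x => L - radialPrimitive s t (dualForm a b c x)) x (e 1) * ξ₀)
      - l ^ 2 * (2 * radialDensity s t (dualForm a b c x))
      ≤ a * ξ₀ ^ 2 + 2 * b * ξ₀ * ξ₁ + c * ξ₁ ^ 2 := by
  obtain ⟨p₀, hp0⟩ : ∃ p, p = fderiv ℝ (fun x => L - radialPrimitive s t (dualForm a b c x)) x (e 0) :=
    ⟨_, rfl⟩
  obtain ⟨p₁, hp1⟩ : ∃ p, p = fderiv ℝ (fun x => L - radialPrimitive s t (dualForm a b c x)) x (e 1) :=
    ⟨_, rfl⟩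
  rw [← hp0, ← hp1]
  refine le_trans ?_ (h.duality_le p₀ p₁ ξ₀ ξ₁ l)
  refine sub_le_sub_left (mul_le_mul_of_nonneg_left ?_ (sq_nonneg l)) _
  have hD := h.D_pos
  obtain ⟨φ, hφ⟩ : ∃ φ, φ = radialDensity s t (dualForm a b c x) := ⟨_, rfl⟩
  have hφ0 : 0 ≤ φ := hφ ▸ radialDensity_nonneg hs _
  have hφ1 : 2 * dualForm a b c x * φ ≤ 1 := hφ ▸ mul_radialDensity_le_one
  have e0 : p₀ = -(φ * (2 * (c * x 0 - b * x 1))) := by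
    rw [hp0, fderiv_radial hs, fderiv_dualForm, hφ]; simp [e]
  have e1 : p₁ = -(φ * (2 * (a * x 1 - b * x 0))) := by
    rw [hp1, fderiv_radial hs, fderiv_dualForm, hφ]; simp [e]
  have h1 : a * p₀ ^ 2 + 2 * b * p₀ * p₁ + c * p₁ ^ 2
      = D ^ 2 * (2 * φ * (2 * dualForm a b c x * φ)) := by
    rw [e0, e1, h.sq_eq, dualForm]; ring
  rw [h1, mul_div_cancel_left₀ _ (pow_ne_zero 2 hD.ne'), ← hφ]
  exact mul_le_of_le_one_right (by positivity) hφ1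

namespace SmoothApprox

variable {r R : ℝ} {w : Plane → Plane} {G : Plane → Mat} {v : ℕ → Plane → Plane}

theorem memLp_val_mul_grad (h : SmoothApprox r R w G v)
    (hw : ∀ᵐ x ∂(volume.restrict (annulus r R)), ‖w x‖ = 1) (i k j : Fin 2) :
    MemLp (fun x => w x i * G x k j) 2 (volume.restrict (annulus r R)) := by
  refine (h.memLp_grad k j).of_le ((h.memLp_val i).1.mul (h.memLp_grad k j).1) (hw.mono fun x hx => ?_)
  rw [norm_mul]
  exact mul_le_of_le_one_left (norm_nonneg _) ((PiLp.norm_apply_le (w x) i).trans hx.le)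

theorem le_setIntegral (h : SmoothApprox r R w G v)
    (hw : ∀ᵐ x ∂(volume.restrict (annulus r R)), ‖w x‖ = 1) {a b c D : ℝ}
    (hE : IsEllipticForm a b c D) {s t : ℝ} (hr : 0 < r) (hR : r < R) (hs : s = (a + c) * r ^ 2)
    (ht : t = D ^ 2 / (a + c) * R ^ 2) {z : ℝ}
    (hd : Tendsto (fun n => circulation (v n) r) atTop (𝓝 (2 * Real.pi * z))) :
    2 * Real.pi * D * z ^ 2 * radialPrimitive s t t
      ≤ ∫ x in annulus r R, (a * (w x 0 * G x 1 0 - w x 1 * G x 0 0) ^ 2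
        + 2 * b * (w x 0 * G x 1 0 - w x 1 * G x 0 0) * (w x 0 * G x 1 1 - w x 1 * G x 0 1)
        + c * (w x 0 * G x 1 1 - w x 1 * G x 0 1) ^ 2) := by
  have hac : 0 < a + c := add_pos hE.a_pos hE.c_pos
  have hD := hE.D_pos
  have hR0 : 0 < R := hr.trans hR
  have hs0 : 0 < s := by rw [hs]; positivity
  have ht0 : 0 < t := by rw [ht]; positivity
  obtain ⟨L, hL⟩ : ∃ L, L = radialPrimitive s t t := ⟨_, rfl⟩
  -- This function equals `L` on `{q ≤ s}`, which contains the inner circle, and `0` on `{q ≥ t}`,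
  -- which contains the outer one.
  have hH : ContDiff ℝ ∞ fun x => L - radialPrimitive s t (dualForm a b c x) :=
    contDiff_const.sub ((contDiff_radialPrimitive hs0).comp (contDiff_dualForm a b c))
  have hcross := h.setIntegral_cross hw hH (c := L) hr hR.le
    (fun x hx => by
      rw [radialPrimitive_of_ge hs0 ht0, hL, sub_self]
      rw [ht, ← hx]; exact hE.le_dualForm x)
    (fun x hx => by
      rw [radialPrimitive_of_le hs0, sub_zero]
      rw [hs, ← hx]; exact hE.dualForm_le x) hd
  have hξ : ∀ j, MemLp (fun x => w x 0 * G x 1 j - w x 1 * G x 0 j) 2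
      (volume.restrict (annulus r R)) := fun j =>
    (h.memLp_val_mul_grad hw 0 1 j).sub (h.memLp_val_mul_grad hw 1 0 j)
  have hint1 : Integrable (fun x =>
      fderiv ℝ (fun x => L - radialPrimitive s t (dualForm a b c x)) x (e 0)
          * (w x 0 * G x 1 1 - w x 1 * G x 0 1)
        - fderiv ℝ (fun x => L - radialPrimitive s t (dualForm a b c x)) x (e 1)
          * (w x 0 * G x 1 0 - w x 1 * G x 0 0)) (volume.restrict (annulus r R)) :=
    (integrable_continuous_mul ((hξ 1).integrable one_le_two) (continuous_fderiv_apply_e hH 0)).sub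
      (integrable_continuous_mul ((hξ 0).integrable one_le_two) (continuous_fderiv_apply_e hH 1))
  have hint2 : Integrable (fun x => 2 * radialDensity s t (dualForm a b c x))
      (volume.restrict (annulus r R)) :=
    (memLp_annulus_of_continuous (continuous_const.mul ((continuous_radialDensity hs0).comp
      (contDiff_dualForm a b c).continuous)) 1 r R).integrable le_rfl
  have hint3 : Integrable (fun x => a * (w x 0 * G x 1 0 - w x 1 * G x 0 0) ^ 2
      + 2 * b * (w x 0 * G x 1 0 - w x 1 * G x 0 0) * (w x 0 * G x 1 1 - w x 1 * G x 0 1)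
      + c * (w x 0 * G x 1 1 - w x 1 * G x 0 1) ^ 2) (volume.restrict (annulus r R)) := by
    have h1 := (((hξ 0).integrable_sq.const_mul a).add
      (((hξ 0).integrable_mul (hξ 1)).const_mul (2 * b))).add ((hξ 1).integrable_sq.const_mul c)
    refine h1.congr (ae_of_all _ fun x => ?_)
    simp only [Pi.add_apply, Pi.mul_apply]
    ring
  -- The multiplier `-z D` maximizes the integrated lower bound: the linear part gives `4π D z² L`,
  -- the quadratic part takes away `2π D z² L`.
  have hmono := integral_mono ((hint1.const_mul (2 * (-z * D))).sub
    (hint2.const_mul ((-z * D) ^ 2))) hint3 fun x => hE.pointwise_le hs0 L (-z * D) x _ _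
  refine le_trans (le_of_eq ?_) hmono
  rw [integral_sub' (hint1.const_mul _) (hint2.const_mul _), integral_const_mul, integral_const_mul,
    hcross, hE.setIntegral_radialDensity hr hR.le hs ht, ← hL]
  field_simp
  ring

end SmoothApprox

/-- The definition of the trace supplies a single sequence converging both in the annulus and on the
circle, so the degree condition becomes a statement on circulations. -/
theorem Admissible.exists_smoothApprox {r R : ℝ} {z : ℤ} {w : Plane → Plane} {G : Plane → Mat}
    (h : Admissible r R z w G) (hr : 0 < r) (hR : r < R) : ∃ v, SmoothApprox r R w G v ∧
      Tendsto (fun n => circulation (v n) r) atTop (𝓝 (2 * Real.pi * z)) := by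
  obtain ⟨⟨hW, -⟩, g, ⟨v, hv, hvw, hvG, hvg⟩, hg, hdeg⟩ := h
  refine ⟨v, ⟨hv, fun i => (hW i).1, hW.memLp_grad, fun i => ?_, hvG⟩, ?_⟩
  · refine tendsto_of_tendsto_of_tendsto_of_le_of_le tendsto_const_nhds hvw (fun _ => zero_le)
      fun n => eLpNorm_mono fun x => ?_
    exact PiLp.norm_apply_le (v n x - w x) i
  · rw [← hdeg]
    exact tendsto_circulation hr hR hv hW.memLp_grad hvG hvg hg

theorem Admissible.le_setIntegral {r R : ℝ} {z : ℤ} {w : Plane → Plane} {G : Plane → Mat}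
    (h : Admissible r R z w G) (hr : 0 < r) (hR : r < R) {a b c D : ℝ}
    (hE : IsEllipticForm a b c D) {φ : Plane → Mat → ℝ}
    (hφ : ∀ p ξ : Plane, ‖p‖ = 1 → φ p (tensor (perp p) ξ)
      = a * ξ 0 ^ 2 + 2 * b * ξ 0 * ξ 1 + c * ξ 1 ^ 2)
    (hrR : 4 * ((a + c) * r ^ 2) ≤ D ^ 2 / (a + c) * R ^ 2) :
    2 * Real.pi * D * (z : ℝ) ^ 2 * (Real.log (R / r) - Real.log (2 * (a + c) / D))
      ≤ ∫ x in annulus r R, φ (w x) (G x) := by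
  obtain ⟨v, hv, hd⟩ := h.exists_smoothApprox hr hR
  have hac : 0 < a + c := add_pos hE.a_pos hE.c_pos
  have hD := hE.D_pos
  have hR0 : 0 < R := hr.trans hR
  have h1 := hv.le_setIntegral h.1.2 hE hr hR rfl rfl hd
  have h2 : ∫ x in annulus r R, φ (w x) (G x)
      = ∫ x in annulus r R, (a * (w x 0 * G x 1 0 - w x 1 * G x 0 0) ^ 2
        + 2 * b * (w x 0 * G x 1 0 - w x 1 * G x 0 0) * (w x 0 * G x 1 1 - w x 1 * G x 0 1)
        + c * (w x 0 * G x 1 1 - w x 1 * G x 0 1) ^ 2) := by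
    refine integral_congr_ae ?_
    filter_upwards [h.1.2, hv.ae_grad_eq_tensor h.1.2] with x hx hG
    have := hφ (w x) !₂[w x 0 * G x 1 0 - w x 1 * G x 0 0, w x 0 * G x 1 1 - w x 1 * G x 0 1] hx
    rw [← hG] at this
    simpa using this
  rw [h2]
  refine le_trans (mul_le_mul_of_nonneg_left ?_ (by positivity)) h1
  refine le_trans (le_of_eq ?_) (le_radialPrimitive (by positivity) hrR)
  -- The ratio `t / (4 s)` is a square, which compensates the `1 / 2` in front of the logarithm.
  -- What is lost, `log (2 (a + c) / D)`, does not depend on `r` and `R`.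
  have h3 : D ^ 2 / (a + c) * R ^ 2 / (4 * ((a + c) * r ^ 2)) = (R / r / (2 * (a + c) / D)) ^ 2 := by
    field_simp
    norm_num
  rw [h3, Real.log_pow,
    Real.log_div (x := R / r) (y := 2 * (a + c) / D) (by positivity) (by positivity)]
  push_cast
  ring

/-! ### Phase maps -/

/-- A lifting of the phase relative to `p`: the logarithm is taken of `q / p`, which is near `1`
when `q` is near `p`, so smoothness and derivatives at `p` do not meet the branch cut. It also
covers negative `z`. -/
theorem phase_zpow_eq {p q : ℂ} (hp : p ≠ 0) (hq : q ≠ 0) (z : ℤ) :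
    (q / ‖q‖) ^ z = Complex.exp (Complex.I * (z * (Complex.log (q / p)).im : ℝ)) * (p / ‖p‖) ^ z := by
  have h1 : ((‖q / p‖ : ℝ) : ℂ) ≠ 0 := by simpa using div_ne_zero hq hp
  have h2 : Complex.exp (Complex.arg (q / p) * Complex.I) = q / p / (‖q / p‖ : ℝ) := by
    rw [eq_div_iff h1, mul_comm, Complex.norm_mul_exp_arg_mul_I]
  have h3 : Complex.I * ((z * (Complex.log (q / p)).im : ℝ) : ℂ)
      = z * (Complex.arg (q / p) * Complex.I) := by
    rw [Complex.log_im]; push_cast; ring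
  rw [h3, Complex.exp_int_mul, h2, ← mul_zpow]
  congr 1
  have hp' : (‖p‖ : ℂ) ≠ 0 := by simpa using hp
  have hq' : (‖q‖ : ℂ) ≠ 0 := by simpa using hq
  rw [norm_div]
  push_cast
  field_simp

theorem norm_phase_zpow {p : ℂ} (hp : p ≠ 0) (z : ℤ) : ‖(p / ‖p‖) ^ z‖ = 1 := by
  rw [norm_zpow, norm_div, Complex.norm_real, norm_norm, div_self (norm_ne_zero_iff.2 hp), one_zpow]

theorem contDiffAt_phase_zpow {f : Plane → ℂ} {x : Plane} (hf : ContDiffAt ℝ ∞ f x) (hx : f x ≠ 0)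
    (z : ℤ) : ContDiffAt ℝ ∞ (fun y => (f y / ‖f y‖) ^ z) x := by
  have hlog : ContDiffAt ℝ ∞ (fun y => Complex.log (f y / f x)) x :=
    ((Complex.contDiffAt_log (by rw [div_self hx]; exact Complex.one_mem_slitPlane)).restrict_scalars
      ℝ).comp x (hf.div_const (f x))
  have h1 : ContDiffAt ℝ ∞ (fun y => ((z * (Complex.log (f y / f x)).im : ℝ) : ℂ)) x :=
    Complex.ofRealCLM.contDiff.contDiffAt.comp x
      (contDiffAt_const.mul (Complex.imCLM.contDiff.contDiffAt.comp x hlog))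
  have h2 := ((contDiffAt_const (c := Complex.I)).mul h1).cexp.mul
    (contDiffAt_const (c := (f x / (‖f x‖ : ℂ)) ^ z))
  refine h2.congr_of_eventuallyEq ?_
  filter_upwards [hf.continuousAt.eventually_ne hx] with y hy
  exact phase_zpow_eq hx hy z

theorem fderiv_phase_zpow {f : Plane → ℂ} {x : Plane} {f' : Plane →L[ℝ] ℂ} (hf : HasFDerivAt f f' x)
    (hx : f x ≠ 0) (z : ℤ) (h : Plane) :
    fderiv ℝ (fun y => (f y / ‖f y‖) ^ z) x h
      = ((z * (f' h / f x).im : ℝ) : ℂ) * (Complex.I * (f x / ‖f x‖) ^ z) := by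
  have hdiv : HasFDerivAt (fun y => f y / f x) ((f x)⁻¹ • f') x := by
    simpa only [div_eq_mul_inv] using hf.mul_const ((f x)⁻¹)
  have hl : HasFDerivAt Complex.log (((f x / f x)⁻¹ : ℂ) • (1 : ℂ →L[ℝ] ℂ)) (f x / f x) :=
    (Complex.hasDerivAt_log (by
      rw [div_self hx]; exact Complex.one_mem_slitPlane)).complexToReal_fderiv
  have hlog := Complex.imCLM.hasFDerivAt.comp x (hl.comp x hdiv)
  have h1 := Complex.ofRealCLM.hasFDerivAt.comp x (hlog.const_mul (z : ℝ))
  have h2 := (h1.const_mul Complex.I).cexp.mul_const ((f x / (‖f x‖ : ℂ)) ^ z)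
  have h3 := h2.congr_of_eventuallyEq (f₁ := fun y => (f y / ‖f y‖) ^ z) (by
    filter_upwards [hf.continuousAt.eventually_ne hx] with y hy
    exact phase_zpow_eq hx hy z)
  rw [h3.fderiv, div_eq_mul_inv (f' h), mul_comm (f' h), Complex.mul_im]
  simp [div_self hx]
  ring

/-! ### The competitor -/

/-- The linear map `ζ(x) = D x₁ + i (a x₂ - b x₁)`, which turns ellipses into circles. -/
def ellipticMap (a b D : ℝ) : Plane →L[ℝ] ℂ :=
  (D • (EuclideanSpace.proj 0 : Plane →L[ℝ] ℝ)).smulRight 1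
    + (a • (EuclideanSpace.proj 1 : Plane →L[ℝ] ℝ)
      - b • (EuclideanSpace.proj 0 : Plane →L[ℝ] ℝ)).smulRight Complex.I

theorem ellipticMap_apply (a b D : ℝ) (x : Plane) :
    ellipticMap a b D x = ⟨D * x 0, a * x 1 - b * x 0⟩ := by
  apply Complex.ext <;> simp [ellipticMap]

/-- The inverse of the identification of `ℝ²` with `ℂ`. -/
def ofC : ℂ →L[ℝ] Plane :=
  Complex.reCLM.smulRight (e 0) + Complex.imCLM.smulRight (e 1)

@[simp] theorem ofC_zero (p : ℂ) : ofC p 0 = p.re := by simp [ofC, e]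

@[simp] theorem ofC_one (p : ℂ) : ofC p 1 = p.im := by simp [ofC, e]

theorem toC_ofC (p : ℂ) : toC (ofC p) = p := by
  apply Complex.ext <;> simp [toC]

theorem norm_ofC (p : ℂ) : ‖ofC p‖ = ‖p‖ := by rw [← norm_toC, toC_ofC]

theorem ofC_I_mul (p : ℂ) : ofC (Complex.I * p) = perp (ofC p) := by
  ext i; fin_cases i <;> simp [perp]

/-- The vortex `(ζ/|ζ|)^z`, smoothly cut off near the origin. -/
def vortex (a b D r : ℝ) (z : ℤ) (x : Plane) : Plane :=
  Real.smoothTransition (4 * ‖x‖ ^ 2 / r ^ 2 - 1) •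
    ofC ((ellipticMap a b D x / ‖ellipticMap a b D x‖) ^ z)

/-- The cutoff already reaches `1` at `‖x‖² = r² / 2`, so derivatives on the inner circle itself are
those of the pure phase. -/
theorem vortex_eventuallyEq (a b D : ℝ) {r : ℝ} (hr : 0 < r) (z : ℤ) {x : Plane} (hx : r ≤ ‖x‖) :
    vortex a b D r z =ᶠ[𝓝 x]
      fun x => ofC ((ellipticMap a b D x / ‖ellipticMap a b D x‖) ^ z) := by
  have h1 : r ^ 2 / 2 < ‖x‖ ^ 2 := by nlinarith
  filter_upwards [((continuous_norm (E := Plane)).pow 2).continuousAt.eventually (lt_mem_nhds h1)] with y hy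
  replace hy : r ^ 2 / 2 < ‖y‖ ^ 2 := hy
  rw [vortex, Real.smoothTransition.one_of_one_le, one_smul]
  rw [le_sub_iff_add_le, le_div_iff₀ (by positivity)]
  linarith

namespace IsEllipticForm

variable {a b c D : ℝ}

theorem normSq_ellipticMap (h : IsEllipticForm a b c D) (x : Plane) :
    Complex.normSq (ellipticMap a b D x) = a * dualForm a b c x := by
  rw [ellipticMap_apply, Complex.normSq_mk, dualForm]
  linear_combination x 0 ^ 2 * h.sq_eq

theorem ellipticMap_ne_zero (h : IsEllipticForm a b c D) {x : Plane} (hx : x ≠ 0) :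
    ellipticMap a b D x ≠ 0 := by
  rw [← Complex.normSq_pos, h.normSq_ellipticMap]
  exact mul_pos h.a_pos (h.dualForm_pos hx)

/-- As a real linear map `ζ` has determinant `a D`, and `|ζ|² = a q`; the factor `a` cancels. -/
theorem im_ellipticMap_div (h : IsEllipticForm a b c D) (x v : Plane) :
    (ellipticMap a b D v / ellipticMap a b D x).im
      = D * (x 0 * v 1 - x 1 * v 0) / dualForm a b c x := by
  have ha := h.a_pos.ne'
  rw [Complex.div_im, h.normSq_ellipticMap, ellipticMap_apply, ellipticMap_apply]
  rcases eq_or_ne (dualForm a b c x) 0 with h0 | h0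
  · simp [h0]
  · field_simp
    ring

theorem contDiff_vortex (h : IsEllipticForm a b c D) {r : ℝ} (hr : 0 < r) (z : ℤ) :
    ContDiff ℝ ∞ (vortex a b D r z) := by
  refine contDiff_iff_contDiffAt.2 fun x => ?_
  rcases eq_or_ne x 0 with rfl | hx
  · refine contDiffAt_const (c := (0 : Plane)) |>.congr_of_eventuallyEq ?_
    have h1 : ‖(0 : Plane)‖ ^ 2 < r ^ 2 / 4 := by
      rw [norm_zero, zero_pow two_ne_zero]; positivity
    filter_upwards [((continuous_norm (E := Plane)).pow 2).continuousAt.eventually (gt_mem_nhds h1)] with y hy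
    replace hy : ‖y‖ ^ 2 < r ^ 2 / 4 := hy
    rw [vortex, Real.smoothTransition.zero_of_nonpos, zero_smul]
    rw [sub_nonpos, div_le_one (by positivity)]
    linarith
  · have hS : ContDiff ℝ ∞ Real.smoothTransition := Real.smoothTransition.contDiff
    have h1 : ContDiff ℝ ∞ fun x : Plane => Real.smoothTransition (4 * ‖x‖ ^ 2 / r ^ 2 - 1) :=
      hS.comp (((contDiff_const.mul (contDiff_norm_sq ℝ)).div_const _).sub contDiff_const)
    exact h1.contDiffAt.smul (ofC.contDiff.contDiffAt.comp x
      (contDiffAt_phase_zpow (ellipticMap a b D).contDiff.contDiffAt (h.ellipticMap_ne_zero hx) z))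

theorem ne_zero_of_le_norm {r : ℝ} (hr : 0 < r) {x : Plane} (hx : r ≤ ‖x‖) : x ≠ 0 :=
  norm_pos_iff.1 (hr.trans_le hx)

theorem norm_vortex (h : IsEllipticForm a b c D) {r : ℝ} (hr : 0 < r) (z : ℤ) {x : Plane}
    (hx : r ≤ ‖x‖) : ‖vortex a b D r z x‖ = 1 := by
  rw [(vortex_eventuallyEq a b D hr z hx).eq_of_nhds, norm_ofC,
    norm_phase_zpow (h.ellipticMap_ne_zero (ne_zero_of_le_norm hr hx))]

theorem fderiv_vortex (h : IsEllipticForm a b c D) {r : ℝ} (hr : 0 < r) (z : ℤ) {x : Plane}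
    (hx : r ≤ ‖x‖) (v : Plane) : fderiv ℝ (vortex a b D r z) x v
      = (z * (D * (x 0 * v 1 - x 1 * v 0) / dualForm a b c x)) • perp (vortex a b D r z x) := by
  have hx0 := h.ellipticMap_ne_zero (ne_zero_of_le_norm hr hx)
  have heq := vortex_eventuallyEq a b D hr z hx
  have hd : DifferentiableAt ℝ
      (fun x => (ellipticMap a b D x / (‖ellipticMap a b D x‖ : ℂ)) ^ z) x :=
    (contDiffAt_phase_zpow (ellipticMap a b D).contDiff.contDiffAt hx0 z).differentiableAt (by simp)
  have h1 : HasFDerivAt (fun x => ofC ((ellipticMap a b D x / ‖ellipticMap a b D x‖) ^ z)) _ x :=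
    ofC.hasFDerivAt.comp x hd.hasFDerivAt
  rw [heq.fderiv_eq, h1.fderiv, ContinuousLinearMap.comp_apply,
    fderiv_phase_zpow (ellipticMap a b D).hasFDerivAt hx0, ← Complex.real_smul, map_smul, ofC_I_mul,
    h.im_ellipticMap_div, heq.eq_of_nhds]

theorem circulation_vortex (h : IsEllipticForm a b c D) {r : ℝ} (hr : 0 < r) (z : ℤ) :
    circulation (vortex a b D r z) r = 2 * Real.pi * z := by
  have h1 : ∀ θ, vortex a b D r z (pol r θ) 0
        * fderiv ℝ (vortex a b D r z) (pol r θ) (perp (pol r θ)) 1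
      - vortex a b D r z (pol r θ) 1 * fderiv ℝ (vortex a b D r z) (pol r θ) (perp (pol r θ)) 0
      = z * (D * (1 / dualForm a b c (pol 1 θ))) := by
    intro θ
    have hp : r ≤ ‖pol r θ‖ := (norm_pol hr.le θ).ge
    have hn := h.norm_vortex hr z hp
    have hn' : vortex a b D r z (pol r θ) 0 ^ 2 + vortex a b D r z (pol r θ) 1 ^ 2 = 1 := by
      rw [← norm_sq_plane, hn, one_pow]
    have hq : pol r θ 0 * perp (pol r θ) 1 - pol r θ 1 * perp (pol r θ) 0 = r ^ 2 := by
      have := norm_sq_plane (pol r θ)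
      rw [norm_pol hr.le] at this
      rw [this]; simp [perp]; ring
    have hpos := (h.dualForm_pol_pos one_pos θ).ne'
    rw [h.fderiv_vortex hr z hp, hq, dualForm_pol]
    simp only [PiLp.smul_apply, smul_eq_mul, perp, Matrix.cons_val_zero,
      Matrix.cons_val_one]
    field_simp
    linear_combination (z : ℝ) * D * hn'
  simp only [circulation, h1, intervalIntegral.integral_const_mul]
  rw [← intervalIntegral.integral_const_mul, h.integral_inv_dualForm]
  ring

/-- The cut-off vortex is smooth on the whole plane, so the constant sequence approximates it and
its restriction to the circle is its trace. `H^{1/2}` summability comes from the trace inequality.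
-/
theorem admissible_vortex (h : IsEllipticForm a b c D) {r R : ℝ} (hr : 0 < r) (hR : r < R)
    (z : ℤ) : Admissible r R z (vortex a b D r z)
      fun x => Matrix.of fun i j => fderiv ℝ (vortex a b D r z) x (e j) i := by
  have hv := h.contDiff_vortex hr z
  have hvd := hv.differentiable (by simp)
  have hvi : ∀ i : Fin 2, ContDiff ℝ ∞ fun x => vortex a b D r z x i := fun i =>
    (EuclideanSpace.proj i : Plane →L[ℝ] ℝ).contDiff.comp hv
  have hc : Continuous fun θ : Angle => toC (vortex a b D r z (circlePoint r θ)) :=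
    (contDiff_toC_comp hv).continuous.comp (continuous_circlePoint r)
  refine ⟨⟨fun i => ⟨memLp_annulus_of_continuous (hvi i).continuous _ _ _,
    memLp_annulus_of_continuous ?_ _ _ _, fun j => ?_⟩, ?_⟩,
    fun θ => toC (vortex a b D r z (circlePoint r θ)), ⟨fun _ => vortex a b D r z, fun _ => hv,
      ?_, fun i j => ?_, ?_⟩, ⟨hc.aestronglyMeasurable, ae_of_all _ fun θ => ?_, ?_⟩, ?_⟩
  · refine (PiLp.continuous_toLp 2 _).comp (continuous_pi fun j => ?_)
    exact (EuclideanSpace.proj i : Plane →L[ℝ] ℝ).continuous.comp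
      ((hv.continuous_fderiv (by simp)).clm_apply continuous_const)
  · have := IsWeakPartial.of_contDiff ((hvi i).of_le (by simp)) (annulus r R) j
    simpa only [fderiv_component hvd, Matrix.of_apply] using this
  · filter_upwards [ae_restrict_mem (isOpen_annulus r R).measurableSet] with x hx
    exact h.norm_vortex hr z hx.1.le
  · simp
  · simp
  · simp
  · rw [norm_toC, h.norm_vortex hr z (norm_circlePoint hr.le θ).ge]
  · exact summable_of_sum_le (fun k => by positivity)
      fun s => trace_inequality (contDiff_toC_comp hv) hr hR s
  · rw [circleDegree_eq_tsum, (hasSum_circulation hv r).tsum_eq, h.circulation_vortex hr]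
    field_simp

/-- The angular velocity is `ξ = z D (-x₁, x₀) / q`, and the form of `A` at `(-x₁, x₀)` is `q`. The
density is thus `z² D² / q`, homogeneous of degree `-2`, and its radial integral is exactly a
logarithm. -/
theorem setIntegral_vortex (h : IsEllipticForm a b c D) {r R : ℝ} (hr : 0 < r) (hR : r < R)
    (z : ℤ) {φ : Plane → Mat → ℝ}
    (hφ : ∀ p ξ : Plane, ‖p‖ = 1 → φ p (tensor (perp p) ξ)
      = a * ξ 0 ^ 2 + 2 * b * ξ 0 * ξ 1 + c * ξ 1 ^ 2) :
    ∫ x in annulus r R, φ (vortex a b D r z x)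
        (Matrix.of fun i j => fderiv ℝ (vortex a b D r z) x (e j) i)
      = 2 * Real.pi * D * (z : ℝ) ^ 2 * Real.log (R / r) := by
  have hpos : ∀ x : Plane, r ≤ ‖x‖ → dualForm a b c x ≠ 0 := fun x hx =>
    (h.dualForm_pos (ne_zero_of_le_norm hr hx)).ne'
  have h1 : ∫ x in annulus r R, φ (vortex a b D r z x)
      (Matrix.of fun i j => fderiv ℝ (vortex a b D r z) x (e j) i)
      = ∫ x in annulus r R, (z : ℝ) ^ 2 * D ^ 2 / dualForm a b c x := by
    refine setIntegral_congr_fun (isOpen_annulus r R).measurableSet fun x hx => ?_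
    have hx' := hpos x hx.1.le
    have hG : (Matrix.of fun i j => fderiv ℝ (vortex a b D r z) x (e j) i)
        = tensor (perp (vortex a b D r z x)) !₂[-(z * D * x 1 / dualForm a b c x),
          z * D * x 0 / dualForm a b c x] := by
      ext i j
      rw [Matrix.of_apply, h.fderiv_vortex hr z hx.1.le, tensor, Matrix.of_apply]
      fin_cases j <;> simp [e] <;> ring
    dsimp only
    rw [hG, hφ _ _ (h.norm_vortex hr z hx.1.le)]
    simp only [Matrix.cons_val_zero, Matrix.cons_val_one]
    field_simp
    rw [dualForm]
    ring
  have hcont : ContinuousOn (fun x => (z : ℝ) ^ 2 * D ^ 2 / dualForm a b c x)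
      {x | r ≤ ‖x‖ ∧ ‖x‖ ≤ R} :=
    continuousOn_const.div (contDiff_dualForm a b c).continuous.continuousOn fun x hx => hpos x hx.1
  rw [h1, setIntegral_annulus_eq hr hR.le hcont]
  have h2 : ∀ ρ ∈ uIcc r R, ∫ θ in (-Real.pi)..Real.pi,
      ρ * ((z : ℝ) ^ 2 * D ^ 2 / dualForm a b c (pol ρ θ))
      = 2 * Real.pi * D * (z : ℝ) ^ 2 * (1 / ρ) := by
    intro ρ hρ
    rw [uIcc_of_le hR.le] at hρ
    have hρ0 : ρ ≠ 0 := (hr.trans_le hρ.1).ne'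
    have h3 : ∀ θ, ρ * ((z : ℝ) ^ 2 * D ^ 2 / dualForm a b c (pol ρ θ))
        = D * (z : ℝ) ^ 2 * (1 / ρ) * (D * (1 / dualForm a b c (pol 1 θ))) := by
      intro θ
      have := (h.dualForm_pol_pos one_pos θ).ne'
      rw [dualForm_pol]
      field_simp
    simp only [h3]
    rw [intervalIntegral.integral_const_mul, h.integral_inv_dualForm]
    ring
  rw [intervalIntegral.integral_congr h2, intervalIntegral.integral_const_mul,
    integral_one_div_of_pos hr (hr.trans hR)]

end IsEllipticForm

/-! ### The cost of a singularity -/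

theorem tendsto_ratio_fatAnnuli : Tendsto (fun p : ℝ × ℝ => p.2 / p.1) fatAnnuli atTop :=
  tendsto_comap.mono_left inf_le_left

theorem eventually_fatAnnuli : ∀ᶠ p in fatAnnuli, 0 < p.1 ∧ p.1 < p.2 :=
  mem_inf_of_right (mem_principal_self _)

/-- Nontriviality of the filter makes limits along it unique, so `limUnder` in `psi` returns the
computed limit. -/
instance instNeBotFatAnnuli : fatAnnuli.NeBot := by
  have h : Tendsto (fun t : ℝ => ((1 : ℝ), t)) atTop fatAnnuli := by
    refine tendsto_inf.2 ⟨tendsto_comap_iff.2 ?_, tendsto_principal.2 ?_⟩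
    · simp only [Function.comp_def, div_one]
      exact tendsto_id
    · filter_upwards [eventually_gt_atTop 1] with t ht
      exact ⟨one_pos, ht⟩
  exact h.neBot

/-- Squared, the hypothesis on `R / r` says `4 s ≤ t`, so the test function has room for its
logarithmic part; the vortex bound needs only `r < R`. -/
theorem IsEllipticForm.psiAnnulus_bounds {a b c D : ℝ} (h : IsEllipticForm a b c D)
    {φ : Plane → Mat → ℝ} (hφ : ∀ p ξ : Plane, ‖p‖ = 1 → φ p (tensor (perp p) ξ)
      = a * ξ 0 ^ 2 + 2 * b * ξ 0 * ξ 1 + c * ξ 1 ^ 2) (z : ℤ) {r R : ℝ} (hr : 0 < r) (hR : r < R)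
    (hrR : 2 * (a + c) / D ≤ R / r) :
    2 * Real.pi * D * (z : ℝ) ^ 2 * (1 - Real.log (2 * (a + c) / D) / Real.log (R / r))
        ≤ psiAnnulus φ z r R ∧
      psiAnnulus φ z r R ≤ 2 * Real.pi * D * (z : ℝ) ^ 2 := by
  have hac : 0 < a + c := add_pos h.a_pos h.c_pos
  have hD := h.D_pos
  have hlog : 0 < Real.log (R / r) := Real.log_pos ((one_lt_div hr).2 hR)
  have hrR' : 4 * ((a + c) * r ^ 2) ≤ D ^ 2 / (a + c) * R ^ 2 := by
    rw [div_le_div_iff₀ hD hr] at hrR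
    rw [div_mul_eq_mul_div, le_div_iff₀ hac]
    have := mul_self_le_mul_self (by positivity) hrR
    nlinarith
  have hlb : ∀ E ∈ {E : ℝ | ∃ w G, Admissible r R z w G ∧
      E = ∫ x in annulus r R, φ (w x) (G x)},
      2 * Real.pi * D * (z : ℝ) ^ 2 * (Real.log (R / r) - Real.log (2 * (a + c) / D)) ≤ E := by
    rintro E ⟨w, G, hw, rfl⟩
    exact hw.le_setIntegral hr hR h hφ hrR'
  have hmem : 2 * Real.pi * D * (z : ℝ) ^ 2 * Real.log (R / r) ∈
      {E : ℝ | ∃ w G, Admissible r R z w G ∧ E = ∫ x in annulus r R, φ (w x) (G x)} :=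
    ⟨_, _, h.admissible_vortex hr hR z, (h.setIntegral_vortex hr hR z hφ).symm⟩
  have h1 := le_csInf ⟨_, hmem⟩ hlb
  have h2 := csInf_le ⟨_, hlb⟩ hmem
  rw [psiAnnulus]
  constructor
  · refine le_trans (le_of_eq ?_) (mul_le_mul_of_nonneg_left h1 (one_div_pos.2 hlog).le)
    field_simp
  · refine (mul_le_mul_of_nonneg_left h2 (one_div_pos.2 hlog).le).trans_eq ?_
    field_simp

theorem IsEllipticForm.tendsto_psiAnnulus {a b c D : ℝ} (h : IsEllipticForm a b c D)
    {φ : Plane → Mat → ℝ} (hφ : ∀ p ξ : Plane, ‖p‖ = 1 → φ p (tensor (perp p) ξ)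
      = a * ξ 0 ^ 2 + 2 * b * ξ 0 * ξ 1 + c * ξ 1 ^ 2) (z : ℤ) :
    Tendsto (fun p : ℝ × ℝ => psiAnnulus φ z p.1 p.2) fatAnnuli
      (𝓝 (2 * Real.pi * D * (z : ℝ) ^ 2)) := by
  have hb : ∀ᶠ p in fatAnnuli, 2 * Real.pi * D * (z : ℝ) ^ 2
        * (1 - Real.log (2 * (a + c) / D) / Real.log (p.2 / p.1)) ≤ psiAnnulus φ z p.1 p.2 ∧
      psiAnnulus φ z p.1 p.2 ≤ 2 * Real.pi * D * (z : ℝ) ^ 2 := by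
    filter_upwards [eventually_fatAnnuli,
      tendsto_ratio_fatAnnuli.eventually_ge_atTop (2 * (a + c) / D)] with p hp hp'
    exact h.psiAnnulus_bounds hφ z hp.1 hp.2 hp'
  have hl : Tendsto (fun p : ℝ × ℝ => 2 * Real.pi * D * (z : ℝ) ^ 2
      * (1 - Real.log (2 * (a + c) / D) / Real.log (p.2 / p.1))) fatAnnuli
      (𝓝 (2 * Real.pi * D * (z : ℝ) ^ 2)) := by
    have h1 : Tendsto (fun p : ℝ × ℝ => Real.log (2 * (a + c) / D) / Real.log (p.2 / p.1))
        fatAnnuli (𝓝 0) :=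
      tendsto_const_nhds.div_atTop (Real.tendsto_log_atTop.comp tendsto_ratio_fatAnnuli)
    simpa using (h1.const_sub 1).const_mul (2 * Real.pi * D * (z : ℝ) ^ 2)
  exact tendsto_of_tendsto_of_tendsto_of_le_of_le' hl tendsto_const_nhds
    (hb.mono fun _ h => h.1) (hb.mono fun _ h => h.2)

end VortexHom

end

/-! ### Assembly of the proposition. -/

theorem mainTheorem6 (α β : ℝ) (hα : 0 < α) (hαβ : α ≤ β)
    (a : VortexHom.Plane → ℝ) (ha_meas : Measurable a) (ha_per : VortexHom.IsPeriodic a)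
    (ha_bdd : ∀ y, α ≤ a y ∧ a y ≤ β)
    (f : VortexHom.Plane → VortexHom.Mat → ℝ) (hf : ∀ y M, f y M = a y * VortexHom.frobSq M) :
    -- the matrix of the homogenized quadratic form is well defined
    ((VortexHom.Ahom a).IsSymm ∧ 0 < (VortexHom.Ahom a).det ∧
      ∀ ξ : VortexHom.Plane,
        ∑ i, ∑ j, VortexHom.Ahom a i j * ξ i * ξ j = VortexHom.cellEnergy a ξ) ∧
    -- the limit defining the tangential homogenization exists
    (∀ s ξ : VortexHom.Plane, ‖s‖ = 1 →
      Tendsto (VortexHom.tangentialCell f s (VortexHom.tensor (VortexHom.perp s) ξ)) atTop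
        (𝓝 (VortexHom.TfHom f s (VortexHom.tensor (VortexHom.perp s) ξ)))) ∧
    -- the limit defining the cost of a single singularity exists, with its value
    (∀ z : ℤ,
      Tendsto (fun p : ℝ × ℝ => VortexHom.psiAnnulus (VortexHom.TfHom f) z p.1 p.2)
        VortexHom.fatAnnuli (𝓝 (VortexHom.psi (VortexHom.TfHom f) z)) ∧
      VortexHom.psi (VortexHom.TfHom f) z =
        2 * Real.pi * √(VortexHom.Ahom a).det * (z : ℝ) ^ 2) ∧
    -- the effective cost
    ∀ z : ℤ, VortexHom.Psi (VortexHom.TfHom f) z =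
      2 * Real.pi * √(VortexHom.Ahom a).det * |(z : ℝ)| := by
  have ha0 : ∀ y, 0 ≤ a y := fun y => hα.le.trans (ha_bdd y).1
  have haβ : ∀ y, 0 ≤ a y ∧ a y ≤ β := fun y => ⟨ha0 y, (ha_bdd y).2⟩
  have hsmul := fun t ξ => VortexHom.cellEnergy_smul (a := a) ha0 t ξ
  have hsum : ∀ ξ : VortexHom.Plane,
      ∑ i, ∑ j, VortexHom.Ahom a i j * ξ i * ξ j = VortexHom.cellEnergy a ξ :=
    VortexHom.sum_Ahom_eq a (fun x y => VortexHom.cellEnergy_parallelogram ha_meas haβ x y) hsmul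
      (fun ξ => VortexHom.cellEnergy_nonneg ha0 ξ)
  have hsymm : (VortexHom.Ahom a).IsSymm :=
    VortexHom.isSymm_Ahom a fun x => by simpa using hsmul (-1) x
  obtain ⟨hA0, hA1, hdet⟩ := VortexHom.det_pos_of_coercive (VortexHom.Ahom a) hsymm hα fun ξ => by
    rw [hsum]
    exact VortexHom.cellEnergy_coercive ha_meas ha_per hα ha_bdd ξ
  have hs' : VortexHom.Ahom a 1 0 = VortexHom.Ahom a 0 1 := hsymm.apply 0 1
  have hE : VortexHom.IsEllipticForm (VortexHom.Ahom a 0 0) (VortexHom.Ahom a 0 1)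
      (VortexHom.Ahom a 1 1) (√(VortexHom.Ahom a).det) := by
    refine ⟨hA0, hA1, Real.sqrt_pos.2 hdet, ?_⟩
    rw [Real.sq_sqrt hdet.le, Matrix.det_fin_two, hs']
    ring
  -- `TfHom` is identified only at unit vectors and tangential matrices. That is enough, since
  -- gradients of `S¹`-valued maps are tangential almost everywhere.
  have hTf : ∀ p ξ : VortexHom.Plane, ‖p‖ = 1 →
      VortexHom.TfHom f p (VortexHom.tensor (VortexHom.perp p) ξ)
        = VortexHom.Ahom a 0 0 * ξ 0 ^ 2 + 2 * VortexHom.Ahom a 0 1 * ξ 0 * ξ 1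
          + VortexHom.Ahom a 1 1 * ξ 1 ^ 2 := by
    intro p ξ hp
    rw [VortexHom.TfHom_eq_cellEnergy ha_meas ha_per haβ hf hp, ← hsum]
    simp only [Fin.sum_univ_two, hs']
    ring
  have hpsi := fun z => hE.tendsto_psiAnnulus hTf z
  have hval : ∀ z : ℤ, VortexHom.psi (VortexHom.TfHom f) z
      = 2 * Real.pi * √(VortexHom.Ahom a).det * (z : ℝ) ^ 2 := fun z => (hpsi z).limUnder_eq
  refine ⟨⟨hsymm, hdet, hsum⟩, fun s ξ hs => ?_, fun z => ⟨?_, hval z⟩, fun z => ?_⟩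
  · rw [VortexHom.TfHom_eq_cellEnergy ha_meas ha_per haβ hf hs]
    exact VortexHom.tendsto_tangentialCell ha_meas ha_per haβ hf hs ξ
  · rw [hval]
    exact hpsi z
  · exact VortexHom.Psi_eq_of_psi_eq_sq (VortexHom.TfHom f)
      (mul_nonneg Real.two_pi_pos.le (Real.sqrt_nonneg _)) hval z
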